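/- **Conventions.** A $C^*$-category is a (possibly non-unital) $\mathbb C$-linear category with small Hom-sets which are Banach spaces, with an antilinear involution $f\mapsto f^*$ from $\mathrm{Hom}(X,Y)$ to $\mathrm{Hom}(Y,X)$ reversing composition, such that $\|gf\|\le\|g\|\|f\|$, $\|f^*f\|=\|f\|^2=\|f^*\|^2$ and $f^*f$ is positive in the $C^*$-algebra $\mathrm{Hom}(X,X)$. $C^*$-functors ($*$-functors) are linear and preserve composition and $*$; they need not preserve units. In a unital $C^*$-category an isometric isomorphism is a morphism $f$ with $f^*f=1$ and $ff^*=1$; isomorphisms of objects and of functors, and equivalences, are understood to be isometric. A Hilbert $\mathcal D$-module $H$ assigns to each object $d$ a complex vector space $H(d)$, with a right action of the morphisms of $\mathcal D$ and an inner product $\langle h,h'\rangle\in \mathrm{Hom}(d',d)$ for $h\in H(d)$, $h'\in H(d')$ that is $\mathcal D$-linear in $h'$, with $\langle h,h'\rangle^*=\langle h',h\rangle$ and $\langle h,h\rangle$ positive, each $H(d)$ being complete for $\|h\|=\|\langle h,h\rangle\|^{1/2}$. It is small if it is generated (as a closed submodule) by a set of elements. $\mathcal H\mathcal D$ is the category of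 small Hilbert $\mathcal D$-modules and adjointable bounded operators; $\mathbb Y_X=\mathrm{Hom}(-,X)$, with $\langle u,v\rangle=u^*v$, defines the Yoneda embedding $\mathbb Y$ of a unital $C^*$-category $\mathcal D$ into $\mathcal H\mathcal D$. A $C^*$-functor $f:\mathcal D\to\mathcal C$ to a unital $C^*$-category induces $\mathcal Hf:\mathcal H\mathcal D\to\mathcal H\mathcal C$, where $(\mathcal Hf)H$ is the completed module generated by symbols $h\otimes g$ ($h\in H(d)$, $g:B\to f(d)$) with $\langle h\otimes g,h'\otimes g'\rangle=g^*f(\langle h,h'\rangle)g'$. A pre-complete $C^*$-category is a unital $C^*$-category $\mathcal C$ with a $C^*$-functor $L:\mathcal H\mathcal C\to\mathcal C$ and an isometric isomorphism of functors $\mathrm{Id}_{\mathcal C}\simeq L\circ\mathbb Y$. One puts $f_*H=L((\mathcal Hf)H)$. Every $a\in H(A)$, viewed as an operator $\mathbb Y_A\to H$, gives a morphism $A\simeq L\mathbb Y_A\to LH$; this embeds $H$ isometrically in $\mathbb Y_{LH}$. In particular (taking the element $h\otimes 1$) each $h\in H(d)$ has a structural morphism $\tilde h:f(d)\to f_*H$,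 and $\tilde h^*\tilde h'=f(\langle h,h'\rangle)$. A hereditary subalgebra $\mathcal A\subset\mathcal C(X)=\mathrm{Hom}(X,X)$ is a closed $*$-subalgebra with $\mathcal A\,\mathcal C(X)\,\mathcal A\subset\mathcal A$; $\mathcal AX\subset\mathbb Y_X$ is the submodule $B\mapsto\{h:B\to X\mid hh^*\in\mathcal A\}$. $\mathcal A$ is weakly dense if there is an isometric isomorphism $L(\mathcal AX)\simeq X$ compatible with the inclusions of $\mathcal AX$ in $L(\mathcal AX)$ and in $X$. * (C1): for all $H\in\mathcal H\mathcal C$ and $\lambda:LH\to A$, if the restriction of $\lambda$ to $H\subset\mathbb Y_{LH}$ is zero then $\lambda=0$. * (C3): for hereditary subalgebras $\mathcal A\subset\mathcal B\subset\mathcal C(X)$, if $\mathcal A$ is weakly dense then so is $\mathcal B$. A partial hereditary subcategory $\mathfrak A\subset\mathcal C$ consists of a class $|\mathfrak A|$ of objects of $\mathcal C$ and closed subspaces $\mathfrak A(X,Y)\subset\mathrm{Hom}(X,Y)$ for $X,Y\in|\mathfrak A|$, stable under composition and $*$, such that $hgf\in\mathfrak A$ whenever $h,f\in\mathfrak A$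 and $g$ is any morphism of $\mathcal C$ for which the composite is defined; it is a hereditary subcategory if $|\mathfrak A|=|\mathcal C|$. For example, for an object $X$, $\mathcal C(X)$ is the full subcategory on $X$. Let $i:\mathfrak A\to\mathcal C$ be the inclusion. For $Y\in|\mathcal C|$, $R_{\mathfrak A}Y$ is the Hilbert $\mathfrak A$-module $a\mapsto\{f:a\to Y\mid f^*f\in\mathfrak A\}$, with $\langle f,g\rangle=f^*g$. $Y$ is weakly contained in $\mathfrak A$ if the endomorphisms of $Y$ lying in the closed two-sided ideal of $\mathcal C$ generated by $\mathfrak A$ form a weakly dense subalgebra of $\mathcal C(Y)$; $Y\prec X$ ($Y$ is quasi-contained in $X$) means that $Y$ is weakly contained in $\mathcal C(X)$. $\mathfrak A$ is generating if there is an isometric isomorphism of functors $\mu:\mathrm{Id}_{\mathcal C}\simeq i_*R_{\mathfrak A}$ such that $\mu_Y\circ f$ is the structural morphism $\tilde f:a\to i_*R_{\mathfrak A}Y$ for all $a\in|\mathfrak A|$ and $f:a\to Y$ with $f^*f\in\mathfrak A$; an object $X$ is generating if $\mathcal C(X)$ is. A pre-closure operation on $\mathcal H\mathfrak A$ is a $C^*$-functor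 $P:\mathcal H\mathfrak A\to\mathcal H\mathfrak A$ with isometric inclusions $H\to PH$ natural in $H$; $H$ is closed if this inclusion is an isomorphism, and $P$ is a closure operation if every $PH$ is closed. $R_{\mathfrak A}\circ i_*$, with the inclusions $h\mapsto\tilde h$, is a pre-closure operation. A full subcategory $\mathfrak D\subset\mathcal C$ is a pre-complete full subcategory if it is closed under isometric isomorphism and contains $j_*H$ for every $C^*$-category $\mathcal B$, every $*$-functor $j:\mathcal B\to\mathfrak D$ and every $H\in\mathcal H\mathcal B$; it then carries the induced pre-complete structure $H\mapsto(\mathfrak D\hookrightarrow\mathcal C)_*H$. **Proposition.** Let $\mathcal C$ be a pre-complete $C^*$-category satisfying (C1) and (C3). 1. For objects $X,Y$: $Y\prec X$ if and only if $Y\simeq i_*H$ for some $H\in\mathcal H(\mathcal C(X))$, where $i:\mathcal C(X)\to\mathcal C$ is the inclusion. More generally, if $\mathfrak A\subset\mathcal C$ is a partial hereditary subcategory with inclusion $i$, then $Y$ is weakly contained in $\mathfrak A$ if and only if $Y\simeq i_*H$ for some $H\in\mathcal H\mathfrak A$. 2. $\prec$ is reflexive and transitive. 3. For every hereditary subcategory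 $\mathfrak A\subset\mathcal C$ the pre-closure operation $R_{\mathfrak A}\circ i_*$ on $\mathcal H\mathfrak A$ is a closure operation, and $i_*$ and $R_{\mathfrak A}$ restrict to mutually inverse equivalences between the full subcategory of closed $\mathfrak A$-modules and the full subcategory of $\mathcal C$ of objects weakly contained in $\mathfrak A$. 4. A hereditary subcategory $\mathfrak A$ is generating if and only if every object of $\mathcal C$ is weakly contained in $\mathfrak A$. 5. For every object $X$, the full subcategory $\mathcal C_X$ of the objects $Y\prec X$ is a pre-complete full subcategory of $\mathcal C$, it contains $X$, and it is contained in every pre-complete full subcategory of $\mathcal C$ which contains $X$. 6. $\mathcal C_X$ is the unique pre-complete full subcategory of $\mathcal C$ generated by $X$: if $\mathfrak D$ is a pre-complete full subcategory of $\mathcal C$ with $X\in\mathfrak D$, then $X$ is generating in $\mathfrak D$ (for the induced pre-complete structure) if and only if $\mathfrak D=\mathcal C_X$. -/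

import Mathlib

universe v u w₁ u₁ w₂ u₂ w₃ u₃
namespace HilbCat

section Key
variable {A : Type*} [NonUnitalCStarAlgebra A] [PartialOrder A] [StarOrderedRing A]
open NonUnitalStarAlgebra

theorem exists_approx (p : A) (hp : 0 ≤ p) {δ : ℝ} (hδ : 0 < δ) :
    ∃ r w : A, r ∈ elemental ℂ p ∧ w ∈ elemental ℂ p ∧ star r = r ∧ star w = w ∧
      w = r * p ∧ w = p * r ∧ ‖p - p * w - w * p + w * p * w‖ < δ ∧ 0 ≤ r + r - r * p * r := by
  obtain ⟨ε, hε, hεδ⟩ : ∃ ε : ℝ, 0 < ε ∧ ε < δ ^ 2 :=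
    ⟨δ ^ 2 / 2, by positivity, by have : 0 < δ ^ 2 := by positivity
                                  linarith⟩
  have hpos : ∀ t : ℝ, 0 < ε + t ^ 2 := fun t => by positivity
  set φ : ℝ → ℝ := fun t => t / (ε + t ^ 2) with hφ
  have hφc : Continuous φ := by
    apply Continuous.div (by fun_prop) (by fun_prop)
    intro t; exact (hpos t).ne'
  have hφ0 : φ 0 = 0 := by simp [φ]
  have hsa : IsSelfAdjoint p := .of_nonneg hp
  have hid : cfcₙ (fun t : ℝ => t) p = p := cfcₙ_id' ℝ p
  have hM : ∀ f g : ℝ → ℝ, Continuous f → f 0 = 0 → Continuous g → g 0 = 0 →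
      cfcₙ f p * cfcₙ g p = cfcₙ (fun t => f t * g t) p := fun f g hf hf0 hg hg0 =>
    (cfcₙ_mul f g p hf.continuousOn hf0 hg.continuousOn hg0).symm
  have hic : Continuous (fun t : ℝ => t) := continuous_id
  set ψ : ℝ → ℝ := fun t => φ t * t with hψ
  have hψc : Continuous ψ := hφc.mul hic
  have hψ0 : ψ 0 = 0 := by simp [ψ]
  have h1 : cfcₙ ψ p = cfcₙ φ p * p := by
    have := hM φ (fun t => t) hφc hφ0 hic rfl
    rw [hid] at this
    rw [this]
  have h2 : cfcₙ ψ p = p * cfcₙ φ p := by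
    have := hM (fun t => t) φ hic rfl hφc hφ0
    rw [hid] at this
    rw [this]
    congr 1; funext t; simp [ψ, mul_comm]
  have hmem : ∀ f : ℝ → ℝ, cfcₙ f p ∈ elemental ℂ p := by
    intro f
    rw [cfcₙ_real_eq_complex]
    exact cfcₙ_mem_elemental _ _
  refine ⟨cfcₙ φ p, cfcₙ ψ p, hmem _, hmem _, (cfcₙ_predicate φ p : IsSelfAdjoint _),
    (cfcₙ_predicate ψ p : IsSelfAdjoint _), h1, h2, ?_, ?_⟩
  · have e1 : p * cfcₙ ψ p = cfcₙ (fun t => t * ψ t) p := by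
      have := hM (fun t => t) ψ hic rfl hψc hψ0
      rwa [hid] at this
    have e2 : cfcₙ ψ p * p = cfcₙ (fun t => ψ t * t) p := by
      have := hM ψ (fun t => t) hψc hψ0 hic rfl
      rwa [hid] at this
    have e3 : cfcₙ (fun t => ψ t * t) p * cfcₙ ψ p = cfcₙ (fun t => ψ t * t * ψ t) p :=
      hM (fun t => ψ t * t) ψ (hψc.mul hic) (by simp) hψc hψ0
    have e4 : p - cfcₙ (fun t => t * ψ t) p - cfcₙ (fun t => ψ t * t) p
        + cfcₙ (fun t => ψ t * t * ψ t) p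
        = cfcₙ (fun t => t - t * ψ t - ψ t * t + ψ t * t * ψ t) p := by
      rw [cfcₙ_add (fun t => t - t * ψ t - ψ t * t) (fun t => ψ t * t * ψ t) p
          (by fun_prop) (by simp) (by fun_prop) (by simp),
        cfcₙ_sub (fun t => t - t * ψ t) (fun t => ψ t * t) p
          (by fun_prop) (by simp) (by fun_prop) (by simp),
        cfcₙ_sub (fun t => t) (fun t => t * ψ t) p
          (by fun_prop) (by simp) (by fun_prop) (by simp), hid]
    rw [e1, e2, e3, e4]
    apply norm_cfcₙ_lt
    intro t ht
    have ht0 : 0 ≤ t := quasispectrum_nonneg_of_nonneg p hp t ht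
    have hpt := hpos t
    have key : t - t * ψ t - ψ t * t + ψ t * t * ψ t = t * ε ^ 2 / (ε + t ^ 2) ^ 2 := by
      simp only [ψ, φ]
      field_simp
      ring
    rw [key, Real.norm_of_nonneg (by positivity), div_lt_iff₀ (by positivity)]
    have hs2 : Real.sqrt ε ^ 2 = ε := Real.sq_sqrt hε.le
    have hs : Real.sqrt ε < δ := by
      rw [Real.sqrt_lt' hδ]; exact hεδ
    have hs0 : 0 < Real.sqrt ε := Real.sqrt_pos.2 hε
    have a2 : t * ε ≤ Real.sqrt ε * (ε + t ^ 2) := by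
      have h3 : t * Real.sqrt ε ≤ ε + t ^ 2 := by nlinarith [sq_nonneg (t - Real.sqrt ε)]
      calc t * ε = Real.sqrt ε * (t * Real.sqrt ε) := by linear_combination (-t) * hs2
        _ ≤ _ := mul_le_mul_of_nonneg_left h3 hs0.le
    have a3 : t * ε < δ * (ε + t ^ 2) := a2.trans_lt (mul_lt_mul_of_pos_right hs hpt)
    calc t * ε ^ 2 = (t * ε) * ε := by ring
      _ < (δ * (ε + t ^ 2)) * ε := mul_lt_mul_of_pos_right a3 hε
      _ ≤ (δ * (ε + t ^ 2)) * (ε + t ^ 2) :=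
        mul_le_mul_of_nonneg_left (by nlinarith) (by positivity)
      _ = _ := by ring
  · have e3 : cfcₙ ψ p * cfcₙ φ p = cfcₙ (fun t => ψ t * φ t) p := hM ψ φ hψc hψ0 hφc hφ0
    rw [← h1, e3, ← cfcₙ_add φ φ p hφc.continuousOn hφ0 hφc.continuousOn hφ0,
      ← cfcₙ_sub (fun t => φ t + φ t) (fun t => ψ t * φ t) p (by fun_prop) (by simp [hφ0])
        (by fun_prop) (by simp [hφ0])]
    apply cfcₙ_nonneg
    intro t ht
    have ht0 : 0 ≤ t := quasispectrum_nonneg_of_nonneg p hp t ht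
    have hpt := hpos t
    have hφn : 0 ≤ φ t := by simp only [φ]; positivity
    have hψ1 : ψ t ≤ 1 := by
      simp only [ψ, φ]
      rw [div_mul_eq_mul_div, div_le_one hpt]
      nlinarith
    have : ψ t * φ t ≤ 1 * φ t := mul_le_mul_of_nonneg_right hψ1 hφn
    change (0 : ℝ) ≤ φ t + φ t - ψ t * φ t
    linarith

theorem exists_sqrt_mem (p : A) (hp : 0 ≤ p) :
    ∃ k ∈ elemental ℂ p, star k = k ∧ k * k = p := by
  refine ⟨cfcₙ Real.sqrt p, ?_, (cfcₙ_predicate _ p : IsSelfAdjoint _), ?_⟩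
  · rw [cfcₙ_real_eq_complex]
    exact cfcₙ_mem_elemental _ _
  · rw [← cfcₙ_mul Real.sqrt Real.sqrt p]
    have hsa : IsSelfAdjoint p := .of_nonneg hp
    conv_rhs => rw [← cfcₙ_id' ℝ p]
    apply cfcₙ_congr
    intro t ht
    exact Real.mul_self_sqrt (quasispectrum_nonneg_of_nonneg p hp t ht)
end Key

end HilbCat

namespace HilbCat

noncomputable section

/-- A `ℂ`-linear `*`-category; identities are not required. -/
class StarCat (C : Type u₁) where
  Hom : C → C → Type w₁
  [addCommGroup : ∀ X Y, AddCommGroup (Hom X Y)]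
  [module : ∀ X Y, Module ℂ (Hom X Y)]
  comp : ∀ {X Y Z : C}, Hom Y Z → Hom X Y → Hom X Z
  dag : ∀ {X Y : C}, Hom X Y → Hom Y X
  comp_assoc : ∀ {W X Y Z : C} (h : Hom Y Z) (g : Hom X Y) (f : Hom W X),
    comp (comp h g) f = comp h (comp g f)
  add_comp : ∀ {X Y Z : C} (g g' : Hom Y Z) (f : Hom X Y),
    comp (g + g') f = comp g f + comp g' f
  comp_add : ∀ {X Y Z : C} (g : Hom Y Z) (f f' : Hom X Y),
    comp g (f + f') = comp g f + comp g f'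
  smul_comp : ∀ {X Y Z : C} (c : ℂ) (g : Hom Y Z) (f : Hom X Y),
    comp (c • g) f = c • comp g f
  comp_smul : ∀ {X Y Z : C} (c : ℂ) (g : Hom Y Z) (f : Hom X Y),
    comp g (c • f) = c • comp g f
  dag_dag : ∀ {X Y : C} (f : Hom X Y), dag (dag f) = f
  dag_comp : ∀ {X Y Z : C} (g : Hom Y Z) (f : Hom X Y), dag (comp g f) = comp (dag f) (dag g)
  dag_add : ∀ {X Y : C} (f g : Hom X Y), dag (f + g) = dag f + dag g
  dag_smul : ∀ {X Y : C} (c : ℂ) (f : Hom X Y), dag (c • f) = (starRingEnd ℂ c) • dag f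

attribute [instance] StarCat.addCommGroup StarCat.module

infixr:80 " ⊚ " => StarCat.comp
postfix:max "†" => StarCat.dag

/-- Identities of a `*`-category; if they exist, they are unique. -/
class UnitalStarCat (C : Type u₁) [StarCat.{w₁} C] where
  one : ∀ X : C, StarCat.Hom X X
  one_comp : ∀ {X Y : C} (f : StarCat.Hom X Y), one Y ⊚ f = f
  comp_one : ∀ {X Y : C} (f : StarCat.Hom X Y), f ⊚ one X = f

/-- A (possibly non-unital) `C*`-category. The last axiom says that `h† ⊚ h` is a positive element
of the `C*`-algebra of endomorphisms of `X`. -/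
class CStarCat (C : Type u) extends StarCat.{u} C where
  norm : ∀ X Y : C, Norm (Hom X Y)
  core : ∀ X Y : C, NormedSpace.Core ℂ (Hom X Y)
  complete : ∀ X Y : C,
    @CompleteSpace (Hom X Y) (NormedAddCommGroup.ofCore (core X Y)).toUniformSpace
  norm_comp_le : ∀ {X Y Z : C} (g : Hom Y Z) (f : Hom X Y), ‖comp g f‖ ≤ ‖g‖ * ‖f‖
  norm_dag : ∀ {X Y : C} (f : Hom X Y), ‖dag f‖ = ‖f‖
  norm_sq : ∀ {X Y : C} (h : Hom X Y), ‖h‖ ^ 2 = ‖comp (dag h) h‖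
  pos : ∀ {X Y : C} (h : Hom X Y), ∃ k : Hom X X, comp (dag h) h = comp (dag k) k

section StarCatLemmas
variable {C : Type u₁} [StarCat.{w₁} C]
open StarCat

def compL {X Y Z : C} : Hom Y Z →ₗ[ℂ] Hom X Y →ₗ[ℂ] Hom X Z :=
  LinearMap.mk₂ ℂ comp add_comp smul_comp comp_add comp_smul

@[simp] theorem zero_comp {X Y Z : C} (f : Hom X Y) : (0 : Hom Y Z) ⊚ f = 0 := by
  simpa using smul_comp (0 : ℂ) (0 : Hom Y Z) f
@[simp] theorem comp_zero {X Y Z : C} (g : Hom Y Z) : g ⊚ (0 : Hom X Y) = 0 := by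
  simpa using comp_smul (0 : ℂ) g (0 : Hom X Y)
@[simp] theorem dag_zero {X Y : C} : (0 : Hom X Y)† = 0 := by
  simpa using dag_smul (0 : ℂ) (0 : Hom X Y)
theorem dag_neg {X Y : C} (f : Hom X Y) : (-f)† = -f† := by
  simpa using dag_smul (-1 : ℂ) f
theorem dag_sub {X Y : C} (f g : Hom X Y) : (f - g)† = f† - g† := by
  rw [sub_eq_add_neg, dag_add, dag_neg, sub_eq_add_neg]
theorem comp_neg {X Y Z : C} (g : Hom Y Z) (f : Hom X Y) : g ⊚ (-f) = -(g ⊚ f) := by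
  simpa using comp_smul (-1 : ℂ) g f
theorem neg_comp {X Y Z : C} (g : Hom Y Z) (f : Hom X Y) : (-g) ⊚ f = -(g ⊚ f) := by
  simpa using smul_comp (-1 : ℂ) g f
theorem comp_sub {X Y Z : C} (g : Hom Y Z) (f f' : Hom X Y) : g ⊚ (f - f') = g ⊚ f - g ⊚ f' := by
  rw [sub_eq_add_neg, comp_add, comp_neg, sub_eq_add_neg]
theorem sub_comp {X Y Z : C} (g g' : Hom Y Z) (f : Hom X Y) : (g - g') ⊚ f = g ⊚ f - g' ⊚ f := by
  rw [sub_eq_add_neg, add_comp, neg_comp, sub_eq_add_neg]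
theorem comp_sum {X Y Z : C} {ι : Type*} (s : Finset ι) (g : Hom Y Z) (f : ι → Hom X Y) :
    g ⊚ (∑ i ∈ s, f i) = ∑ i ∈ s, g ⊚ f i := map_sum (compL (X := X) g) f s
theorem sum_comp {X Y Z : C} {ι : Type*} (s : Finset ι) (g : ι → Hom Y Z) (f : Hom X Y) :
    (∑ i ∈ s, g i) ⊚ f = ∑ i ∈ s, g i ⊚ f := map_sum (compL.flip f) g s
theorem dag_sum {X Y : C} {ι : Type*} (s : Finset ι) (g : ι → Hom X Y) :
    (∑ i ∈ s, g i)† = ∑ i ∈ s, (g i)† :=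
  map_sum (AddMonoidHom.mk' (fun f : Hom X Y => f†) dag_add) g s

end StarCatLemmas

/-- A `*`-functor: `ℂ`-linear, compatible with composition and `*`; units need not be preserved.
Between `C*`-categories it is automatically norm-decreasing. -/
structure StarFunctor (C : Type u₁) (D : Type u₂) [StarCat.{w₁} C] [StarCat.{w₂} D] where
  obj : C → D
  map : ∀ {X Y : C}, StarCat.Hom X Y → StarCat.Hom (obj X) (obj Y)
  map_add : ∀ {X Y : C} (f g : StarCat.Hom X Y), map (f + g) = map f + map g
  map_smul : ∀ {X Y : C} (c : ℂ) (f : StarCat.Hom X Y), map (c • f) = c • map f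
  map_comp : ∀ {X Y Z : C} (g : StarCat.Hom Y Z) (f : StarCat.Hom X Y),
    map (g ⊚ f) = map g ⊚ map f
  map_dag : ∀ {X Y : C} (f : StarCat.Hom X Y), map f† = (map f)†

namespace StarFunctor
variable {C : Type u₁} {D : Type u₂} {E : Type u₃} [StarCat.{w₁} C] [StarCat.{w₂} D]
  [StarCat.{w₃} E]

def id (C : Type u₁) [StarCat.{w₁} C] : StarFunctor C C where
  obj X := X
  map f := f
  map_add _ _ := rfl
  map_smul _ _ := rfl
  map_comp _ _ := rfl
  map_dag _ := rfl

/-- `F.comp G` is `F ∘ G`. -/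
def comp (F : StarFunctor D E) (G : StarFunctor C D) : StarFunctor C E where
  obj X := F.obj (G.obj X)
  map f := F.map (G.map f)
  map_add f g := by rw [G.map_add, F.map_add]
  map_smul c f := by rw [G.map_smul, F.map_smul]
  map_comp g f := by rw [G.map_comp, F.map_comp]
  map_dag f := by rw [G.map_dag, F.map_dag]

def mapL (F : StarFunctor C D) {X Y : C} :
    StarCat.Hom X Y →ₗ[ℂ] StarCat.Hom (F.obj X) (F.obj Y) where
  toFun := F.map
  map_add' := F.map_add
  map_smul' := F.map_smul

theorem map_sub (F : StarFunctor C D) {X Y : C} (f g : StarCat.Hom X Y) :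
    F.map (f - g) = F.map f - F.map g := _root_.map_sub (F.mapL (X := X) (Y := Y)) f g

end StarFunctor

/-- A morphism `f` with `f† ⊚ f = 1` and `f ⊚ f† = 1`, i.e. an isometric isomorphism. -/
def IsUnitary {C : Type u₁} [StarCat.{w₁} C] [UnitalStarCat C] {X Y : C}
    (f : StarCat.Hom X Y) : Prop :=
  f† ⊚ f = UnitalStarCat.one X ∧ f ⊚ f† = UnitalStarCat.one Y

theorem dag_one {C : Type u₁} [StarCat.{w₁} C] [UnitalStarCat C] (X : C) :
    (UnitalStarCat.one X)† = UnitalStarCat.one X := by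
  have h := congrArg StarCat.dag (UnitalStarCat.one_comp (UnitalStarCat.one X)†)
  rw [StarCat.dag_comp, StarCat.dag_dag, UnitalStarCat.one_comp] at h
  exact h

/-- Two objects are (isometrically) isomorphic. -/
def Iso {C : Type u₁} [StarCat.{w₁} C] [UnitalStarCat C] (X Y : C) : Prop :=
  ∃ f : StarCat.Hom X Y, IsUnitary f

/-- `μ` is an isometric isomorphism of functors from `F` to `G`. -/
def IsNatUnitary {C : Type u₁} {D : Type u₂} [StarCat.{w₁} C] [StarCat.{w₂} D] [UnitalStarCat D]
    (F G : StarFunctor C D) (μ : ∀ X, StarCat.Hom (F.obj X) (G.obj X)) : Prop :=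
  (∀ X, IsUnitary (μ X)) ∧
    ∀ {X Y : C} (f : StarCat.Hom X Y), G.map f ⊚ μ X = μ Y ⊚ F.map f

/-- `F` and `G` are mutually inverse equivalences of `C*`-categories. -/
def IsEquivalence {C : Type u₁} {D : Type u₂} [StarCat.{w₁} C] [StarCat.{w₂} D]
    [UnitalStarCat C] [UnitalStarCat D] (F : StarFunctor C D) (G : StarFunctor D C) : Prop :=
  (∃ η, IsNatUnitary (StarFunctor.id C) (G.comp F) η) ∧
    ∃ ε, IsNatUnitary (F.comp G) (StarFunctor.id D) ε

section Algebra
variable {C : Type u} [CStarCat C]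
open StarCat

instance instNACG (X Y : C) : NormedAddCommGroup (Hom X Y) :=
  letI := CStarCat.norm X Y
  NormedAddCommGroup.ofCore (CStarCat.core X Y)

instance instNS (X Y : C) : NormedSpace ℂ (Hom X Y) :=
  letI := CStarCat.norm X Y
  NormedSpace.ofCore (CStarCat.core X Y)

instance (X Y : C) : CompleteSpace (Hom X Y) := CStarCat.complete X Y

theorem norm_comp_le {X Y Z : C} (g : Hom Y Z) (f : Hom X Y) : ‖g ⊚ f‖ ≤ ‖g‖ * ‖f‖ :=
  CStarCat.norm_comp_le g f
theorem norm_dag {X Y : C} (f : Hom X Y) : ‖f†‖ = ‖f‖ := CStarCat.norm_dag f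
theorem norm_sq {X Y : C} (h : Hom X Y) : ‖h‖ ^ 2 = ‖h† ⊚ h‖ := CStarCat.norm_sq h

/-- The `C*`-algebra of endomorphisms of an object. -/
instance (X : C) : NonUnitalCStarAlgebra (Hom X X) where
  __ := instNACG X X
  __ := instNS X X
  mul f g := f ⊚ g
  left_distrib := comp_add
  right_distrib := add_comp
  zero_mul := zero_comp
  mul_zero := comp_zero
  mul_assoc := comp_assoc
  norm_mul_le := norm_comp_le
  star f := f†
  star_involutive := dag_dag
  star_mul := dag_comp
  star_add := dag_add
  complete := CompleteSpace.complete
  norm_mul_self_le f := by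
    rw [← pow_two]; exact (norm_sq f).le
  smul_assoc := smul_comp
  smul_comm c f g := (comp_smul c f g).symm
  star_smul := dag_smul

instance (X : C) : PartialOrder (Hom X X) := CStarAlgebra.spectralOrder _
instance (X : C) : StarOrderedRing (Hom X X) := CStarAlgebra.spectralOrderedRing _

theorem mul_def {X : C} (f g : Hom X X) : f * g = f ⊚ g := rfl
theorem star_def {X : C} (f : Hom X X) : star f = f† := rfl

theorem dag_comp_self_nonneg {X Y : C} (h : Hom X Y) : 0 ≤ h† ⊚ h := by
  obtain ⟨k, hk⟩ := CStarCat.pos h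
  rw [hk]
  exact star_mul_self_nonneg k

theorem exists_of_nonneg {X : C} {p : Hom X X} (hp : 0 ≤ p) : ∃ k : Hom X X, p = k† ⊚ k :=
  CStarAlgebra.nonneg_iff_eq_star_mul_self.1 hp

theorem conj_nonneg {X Y : C} {p : Hom X X} (hp : 0 ≤ p) (g : Hom Y X) : 0 ≤ g† ⊚ p ⊚ g := by
  obtain ⟨k, rfl⟩ := exists_of_nonneg hp
  have := dag_comp_self_nonneg (k ⊚ g)
  rwa [dag_comp, comp_assoc, ← comp_assoc k†] at this

theorem continuous_comp {X Y Z : C} : Continuous fun q : Hom Y Z × Hom X Y => q.1 ⊚ q.2 :=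
  (LinearMap.mkContinuous₂ compL 1 (fun g f => by
    rw [one_mul]; exact norm_comp_le g f) :
    Hom Y Z →L[ℂ] Hom X Y →L[ℂ] Hom X Z).continuous₂

theorem continuous_dag {X Y : C} : Continuous fun f : Hom X Y => f† := by
  apply Isometry.continuous
  refine Isometry.of_dist_eq fun f g => ?_
  rw [dist_eq_norm, dist_eq_norm, ← dag_sub, norm_dag]

theorem eq_zero_of_dag_comp {X Y : C} {f : Hom X Y} (h : f† ⊚ f = 0) : f = 0 := by
  have := norm_sq f
  rw [h, norm_zero] at this
  exact norm_eq_zero.1 (by nlinarith [norm_nonneg f])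

end Algebra

/-- A `*`-functor restricted to endomorphisms is a `*`-homomorphism of `C*`-algebras. -/
def StarFunctor.endHom {C D : Type*} [CStarCat C] [CStarCat D] (F : StarFunctor C D) (X : C) :
    StarCat.Hom X X →⋆ₙₐ[ℂ] StarCat.Hom (F.obj X) (F.obj X) where
  toFun := F.map
  map_smul' := F.map_smul
  map_zero' := F.mapL.map_zero
  map_add' := F.map_add
  map_mul' := F.map_comp
  map_star' := F.map_dag

theorem StarFunctor.norm_map_le {C D : Type*} [CStarCat C] [CStarCat D] (F : StarFunctor C D)
    {X Y : C} (f : StarCat.Hom X Y) : ‖F.map f‖ ≤ ‖f‖ := by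
  have h : ‖F.map f‖ ^ 2 ≤ ‖f‖ ^ 2 := by
    rw [norm_sq, norm_sq, ← F.map_dag, ← F.map_comp]
    exact NonUnitalStarAlgHom.norm_apply_le (F.endHom X) _
  exact le_of_sq_le_sq h (norm_nonneg _)

theorem StarFunctor.map_nonneg {C D : Type*} [CStarCat C] [CStarCat D] (F : StarFunctor C D)
    {X : C} {p : StarCat.Hom X X} (hp : 0 ≤ p) : 0 ≤ F.map p := by
  obtain ⟨k, rfl⟩ := exists_of_nonneg hp
  rw [F.map_comp, F.map_dag]
  exact dag_comp_self_nonneg _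

end

end HilbCat

namespace HilbCat

noncomputable section
open StarCat

/-- A right pre-Hilbert module over a `C*`-category; `inner b a` is `⟨b, a⟩`, an arrow `A ⟶ B` for
`b ∈ H(B)` and `a ∈ H(A)`, and `act a f` is `a ∘ f`. -/
structure PreHilbertModule (C : Type u) [CStarCat C] where
  obj : C → Type u
  [addCommGroup : ∀ A, AddCommGroup (obj A)]
  [module : ∀ A, Module ℂ (obj A)]
  act : ∀ {A B : C}, obj A → Hom B A → obj B
  inner : ∀ {A B : C}, obj B → obj A → Hom A B
  add_act : ∀ {A B : C} (a a' : obj A) (f : Hom B A), act (a + a') f = act a f + act a' f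
  smul_act : ∀ {A B : C} (c : ℂ) (a : obj A) (f : Hom B A), act (c • a) f = c • act a f
  act_add : ∀ {A B : C} (a : obj A) (f f' : Hom B A), act a (f + f') = act a f + act a f'
  act_smul : ∀ {A B : C} (c : ℂ) (a : obj A) (f : Hom B A), act a (c • f) = c • act a f
  act_act : ∀ {A B D : C} (a : obj A) (f : Hom B A) (g : Hom D B),
    act (act a f) g = act a (f ⊚ g)
  inner_dag : ∀ {A B : C} (b : obj B) (a : obj A), (inner b a)† = inner a b
  inner_add : ∀ {A B : C} (b : obj B) (a a' : obj A), inner b (a + a') = inner b a + inner b a'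
  inner_smul : ∀ {A B : C} (c : ℂ) (b : obj B) (a : obj A), inner b (c • a) = c • inner b a
  inner_act : ∀ {A B D : C} (b : obj B) (a : obj A) (f : Hom D A),
    inner b (act a f) = inner b a ⊚ f
  inner_pos : ∀ {A : C} (a : obj A), ∃ k : Hom A A, inner a a = k† ⊚ k

attribute [instance] PreHilbertModule.addCommGroup PreHilbertModule.module

/-- A Hilbert module: a pre-Hilbert module which is separated and complete for the norm
`‖a‖ = ‖⟨a, a⟩‖ ^ (1 / 2)`. -/
structure HilbertModule (C : Type u) [CStarCat C] extends PreHilbertModule C where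
  norm : ∀ A : C, Norm (obj A)
  norm_sq : ∀ {A : C} (a : obj A), ‖a‖ ^ 2 = ‖inner a a‖
  core : ∀ A : C, NormedSpace.Core ℂ (obj A)
  complete : ∀ A : C,
    @CompleteSpace (obj A) (NormedAddCommGroup.ofCore (core A)).toUniformSpace

namespace PreHilbertModule
variable {C : Type u} [CStarCat C] (H : PreHilbertModule C)

theorem add_inner {A B : C} (b b' : H.obj B) (a : H.obj A) :
    H.inner (b + b') a = H.inner b a + H.inner b' a := by
  rw [← H.inner_dag, H.inner_add, dag_add, H.inner_dag, H.inner_dag]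
theorem smul_inner {A B : C} (c : ℂ) (b : H.obj B) (a : H.obj A) :
    H.inner (c • b) a = (starRingEnd ℂ c) • H.inner b a := by
  rw [← H.inner_dag, H.inner_smul, dag_smul, H.inner_dag]
theorem act_inner {A B D : C} (b : H.obj B) (a : H.obj A) (f : Hom D B) :
    H.inner (H.act b f) a = f† ⊚ H.inner b a := by
  rw [← H.inner_dag, H.inner_act, dag_comp, H.inner_dag]
theorem inner_nonneg {A : C} (a : H.obj A) : 0 ≤ H.inner a a := by
  obtain ⟨k, hk⟩ := H.inner_pos a
  rw [hk]; exact dag_comp_self_nonneg k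

def innerL {A B : C} (b : H.obj B) : H.obj A →ₗ[ℂ] Hom A B where
  toFun := H.inner b
  map_add' := H.inner_add b
  map_smul' c a := H.inner_smul c b a

def actL {A B : C} : H.obj A →ₗ[ℂ] Hom B A →ₗ[ℂ] H.obj B :=
  LinearMap.mk₂ ℂ H.act H.add_act H.smul_act H.act_add H.act_smul

theorem inner_sub {A B : C} (b : H.obj B) (a a' : H.obj A) :
    H.inner b (a - a') = H.inner b a - H.inner b a' := map_sub (H.innerL b) a a'
theorem sub_inner {A B : C} (b b' : H.obj B) (a : H.obj A) :
    H.inner (b - b') a = H.inner b a - H.inner b' a := by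
  rw [← H.inner_dag, H.inner_sub, dag_sub, H.inner_dag, H.inner_dag]
theorem zero_inner {A B : C} (a : H.obj A) : H.inner (0 : H.obj B) a = 0 := by
  simpa using H.smul_inner (0 : ℂ) (0 : H.obj B) a
theorem inner_zero {A B : C} (b : H.obj B) : H.inner b (0 : H.obj A) = 0 := map_zero (H.innerL b)
theorem inner_sum {A B : C} {ι : Type*} (s : Finset ι) (b : H.obj B) (a : ι → H.obj A) :
    H.inner b (∑ i ∈ s, a i) = ∑ i ∈ s, H.inner b (a i) := map_sum (H.innerL b) a s
theorem sum_inner {A B : C} {ι : Type*} (s : Finset ι) (b : ι → H.obj B) (a : H.obj A) :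
    H.inner (∑ i ∈ s, b i) a = ∑ i ∈ s, H.inner (b i) a := by
  rw [← H.inner_dag, H.inner_sum, dag_sum]
  exact Finset.sum_congr rfl fun i _ => H.inner_dag _ _
theorem sub_act {A B : C} (a a' : H.obj A) (f : Hom B A) :
    H.act (a - a') f = H.act a f - H.act a' f := map_sub (H.actL.flip f) a a'
theorem act_sub {A B : C} (a : H.obj A) (f f' : Hom B A) :
    H.act a (f - f') = H.act a f - H.act a f' := map_sub (H.actL a) f f'

/-- Cauchy-Schwarz. -/
theorem norm_inner_sq_le {A B : C} (a : H.obj A) (b : H.obj B) :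
    ‖H.inner a b‖ ^ 2 ≤ ‖H.inner a a‖ * ‖H.inner b b‖ := by
  set c := H.inner a b with hc
  have key : ∀ t : ℝ, 0 < t → 2 * t * ‖c‖ ^ 2 ≤ ‖H.inner a a‖ * ‖c‖ ^ 2 + t ^ 2 * ‖H.inner b b‖ := by
    intro t ht
    have h0 := H.inner_nonneg (H.act a c - (t : ℂ) • b)
    have hcb : H.inner b a = c† := (H.inner_dag a b).symm
    have e : H.inner (H.act a c - (t : ℂ) • b) (H.act a c - (t : ℂ) • b)
        = (c† ⊚ H.inner a a ⊚ c + ((t : ℂ) * t) • H.inner b b) - ((2 * t : ℝ) : ℂ) • (c† ⊚ c) := by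
      rw [inner_sub, sub_inner, sub_inner, inner_act, act_inner, inner_smul, smul_inner,
        inner_smul, smul_inner, act_inner, inner_act, ← hc, hcb, comp_assoc]
      rw [Complex.conj_ofReal, Complex.ofReal_mul, Complex.ofReal_ofNat]
      module
    rw [e, sub_nonneg] at h0
    have h1 : 0 ≤ ((2 * t : ℝ) : ℂ) • (c† ⊚ c) := by
      have := dag_comp_self_nonneg (((Real.sqrt (2 * t) : ℝ) : ℂ) • c)
      rwa [dag_smul, smul_comp, comp_smul, smul_smul, Complex.conj_ofReal, ← Complex.ofReal_mul,
        Real.mul_self_sqrt (by positivity)] at this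
    have h2 := CStarAlgebra.norm_le_norm_of_nonneg_of_le h1 h0
    rw [norm_smul, ← HilbCat.norm_sq, Complex.norm_real, Real.norm_of_nonneg (by positivity)] at h2
    refine h2.trans ((norm_add_le _ _).trans (add_le_add ?_ ?_))
    · refine (norm_comp_le _ _).trans ?_
      rw [norm_dag]
      have := norm_comp_le (H.inner a a) c
      nlinarith [norm_nonneg c]
    · rw [norm_smul, norm_mul, Complex.norm_real, Real.norm_of_nonneg ht.le, pow_two]
  rcases (norm_nonneg (H.inner a a)).eq_or_lt with h | h
  · rw [← h, zero_mul]
    by_contra hne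
    push Not at hne
    set q := ‖H.inner b b‖
    have hq : 0 ≤ q := norm_nonneg _
    have := key (‖c‖ ^ 2 / (q + 1)) (by positivity)
    rw [← h, zero_mul, zero_add] at this
    have h3 : ‖c‖ ^ 2 / (q + 1) * (q + 1) = ‖c‖ ^ 2 := by field_simp
    set s := ‖c‖ ^ 2 / (q + 1) with hs
    have hs0 : 0 < s := by positivity
    rw [← h3] at this
    nlinarith [mul_pos hs0 hs0]
  · have := key _ h
    nlinarith

end PreHilbertModule

namespace HilbertModule
variable {C : Type u} [CStarCat C] (H : HilbertModule C)

instance instNACG (A : C) : NormedAddCommGroup (H.obj A) :=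
  letI := H.norm A
  NormedAddCommGroup.ofCore (H.core A)

instance instNS (A : C) : NormedSpace ℂ (H.obj A) :=
  letI := H.norm A
  NormedSpace.ofCore (H.core A)

instance (A : C) : CompleteSpace (H.obj A) := H.complete A

theorem norm_sq' {A : C} (a : H.obj A) : ‖a‖ ^ 2 = ‖H.inner a a‖ := H.norm_sq a

theorem norm_inner_le {A B : C} (a : H.obj A) (b : H.obj B) : ‖H.inner a b‖ ≤ ‖a‖ * ‖b‖ := by
  have := H.norm_inner_sq_le a b
  rw [← H.norm_sq', ← H.norm_sq', ← mul_pow] at this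
  exact le_of_sq_le_sq this (by positivity)

theorem norm_act_le {A B : C} (a : H.obj A) (f : Hom B A) : ‖H.act a f‖ ≤ ‖a‖ * ‖f‖ := by
  have : ‖H.act a f‖ ^ 2 ≤ (‖a‖ * ‖f‖) ^ 2 := by
    rw [H.norm_sq', H.inner_act, H.act_inner, mul_pow, H.norm_sq', comp_assoc]
    refine (norm_comp_le _ _).trans ?_
    rw [norm_dag]
    have := norm_comp_le (H.inner a a) f
    nlinarith [norm_nonneg f]
  exact le_of_sq_le_sq this (by positivity)

theorem eq_zero {A : C} (a : H.obj A) (h : H.inner a a = 0) : a = 0 := by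
  have := H.norm_sq' a
  rw [h, norm_zero] at this
  exact norm_eq_zero.1 (by nlinarith [norm_nonneg a])

theorem ext_inner {A : C} (a a' : H.obj A)
    (h : ∀ {B : C} (b : H.obj B), H.inner b a = H.inner b a') : a = a' := by
  rw [← sub_eq_zero]
  apply H.eq_zero
  rw [H.inner_sub, h, sub_self]

theorem continuous_inner {A B : C} : Continuous fun q : H.obj B × H.obj A => H.inner q.1 q.2 := by
  let T : H.obj B →L⋆[ℂ] H.obj A →L[ℂ] Hom A B :=
    LinearMap.mkContinuous₂ (LinearMap.mk₂'ₛₗ (starRingEnd ℂ) (RingHom.id ℂ) H.inner H.add_inner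
      H.smul_inner H.inner_add (fun c b a => H.inner_smul c b a)) 1 (fun g f => by
        rw [one_mul]; exact H.norm_inner_le g f)
  exact (T.continuous.comp continuous_fst).clm_apply continuous_snd

theorem continuous_act {A B : C} : Continuous fun q : H.obj A × Hom B A => H.act q.1 q.2 :=
  (LinearMap.mkContinuous₂ H.actL 1 (fun g f => by
    rw [one_mul]; exact H.norm_act_le g f) :
    H.obj A →L[ℂ] Hom B A →L[ℂ] H.obj B).continuous₂

end HilbertModule

end

end HilbCat

namespace HilbCat

noncomputable section
open StarCat

section Operators
variable {C : Type u} [CStarCat C]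

/-- A bounded linear map of Hilbert modules: a `ℂ`-linear natural transformation with a uniform
bound. -/
def IsBoundedMap {H G : HilbertModule C} (f : ∀ A, H.obj A →ₗ[ℂ] G.obj A) : Prop :=
  (∀ {A B : C} (a : H.obj A) (k : Hom B A), f B (H.act a k) = G.act (f A a) k) ∧
    ∃ K : ℝ, ∀ (A : C) (a : H.obj A), ‖f A a‖ ≤ K * ‖a‖

def IsAdjoint {H G : HilbertModule C} (f : ∀ A, H.obj A →ₗ[ℂ] G.obj A)
    (g : ∀ A, G.obj A →ₗ[ℂ] H.obj A) : Prop :=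
  ∀ {A B : C} (h : H.obj A) (x : G.obj B), H.inner h (g B x) = G.inner (f A h) x

theorem IsAdjoint.symm {H G : HilbertModule C} {f : ∀ A, H.obj A →ₗ[ℂ] G.obj A}
    {g : ∀ A, G.obj A →ₗ[ℂ] H.obj A} (h : IsAdjoint f g) : IsAdjoint g f := fun a x => by
  rw [← G.inner_dag, ← h, H.inner_dag]

theorem IsAdjoint.unique {H G : HilbertModule C} {f : ∀ A, H.obj A →ₗ[ℂ] G.obj A}
    {g g' : ∀ A, G.obj A →ₗ[ℂ] H.obj A} (h : IsAdjoint f g) (h' : IsAdjoint f g') : g = g' := by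
  funext A
  ext x
  exact H.ext_inner _ _ fun b => by rw [h, h']

/-- Operators: the bounded linear maps which have a bounded linear adjoint. -/
def operators (H G : HilbertModule C) : Submodule ℂ (∀ A, H.obj A →ₗ[ℂ] G.obj A) where
  carrier := {f | IsBoundedMap f ∧
    ∃ g : ∀ A, G.obj A →ₗ[ℂ] H.obj A, IsBoundedMap g ∧ IsAdjoint f g}
  zero_mem' := by
    refine ⟨⟨fun a k => ?_, 0, fun A a => by simp⟩, 0, ⟨fun a k => ?_, 0, fun A a => by simp⟩,
      fun h x => ?_⟩
    · exact (map_zero (G.actL.flip k)).symm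
    · exact (map_zero (H.actL.flip k)).symm
    · exact (map_zero (H.innerL h)).trans
        (G.zero_inner x).symm
  add_mem' := by
    rintro f f' ⟨⟨hf, K, hK⟩, g, ⟨hg, L, hL⟩, hfg⟩ ⟨⟨hf', K', hK'⟩, g', ⟨hg', L', hL'⟩, hfg'⟩
    refine ⟨⟨fun a k => ?_, K + K', fun A a => ?_⟩, g + g', ⟨fun a k => ?_, L + L', fun A a => ?_⟩,
      fun h x => ?_⟩
    · simp only [Pi.add_apply, LinearMap.add_apply, hf, hf', G.add_act]
    · exact (norm_add_le _ _).trans (by linarith [hK A a, hK' A a])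
    · simp only [Pi.add_apply, LinearMap.add_apply, hg, hg', H.add_act]
    · exact (norm_add_le _ _).trans (by linarith [hL A a, hL' A a])
    · simp only [Pi.add_apply, LinearMap.add_apply, H.inner_add, G.add_inner, hfg h x, hfg' h x]
  smul_mem' := by
    rintro c f ⟨⟨hf, K, hK⟩, g, ⟨hg, L, hL⟩, hfg⟩
    refine ⟨⟨fun a k => ?_, ‖c‖ * K, fun A a => ?_⟩, (starRingEnd ℂ c) • g,
      ⟨fun a k => ?_, ‖c‖ * L, fun A a => ?_⟩, fun h x => ?_⟩
    · simp only [Pi.smul_apply, LinearMap.smul_apply, hf, G.smul_act]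
    · simp only [Pi.smul_apply, LinearMap.smul_apply, norm_smul, mul_assoc]
      exact mul_le_mul_of_nonneg_left (hK A a) (norm_nonneg c)
    · simp only [Pi.smul_apply, LinearMap.smul_apply, hg, H.smul_act]
    · simp only [Pi.smul_apply, LinearMap.smul_apply, norm_smul, mul_assoc, RCLike.norm_conj]
      exact mul_le_mul_of_nonneg_left (hL A a) (norm_nonneg c)
    · simp only [Pi.smul_apply, LinearMap.smul_apply, H.inner_smul, G.smul_inner, hfg h x]

/-- A family `e` generates `H` if the finite sums of the elements `e x ∘ f` are dense. -/
def Generates (H : HilbertModule C) {X : Type*} (s : X → C) (e : ∀ x, H.obj (s x)) : Prop :=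
  ∀ (A : C) (a : H.obj A),
    a ∈ closure (Submodule.span ℂ {b : H.obj A | ∃ (x : X) (f : Hom A (s x)), b = H.act (e x) f} :
      Set (H.obj A))

end Operators

/-- The small Hilbert modules: those generated by a `v`-small family of elements. -/
structure SmallHilb (C : Type u) [CStarCat C] extends HilbertModule C where
  small : ∃ (X : Type v) (s : X → C) (e : ∀ x, obj (s x)), Generates toHilbertModule s e

section HC
variable {C : Type u} [CStarCat C]

abbrev Op (H G : SmallHilb.{v} C) : Type u := ↥(operators H.toHilbertModule G.toHilbertModule)

namespace Op
variable {H G K : SmallHilb.{v} C}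

def app (f : Op H G) {A : C} (a : H.obj A) : G.obj A := f.1 A a

theorem app_act (f : Op H G) {A B : C} (a : H.obj A) (k : Hom B A) :
    f.app (H.act a k) = G.act (f.app a) k := f.2.1.1 a k
theorem app_bound (f : Op H G) : ∃ M : ℝ, 0 < M ∧ ∀ {A : C} (a : H.obj A), ‖f.app a‖ ≤ M * ‖a‖ := by
  obtain ⟨M, hM⟩ := f.2.1.2
  refine ⟨max M 1, by positivity, fun a => (hM _ a).trans ?_⟩
  exact mul_le_mul_of_nonneg_right (le_max_left _ _) (norm_nonneg _)

@[ext] theorem ext {f g : Op H G} (h : ∀ {A : C} (a : H.obj A), f.app a = g.app a) : f = g :=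
  Subtype.ext (funext fun _ => LinearMap.ext fun a => h a)

/-- The adjoint operator. -/
def adj (f : Op H G) : Op G H :=
  ⟨Classical.choose f.2.2, (Classical.choose_spec f.2.2).1, f.1, f.2.1,
    IsAdjoint.symm (Classical.choose_spec f.2.2).2⟩

theorem inner_adj (f : Op H G) {A B : C} (h : H.obj A) (x : G.obj B) :
    H.inner h (f.adj.app x) = G.inner (f.app h) x := (Classical.choose_spec f.2.2).2 h x
theorem adj_inner (f : Op H G) {A B : C} (h : H.obj A) (x : G.obj B) :
    H.inner (f.adj.app x) h = G.inner x (f.app h) := by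
  rw [← H.inner_dag, inner_adj, G.inner_dag]
theorem eq_adj (f : Op H G) (g : Op G H)
    (h : ∀ {A B : C} (x : G.obj B) (a : H.obj A), H.inner a (g.app x) = G.inner (f.app a) x) :
    f.adj = g := by
  ext A x
  exact H.ext_inner _ _ fun b => by rw [inner_adj, h]

/-- Constructor from an adjoint pair. -/
def mk' (f : ∀ A, H.obj A →ₗ[ℂ] G.obj A) (g : ∀ A, G.obj A →ₗ[ℂ] H.obj A) (hf : IsBoundedMap f)
    (hg : IsBoundedMap g) (h : IsAdjoint f g) : Op H G := ⟨f, hf, g, hg, h⟩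

theorem isBoundedMap_comp {H G K : HilbertModule C} {f : ∀ A, G.obj A →ₗ[ℂ] K.obj A}
    {g : ∀ A, H.obj A →ₗ[ℂ] G.obj A} (hf : IsBoundedMap f) (hg : IsBoundedMap g) :
    IsBoundedMap fun A => f A ∘ₗ g A := by
  obtain ⟨hf, M, hM⟩ := hf
  obtain ⟨hg, L, hL⟩ := hg
  refine ⟨fun a k => by simp only [LinearMap.comp_apply, hf, hg], max M 0 * L, fun A a => ?_⟩
  have h1 := hM A (g A a)
  have h2 := hL A a
  have h3 : M * ‖g A a‖ ≤ max M 0 * ‖g A a‖ :=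
    mul_le_mul_of_nonneg_right (le_max_left _ _) (norm_nonneg _)
  have h4 : max M 0 * ‖g A a‖ ≤ max M 0 * (L * ‖a‖) :=
    mul_le_mul_of_nonneg_left h2 (le_max_right _ _)
  rw [LinearMap.comp_apply, mul_assoc]
  linarith

def comp (f : Op G K) (g : Op H G) : Op H K :=
  mk' (fun A => f.1 A ∘ₗ g.1 A) (fun A => g.adj.1 A ∘ₗ f.adj.1 A)
    (isBoundedMap_comp f.2.1 g.2.1) (isBoundedMap_comp g.adj.2.1 f.adj.2.1)
    (fun a x => (inner_adj g a (f.adj.app x)).trans (inner_adj f (g.app a) x))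

def one (H : SmallHilb.{v} C) : Op H H :=
  mk' (fun _ => LinearMap.id) (fun _ => LinearMap.id) ⟨fun _ _ => rfl, 1, fun _ _ => by simp⟩
    ⟨fun _ _ => rfl, 1, fun _ _ => by simp⟩ (fun _ _ => rfl)

end Op

/-- The `*`-category `𝓗 C` of small Hilbert `C`-modules and operators. -/
instance : StarCat (SmallHilb.{v} C) where
  Hom H G := Op H G
  comp f g := Op.comp f g
  dag f := Op.adj f
  comp_assoc _ _ _ := rfl
  add_comp _ _ _ := rfl
  comp_add g f f' := Op.ext fun a => map_add (g.1 _) _ _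
  smul_comp _ _ _ := rfl
  comp_smul c g f := Op.ext fun a => map_smul (g.1 _) _ _
  dag_dag f := Op.eq_adj _ _ fun x a => (Op.adj_inner f x a).symm
  dag_comp g f := Op.eq_adj _ _ fun x a =>
    (Op.inner_adj f a (g.adj.app x)).trans (Op.inner_adj g (f.app a) x)
  dag_add {H G} f g := Op.eq_adj _ _ fun x a => by
    refine (H.inner_add a (f.adj.app x) (g.adj.app x)).trans ?_
    rw [Op.inner_adj, Op.inner_adj]
    exact (G.add_inner (f.app a) (g.app a) x).symm
  dag_smul {H G} c f := Op.eq_adj _ _ fun x a => by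
    refine (H.inner_smul _ a (f.adj.app x)).trans ?_
    rw [Op.inner_adj]
    exact (G.smul_inner c (f.app a) x).symm

instance : UnitalStarCat (SmallHilb.{v} C) where
  one := Op.one
  one_comp _ := rfl
  comp_one _ := rfl

namespace SmallHilb
variable {H G K : SmallHilb.{v} C}

/-- The value of an operator at an element. -/
def app (f : Hom H G) {A : C} (a : H.obj A) : G.obj A := Op.app f a

theorem comp_app (f : Hom G K) (g : Hom H G) {A : C} (a : H.obj A) :
    app (f ⊚ g) a = app f (app g a) := rfl
theorem one_app {A : C} (a : H.obj A) : app (UnitalStarCat.one H) a = a := rfl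
theorem app_act (f : Hom H G) {A B : C} (a : H.obj A) (k : Hom B A) :
    app f (H.act a k) = G.act (app f a) k := Op.app_act f a k
theorem inner_dag_app (f : Hom H G) {A B : C} (h : H.obj A) (x : G.obj B) :
    H.inner h (app f† x) = G.inner (app f h) x := Op.inner_adj f h x
theorem dag_app_inner (f : Hom H G) {A B : C} (h : H.obj A) (x : G.obj B) :
    H.inner (app f† x) h = G.inner x (app f h) := Op.adj_inner f h x
theorem app_add (f : Hom H G) {A : C} (a b : H.obj A) : app f (a + b) = app f a + app f b :=
  map_add (f.1 A) a b
theorem app_smul (f : Hom H G) {A : C} (c : ℂ) (b : H.obj A) : app f (c • b) = c • app f b :=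
  map_smul (f.1 A) c b
theorem hom_ext {f g : Hom H G} (h : ∀ {A : C} (a : H.obj A), app f a = app g a) : f = g :=
  Op.ext h
theorem app_bound (f : Hom H G) :
    ∃ M : ℝ, 0 < M ∧ ∀ {A : C} (a : H.obj A), ‖app f a‖ ≤ M * ‖a‖ := Op.app_bound f
theorem continuous_app (f : Hom H G) (A : C) : Continuous fun a : H.obj A => app f a := by
  obtain ⟨M, -, hM⟩ := app_bound f
  exact ((f.1 A).mkContinuous M fun a => hM a).continuous

theorem isUnitary_of {f : Hom H G}
    (h1 : ∀ {A B : C} (a : H.obj A) (b : H.obj B), G.inner (app f b) (app f a) = H.inner b a)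
    (h2 : ∀ {A : C} (x : G.obj A), app f (app f† x) = x) : IsUnitary f := by
  refine ⟨hom_ext fun a => H.ext_inner _ _ fun b => ?_, hom_ext fun a => h2 a⟩
  rw [comp_app, inner_dag_app, h1, one_app]

end SmallHilb
end HC

section Yoneda
variable {C : Type u} [CStarCat C]

/-- The representable Hilbert module of `A`: `X ↦ Hom X A` with `⟨u, v⟩ = u† ⊚ v`. -/
def yonedaModule (A : C) : HilbertModule C where
  obj X := Hom X A
  act u f := u ⊚ f
  inner u v := u† ⊚ v
  add_act := add_comp
  smul_act := smul_comp
  act_add := comp_add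
  act_smul c a f := comp_smul c a f
  act_act := comp_assoc
  inner_dag b a := by rw [dag_comp, dag_dag]
  inner_add b := comp_add _
  inner_smul c b a := comp_smul c _ a
  inner_act b a f := (comp_assoc _ _ _).symm
  inner_pos := CStarCat.pos
  norm X := CStarCat.norm X A
  norm_sq := CStarCat.norm_sq
  core X := CStarCat.core X A
  complete X := CStarCat.complete X A

variable [UnitalStarCat C]

/-- The Yoneda embedding on objects. -/
def yonedaObj (A : C) : SmallHilb.{v} C where
  toHilbertModule := yonedaModule A
  small := by
    refine ⟨PUnit, fun _ => A, fun _ => UnitalStarCat.one A, fun X a => subset_closure ?_⟩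
    exact Submodule.subset_span ⟨PUnit.unit, a, (UnitalStarCat.one_comp a).symm⟩

/-- The operator `Y A ⟶ H`, `g ↦ a ∘ g`, corresponding to an element `a ∈ H(A)`. -/
def elemOp {H : SmallHilb.{v} C} {A : C} (a : H.obj A) : Hom (yonedaObj A) H :=
  Op.mk' (H := yonedaObj A) (fun _ => H.actL a) (fun _ => H.innerL a)
    ⟨fun g k => (H.act_act a g k).symm, ‖a‖, fun _ g => H.norm_act_le a g⟩
    ⟨fun x k => H.inner_act a x k, ‖a‖, fun _ x => H.norm_inner_le a x⟩
    (fun g x => (H.act_inner a x g).symm)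

theorem elemOp_app {H : SmallHilb.{v} C} {A B : C} (a : H.obj A) (g : Hom B A) :
    SmallHilb.app (elemOp a) g = H.act a g := rfl
theorem elemOp_dag_app {H : SmallHilb.{v} C} {A B : C} (a : H.obj A) (x : H.obj B) :
    SmallHilb.app (elemOp a)† x = H.inner a x := by
  have : ((elemOp a)† : Hom H (yonedaObj A)) =
    Op.mk' (G := yonedaObj A) (fun _ => H.innerL a) (fun _ => H.actL a)
    ⟨fun x k => H.inner_act a x k, ‖a‖, fun _ x => H.norm_inner_le a x⟩
    ⟨fun g k => (H.act_act a g k).symm, ‖a‖, fun _ g => H.norm_act_le a g⟩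
    (fun x g => (H.inner_act x a g).trans (congrArg (fun z => z ⊚ g) (H.inner_dag a x).symm)) :=
    Op.eq_adj _ _ fun x g => (H.act_inner a x g).symm
  rw [this]; rfl

/-- The Yoneda embedding `C → 𝓗 C`. -/
def yoneda (C : Type u) [CStarCat C] [UnitalStarCat C] : StarFunctor C (SmallHilb.{v} C) where
  obj A := yonedaObj A
  map {A B} f := elemOp (H := yonedaObj B) f
  map_add f g := SmallHilb.hom_ext fun a => add_comp f g a
  map_smul c f := SmallHilb.hom_ext fun a => smul_comp c f a
  map_comp g f := SmallHilb.hom_ext fun a => comp_assoc g f a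
  map_dag f := (Op.eq_adj _ _ fun x a => by
    exact ((congrArg (fun z => z ⊚ x) (dag_comp f a)).trans (comp_assoc _ _ _)).symm).symm

end Yoneda

end

end HilbCat

namespace HilbCat

noncomputable section
open StarCat

theorem uniformSpace_of_core {E : Type*} (i1 : NormedAddCommGroup E) [NormedSpace ℂ E]
    (core : NormedSpace.Core ℂ E) :
    (NormedAddCommGroup.ofCore core).toUniformSpace = i1.toUniformSpace := by
  refine UniformSpace.ext ?_
  rw [@Metric.uniformity_basis_dist E (NormedAddCommGroup.ofCore core).toPseudoMetricSpace
    |>.eq_biInf, (@Metric.uniformity_basis_dist E i1.toPseudoMetricSpace).eq_biInf]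
  have : ∀ x y : E, (NormedAddCommGroup.ofCore core).toPseudoMetricSpace.dist x y =
      i1.toPseudoMetricSpace.dist x y := fun x y =>
    ((NormedAddCommGroup.ofCore core).dist_eq x y).trans (i1.dist_eq x y).symm
  simp only [this]

theorem complete_of_core {E : Type*} (i1 : NormedAddCommGroup E) [NormedSpace ℂ E]
    [CompleteSpace E] (core : NormedSpace.Core ℂ E) :
    @CompleteSpace E (NormedAddCommGroup.ofCore core).toUniformSpace := by
  rw [uniformSpace_of_core]
  infer_instance

section Completion
variable {C : Type u} [CStarCat C]

namespace PreHilbertModule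
variable (V : PreHilbertModule C)

section Local

/-- The seminorm `‖⟨a, a⟩‖ ^ (1 / 2)`. -/
abbrev semNorm (A : C) : Norm (V.obj A) := ⟨fun a => √‖V.inner a a‖⟩

attribute [local instance] semNorm

theorem norm_inner_le_sqrt {A B : C} (a : V.obj A) (b : V.obj B) :
    ‖V.inner a b‖ ≤ √‖V.inner a a‖ * √‖V.inner b b‖ := by
  rw [← Real.sqrt_mul (norm_nonneg _)]
  exact Real.le_sqrt_of_sq_le (V.norm_inner_sq_le a b)

theorem semCore (A : C) : SeminormedSpace.Core ℂ (V.obj A) where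
  norm_nonneg x := Real.sqrt_nonneg _
  norm_smul c x := by
    change √‖V.inner (c • x) (c • x)‖ = ‖c‖ * √‖V.inner x x‖
    rw [V.inner_smul, V.smul_inner, norm_smul, norm_smul, RCLike.norm_conj, ← mul_assoc,
      Real.sqrt_mul (by positivity), Real.sqrt_mul_self (norm_nonneg c)]
  norm_triangle x y := by
    change √‖V.inner (x + y) (x + y)‖ ≤
      √‖V.inner x x‖ + √‖V.inner y y‖
    apply Real.sqrt_le_iff.2 ⟨by positivity, ?_⟩
    rw [V.inner_add, V.add_inner, V.add_inner]
    have h1 := V.norm_inner_le_sqrt x y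
    have h2 := V.norm_inner_le_sqrt y x
    have h3 := Real.sq_sqrt (norm_nonneg (V.inner x x))
    have h4 := Real.sq_sqrt (norm_nonneg (V.inner y y))
    have h5 : ‖V.inner x x + V.inner y x +
      (V.inner x y + V.inner y y)‖ ≤
      ‖V.inner x x‖ + ‖V.inner y x‖ +
      (‖V.inner x y‖ + ‖V.inner y y‖) :=
      (norm_add_le _ _).trans (add_le_add (norm_add_le _ _) (norm_add_le _ _))
    nlinarith

abbrev semGroup (A : C) : SeminormedAddCommGroup (V.obj A) := SeminormedAddCommGroup.ofCore (V.semCore A)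

attribute [local instance] semGroup

abbrev semSpace (A : C) : NormedSpace ℂ (V.obj A) where
  norm_smul_le c x := ((V.semCore A).norm_smul c x).le

attribute [local instance] semSpace

theorem sem_norm_def {A : C} (a : V.obj A) : ‖a‖ = √‖V.inner a a‖ := rfl

theorem sem_norm_sq {A : C} (a : V.obj A) : ‖a‖ ^ 2 = ‖V.inner a a‖ :=
  Real.sq_sqrt (norm_nonneg _)

theorem sem_norm_inner_le {A B : C} (a : V.obj A) (b : V.obj B) :
    ‖V.inner a b‖ ≤ ‖a‖ * ‖b‖ := V.norm_inner_le_sqrt a b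

theorem sem_norm_act_le {A B : C} (a : V.obj A) (f : Hom B A) :
    ‖(V.act a f : V.obj B)‖ ≤ ‖a‖ * ‖f‖ := by
  have : ‖(V.act a f : V.obj B)‖ ^ 2 ≤ (‖a‖ * ‖f‖) ^ 2 := by
    rw [V.sem_norm_sq, V.inner_act, V.act_inner, mul_pow, V.sem_norm_sq, comp_assoc]
    refine (norm_comp_le _ _).trans ?_
    rw [norm_dag]
    have := norm_comp_le (V.inner a a) f
    nlinarith [norm_nonneg f]
  exact le_of_sq_le_sq this (by positivity)

theorem continuous_sem_inner (A B : C) :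
    Continuous fun q : V.obj B × V.obj A => V.inner q.1 q.2 := by
  let T : V.obj B →L⋆[ℂ] V.obj A →L[ℂ] Hom A B :=
    LinearMap.mkContinuous₂ (LinearMap.mk₂'ₛₗ (starRingEnd ℂ) (RingHom.id ℂ)
      (fun (x : V.obj B) y => V.inner x y) V.add_inner
      V.smul_inner V.inner_add (fun c b a => V.inner_smul c b a)) 1 (fun g f => by
        rw [one_mul]; exact V.sem_norm_inner_le g f)
  exact (T.continuous.comp continuous_fst).clm_apply continuous_snd

def semAct {A B : C} (f : Hom B A) : V.obj A →L[ℂ] V.obj B :=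
  LinearMap.mkContinuous (V.actL.flip f : V.obj A →ₗ[ℂ] V.obj B) ‖f‖ fun a =>
    by rw [mul_comm]; exact V.sem_norm_act_le a f

/-- The completion of a fibre. -/
def CF (A : C) : Type u := UniformSpace.Completion (V.obj A)

instance instCF (A : C) : NormedAddCommGroup (V.CF A) :=
  inferInstanceAs (NormedAddCommGroup (UniformSpace.Completion (V.obj A)))
instance (A : C) : NormedSpace ℂ (V.CF A) :=
  inferInstanceAs (NormedSpace ℂ (UniformSpace.Completion (V.obj A)))
instance (A : C) : CompleteSpace (V.CF A) :=
  inferInstanceAs (CompleteSpace (UniformSpace.Completion (V.obj A)))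

def toCF {A : C} : V.obj A →L[ℂ] V.CF A := UniformSpace.Completion.toComplL

theorem denseInducing_toCF {A : C} : IsDenseInducing (V.toCF (A := A)) :=
  UniformSpace.Completion.isDenseInducing_coe

theorem norm_toCF {A : C} (a : V.obj A) : ‖V.toCF a‖ = ‖a‖ := UniformSpace.Completion.norm_coe a

theorem cf_induction {A : C} {p : V.CF A → Prop} (a : V.CF A) (hp : IsClosed {a | p a})
    (h : ∀ a, p (V.toCF a)) : p a := V.denseInducing_toCF.dense.induction_on a hp h

def cInner {A B : C} : V.CF B × V.CF A → Hom A B :=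
  (V.denseInducing_toCF.prodMap V.denseInducing_toCF).extend fun q => V.inner q.1 q.2

theorem cInner_coe {A B : C} (b : V.obj B) (a : V.obj A) :
    V.cInner (V.toCF b, V.toCF a) = V.inner b a :=
  (V.denseInducing_toCF.prodMap V.denseInducing_toCF).extend_eq
    (V.continuous_sem_inner A B) (b, a)

theorem continuous_cInner {A B : C} : Continuous (V.cInner (A := A) (B := B)) := by
  let φ : V.obj B →+ V.obj A →+ Hom A B :=
    { toFun := fun x => (V.innerL (A := A) (B := B) x).toAddMonoidHom
      map_zero' := by ext x; exact V.zero_inner _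
      map_add' := fun x y => by ext z; exact V.add_inner _ _ _ }
  exact (UniformSpace.Completion.isDenseInducing_toCompl (V.obj B)).extend_Z_bilin (φ := φ)
    (UniformSpace.Completion.isDenseInducing_toCompl (V.obj A)) (V.continuous_sem_inner A B)

theorem continuous_cInner_left {A B : C} (a : V.CF A) :
    Continuous fun b : V.CF B => V.cInner (b, a) := V.continuous_cInner.comp (by fun_prop)
theorem continuous_cInner_right {A B : C} (b : V.CF B) :
    Continuous fun a : V.CF A => V.cInner (b, a) := V.continuous_cInner.comp (by fun_prop)

def cAct {A B : C} (f : Hom B A) : V.CF A →L[ℂ] V.CF B := (V.semAct f).completion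

theorem cAct_coe {A B : C} (f : Hom B A) (a : V.obj A) :
    V.cAct f (V.toCF a) = V.toCF (V.act a f : V.obj B) :=
  (V.semAct f).completion_apply_coe a

theorem cInner_dag {A B : C} (b : V.CF B) (a : V.CF A) : (V.cInner (b, a))† = V.cInner (a, b) := by
  induction b using V.cf_induction with
  | hp => exact isClosed_eq (continuous_dag.comp (V.continuous_cInner_left a))
            (V.continuous_cInner_right a)
  | h b =>
    induction a using V.cf_induction with
    | hp => exact isClosed_eq (continuous_dag.comp (V.continuous_cInner_right _))
              (V.continuous_cInner_left _)
    | h a => rw [cInner_coe, cInner_coe, V.inner_dag]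

theorem cInner_add {A B : C} (b : V.CF B) (a a' : V.CF A) :
    V.cInner (b, a + a') = V.cInner (b, a) + V.cInner (b, a') := by
  induction b using V.cf_induction with
  | hp => exact isClosed_eq (V.continuous_cInner_left _)
            ((V.continuous_cInner_left _).add (V.continuous_cInner_left _))
  | h b =>
    induction a using V.cf_induction with
    | hp => exact isClosed_eq ((V.continuous_cInner_right _).comp (continuous_add_const a'))
              ((V.continuous_cInner_right _).add continuous_const)
    | h a =>
      induction a' using V.cf_induction with
      | hp => exact isClosed_eq ((V.continuous_cInner_right _).comp (continuous_const_add _))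
                (continuous_const.add (V.continuous_cInner_right _))
      | h a' => rw [← map_add, cInner_coe, cInner_coe, cInner_coe, V.inner_add]

theorem cInner_smul {A B : C} (c : ℂ) (b : V.CF B) (a : V.CF A) :
    V.cInner (b, c • a) = c • V.cInner (b, a) := by
  induction b using V.cf_induction with
  | hp => exact isClosed_eq (V.continuous_cInner_left _)
            ((V.continuous_cInner_left _).const_smul c)
  | h b =>
    induction a using V.cf_induction with
    | hp => exact isClosed_eq ((V.continuous_cInner_right _).comp (continuous_const_smul c))
              ((V.continuous_cInner_right _).const_smul c)
    | h a => rw [← map_smul, cInner_coe, cInner_coe, V.inner_smul]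

theorem cInner_act {A B D : C} (b : V.CF B) (a : V.CF A) (f : Hom D A) :
    V.cInner (b, V.cAct f a) = V.cInner (b, a) ⊚ f := by
  induction b using V.cf_induction with
  | hp => exact isClosed_eq (V.continuous_cInner_left _)
            (continuous_comp.comp ((V.continuous_cInner_left _).prodMk continuous_const))
  | h b =>
    induction a using V.cf_induction with
    | hp => exact isClosed_eq ((V.continuous_cInner_right _).comp (V.cAct f).continuous)
              (continuous_comp.comp ((V.continuous_cInner_right _).prodMk continuous_const))
    | h a => rw [cAct_coe, cInner_coe, cInner_coe, V.inner_act]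

theorem cInner_self_nonneg {A : C} (a : V.CF A) : 0 ≤ V.cInner (a, a) := by
  induction a using V.cf_induction with
  | hp => exact isClosed_le continuous_const
            (V.continuous_cInner.comp (continuous_id.prodMk continuous_id))
  | h a =>
    rw [cInner_coe]
    exact V.inner_nonneg a

theorem cf_norm_sq {A : C} (a : V.CF A) : ‖a‖ ^ 2 = ‖V.cInner (a, a)‖ := by
  induction a using V.cf_induction with
  | hp => exact isClosed_eq (continuous_norm.pow 2)
            (V.continuous_cInner.comp (continuous_id.prodMk continuous_id)).norm
  | h a => rw [cInner_coe, norm_toCF, V.sem_norm_sq]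

theorem cAct_add {A B : C} (a : V.CF A) (f f' : Hom B A) :
    V.cAct (f + f') a = V.cAct f a + V.cAct f' a := by
  induction a using V.cf_induction with
  | hp => exact isClosed_eq (V.cAct _).continuous ((V.cAct _).continuous.add (V.cAct _).continuous)
  | h a => rw [cAct_coe, cAct_coe, cAct_coe, V.act_add, map_add]

theorem cAct_smul {A B : C} (c : ℂ) (a : V.CF A) (f : Hom B A) :
    V.cAct (c • f) a = c • V.cAct f a := by
  induction a using V.cf_induction with
  | hp => exact isClosed_eq (V.cAct _).continuous ((V.cAct _).continuous.const_smul c)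
  | h a => rw [cAct_coe, cAct_coe, V.act_smul, map_smul]

theorem cAct_cAct {A B D : C} (a : V.CF A) (f : Hom B A) (g : Hom D B) :
    V.cAct g (V.cAct f a) = V.cAct (f ⊚ g) a := by
  induction a using V.cf_induction with
  | hp => exact isClosed_eq ((V.cAct _).continuous.comp (V.cAct _).continuous) (V.cAct _).continuous
  | h a => rw [cAct_coe, cAct_coe, cAct_coe, V.act_act]

theorem denseRange_toCF {A : C} : DenseRange fun a : V.obj A => V.toCF a :=
  V.denseInducing_toCF.dense

/-- The linear map underlying the inclusion into the completion. -/
def toCL {A : C} : V.obj A →ₗ[ℂ] V.CF A := V.toCF.toLinearMap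

end Local

/-- The Hilbert module obtained by separation and completion of a pre-Hilbert module. -/
def completion : HilbertModule C where
  obj := V.CF
  act a f := V.cAct f a
  inner b a := V.cInner (b, a)
  add_act a a' f := map_add (V.cAct f) a a'
  smul_act c a f := map_smul (V.cAct f) c a
  act_add := V.cAct_add
  act_smul := V.cAct_smul
  act_act := V.cAct_cAct
  inner_dag := V.cInner_dag
  inner_add := V.cInner_add
  inner_smul := V.cInner_smul
  inner_act := V.cInner_act
  inner_pos a := exists_of_nonneg (V.cInner_self_nonneg a)
  norm _ := inferInstance
  norm_sq := V.cf_norm_sq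
  core _ :=
    { norm_nonneg := norm_nonneg
      norm_smul := norm_smul
      norm_triangle := norm_add_le
      norm_eq_zero_iff := fun _ => norm_eq_zero }
  complete _ := complete_of_core inferInstance _

/-- The canonical map to the completion. -/
def toC {A : C} : V.obj A →ₗ[ℂ] V.completion.obj A := V.toCL

theorem toC_act {A B : C} (a : V.obj A) (f : Hom B A) :
    V.toC (V.act a f) = V.completion.act (V.toC a) f := (V.cAct_coe f a).symm

theorem inner_toC {A B : C} (b : V.obj B) (a : V.obj A) :
    V.completion.inner (V.toC b) (V.toC a) = V.inner b a := V.cInner_coe b a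

theorem norm_toC_sq {A : C} (a : V.obj A) : ‖V.toC a‖ ^ 2 = ‖V.inner a a‖ := by
  rw [V.completion.norm_sq', V.inner_toC]

theorem denseRange_toC {A : C} : DenseRange (V.toC (A := A)) := by
  have h := V.denseRange_toCF (A := A)
  have e : (V.completion.instNACG A).toUniformSpace =
    (instCF V A).toUniformSpace :=
    uniformSpace_of_core (E := V.CF A) inferInstance (V.completion.core A)
  unfold DenseRange Dense at h ⊢
  rw [e]
  exact h

attribute [irreducible] completion

end PreHilbertModule
end Completion
end

end HilbCat

namespace HilbCat

noncomputable section
open StarCat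

section Ext
variable {C : Type u} [CStarCat C]

namespace PreHilbertModule
variable {V W X : PreHilbertModule C}

/-- The extension of bounded linear maps to the completions. -/
def extOp (T : ∀ A, V.obj A →ₗ[ℂ] W.obj A) (A : C) :
    V.completion.obj A →ₗ[ℂ] W.completion.obj A :=
  ((W.toC ∘ₗ T A).extendOfNorm V.toC).toLinearMap

/-- A bound with respect to the seminorms. -/
def SemBounded (T : ∀ A, V.obj A →ₗ[ℂ] W.obj A) : Prop :=
  ∃ K : ℝ, ∀ (A : C) (a : V.obj A), ‖W.toC (T A a)‖ ≤ K * ‖V.toC a‖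

theorem extOp_toC {T : ∀ A, V.obj A →ₗ[ℂ] W.obj A} (h : SemBounded T) {A : C} (a : V.obj A) :
    extOp T A (V.toC a) = W.toC (T A a) := by
  obtain ⟨K, hK⟩ := h
  exact LinearMap.extendOfNorm_eq V.denseRange_toC ⟨K, hK A⟩ a

theorem continuous_extOp (T : ∀ A, V.obj A →ₗ[ℂ] W.obj A) (A : C) : Continuous (extOp T A) :=
  ((W.toC ∘ₗ T A).extendOfNorm V.toC).continuous

theorem c_induction {A : C} {p : V.completion.obj A → Prop} (a : V.completion.obj A)
    (hp : IsClosed {a | p a}) (h : ∀ a, p (V.toC a)) : p a := V.denseRange_toC.induction_on a hp h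

theorem isBoundedMap_extOp {T : ∀ A, V.obj A →ₗ[ℂ] W.obj A} (h : SemBounded T)
    (nat : ∀ {A B : C} (a : V.obj A) (k : Hom B A), T B (V.act a k) = W.act (T A a) k) :
    IsBoundedMap (extOp T) := by
  refine ⟨fun {A B} a k => ?_, ?_⟩
  · induction a using c_induction with
    | hp => exact isClosed_eq ((continuous_extOp T B).comp
              (V.completion.continuous_act.comp (continuous_id.prodMk continuous_const)))
              (W.completion.continuous_act.comp ((continuous_extOp T A).prodMk continuous_const))
    | h a => rw [← toC_act, extOp_toC h, extOp_toC h, nat, toC_act]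
  · obtain ⟨K, hK⟩ := h
    exact ⟨K, fun A a => LinearMap.norm_extendOfNorm_apply_le V.denseRange_toC K (hK A) a⟩

theorem isAdjoint_extOp {T : ∀ A, V.obj A →ₗ[ℂ] W.obj A} {S : ∀ A, W.obj A →ₗ[ℂ] V.obj A}
    (h : SemBounded T) (h' : SemBounded S)
    (adj : ∀ {A B : C} (a : V.obj A) (x : W.obj B), V.inner a (S B x) = W.inner (T A a) x) :
    IsAdjoint (extOp T) (extOp S) := by
  intro A B a x
  induction a using c_induction with
  | hp => exact isClosed_eq (V.completion.continuous_inner.comp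
            (continuous_id.prodMk continuous_const))
            (W.completion.continuous_inner.comp ((continuous_extOp T A).prodMk continuous_const))
  | h a =>
    induction x using c_induction with
    | hp => exact isClosed_eq (V.completion.continuous_inner.comp
              (continuous_const.prodMk (continuous_extOp S B)))
              (W.completion.continuous_inner.comp (continuous_const.prodMk continuous_id))
    | h x => rw [extOp_toC h, extOp_toC h', inner_toC, inner_toC, adj]

theorem toC_norm_inner_le {A B : C} (a : V.obj A) (b : V.obj B) :
    ‖V.inner a b‖ ≤ ‖V.toC a‖ * ‖V.toC b‖ := by
  rw [← V.inner_toC]; exact V.completion.norm_inner_le _ _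

theorem seq_bound {a : ℕ → ℝ} (h0 : ∀ n, 0 ≤ a n) (h : ∀ n, a n ^ 2 ≤ a 0 * a (2 * n)) {K M : ℝ}
    (hK : 0 < K) (hM : ∀ n, a n ≤ M * K ^ n) : a 1 ≤ K * a 0 := by
  rcases (h0 0).eq_or_lt with h1 | h1
  · have := h 1
    rw [← h1, zero_mul] at this
    rw [← h1, mul_zero]
    nlinarith [h0 1]
  · by_contra! hc
    set t := a 1 / (K * a 0) with ht
    have ht1 : 1 < t := by rw [ht, one_lt_div (by positivity)]; exact hc
    have key : ∀ m : ℕ, a 0 * (K * t) ^ (2 ^ m) ≤ a (2 ^ m) := by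
      intro m
      induction m with
      | zero =>
        rw [pow_zero, pow_one, ht]
        apply le_of_eq; field_simp
      | succ m ih =>
        have h2 := h (2 ^ m)
        rw [← pow_succ'] at h2
        have h3 : (a 0 * (K * t) ^ (2 ^ m)) ^ 2 ≤ a (2 ^ m) ^ 2 :=
          pow_le_pow_left₀ (by positivity) ih 2
        rw [pow_succ 2 m, pow_mul]
        set y := (K * t) ^ 2 ^ m
        have h4 : a 0 * (a 0 * y ^ 2) ≤ a 0 * a (2 ^ (m + 1)) := by nlinarith
        exact le_of_mul_le_mul_left h4 h1
    have key2 : ∀ m : ℕ, t ^ (2 ^ m) ≤ M / a 0 := by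
      intro m
      have h5 := (key m).trans (hM _)
      rw [mul_pow] at h5
      rw [le_div_iff₀ h1]
      have h6 : 0 < K ^ 2 ^ m := by positivity
      have : K ^ 2 ^ m * (t ^ 2 ^ m * a 0) ≤ K ^ 2 ^ m * M := by nlinarith
      exact le_of_mul_le_mul_left this h6
    obtain ⟨n, hn⟩ := pow_unbounded_of_one_lt (M / a 0) ht1
    have := key2 n
    have h7 : t ^ n ≤ t ^ 2 ^ n := pow_le_pow_right₀ ht1.le Nat.lt_two_pow_self.le
    linarith

theorem bound_of_pow {A : C} (T : V.obj A →ₗ[ℂ] W.obj A) (S : W.obj A →ₗ[ℂ] V.obj A)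
    (adj : ∀ (a : V.obj A) (x : W.obj A), V.inner a (S x) = W.inner (T a) x)
    {K : ℝ} (hK : 0 < K)
    (hM : ∀ a : V.obj A, ∃ M : ℝ, ∀ n : ℕ, ‖V.toC (((S ∘ₗ T) ^ n) a)‖ ≤ M * K ^ n) (a : V.obj A) :
    ‖W.toC (T a)‖ ≤ √K * ‖V.toC a‖ := by
  obtain ⟨M, hM⟩ := hM a
  have sym : ∀ x y : V.obj A, V.inner ((S ∘ₗ T) x) y = V.inner x ((S ∘ₗ T) y) := fun x y => by
    rw [LinearMap.comp_apply, LinearMap.comp_apply, adj, ← V.inner_dag, adj, W.inner_dag]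
  have sympow : ∀ (n : ℕ) (x y : V.obj A),
      V.inner (((S ∘ₗ T) ^ n) x) y = V.inner x (((S ∘ₗ T) ^ n) y) := by
    intro n
    induction n with
    | zero => intro x y; rfl
    | succ n ih => intro x y; rw [pow_succ, Module.End.mul_apply, ih, sym, ← Module.End.mul_apply,
                    ← pow_succ', ← pow_succ]
  have h1 : ‖V.toC ((S ∘ₗ T) a)‖ ≤ K * ‖V.toC a‖ := by
    have := seq_bound (a := fun n => ‖V.toC (((S ∘ₗ T) ^ n) a)‖) (fun n => norm_nonneg _)
      (fun n => ?_) hK hM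
    · simpa using this
    · rw [norm_toC_sq, sympow, ← Module.End.mul_apply, ← pow_add, ← two_mul]
      exact V.toC_norm_inner_le _ _
  have h2 : ‖W.toC (T a)‖ ^ 2 ≤ (√K * ‖V.toC a‖) ^ 2 := by
    rw [norm_toC_sq, ← adj, mul_pow, Real.sq_sqrt hK.le]
    have := V.toC_norm_inner_le a (S (T a))
    rw [LinearMap.comp_apply] at h1
    nlinarith [norm_nonneg (V.toC a)]
  exact le_of_sq_le_sq h2 (by positivity)

end PreHilbertModule
end Ext
end

end HilbCat

namespace HilbCat

noncomputable section
open StarCat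
open scoped Classical

section BaseChange
variable {D C : Type u} [CStarCat D] [CStarCat C] (f : StarFunctor D C) (H : HilbertModule D)

/-- Finite formal sums `∑ᵢ hᵢ ⊗ gᵢ` with `hᵢ ∈ H(dᵢ)` and `gᵢ : B ⟶ f(dᵢ)`, additive in `gᵢ`. -/
abbrev BCFib (B : C) : Type u := Π₀ i : (Σ d : D, H.obj d), Hom B (f.obj i.1)

def bcRow {B : C} (j : Σ d : D, H.obj d) : BCFib f H B →ₗ[ℂ] Hom B (f.obj j.1) :=
  DFinsupp.lsum ℕ fun i => compL (f.map (H.inner j.2 i.2))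

/-- `⟨∑ᵢ kᵢ ⊗ lᵢ, ∑ⱼ hⱼ ⊗ gⱼ⟩ = ∑ᵢⱼ lᵢ† ⊚ f⟨kᵢ, hⱼ⟩ ⊚ gⱼ`. -/
def bcInnerL {A B : C} (v : BCFib f H B) : BCFib f H A →ₗ[ℂ] Hom A B :=
  DFinsupp.lsum ℕ fun j => compL ((bcRow f H j v)†)

theorem bcRow_single {B : C} (j i : Σ d : D, H.obj d) (g : Hom B (f.obj i.1)) :
    bcRow f H j (DFinsupp.single i g) = f.map (H.inner j.2 i.2) ⊚ g := by
  rw [bcRow, DFinsupp.lsum_single]; rfl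

theorem bcInnerL_single {A B : C} (v : BCFib f H B) (j : Σ d : D, H.obj d)
    (g : Hom A (f.obj j.1)) :
    bcInnerL f H v (DFinsupp.single j g) = (bcRow f H j v)† ⊚ g := by
  rw [bcInnerL, DFinsupp.lsum_single]; rfl

theorem bcInner_single {A B : C} (i j : Σ d : D, H.obj d) (l : Hom B (f.obj i.1))
    (g : Hom A (f.obj j.1)) :
    bcInnerL f H (DFinsupp.single i l) (DFinsupp.single j g) =
      l† ⊚ f.map (H.inner i.2 j.2) ⊚ g := by
  rw [bcInnerL_single, bcRow_single, dag_comp, ← f.map_dag, H.inner_dag, comp_assoc]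

theorem bcInner_add_left {A B : C} (v v' : BCFib f H B) (w : BCFib f H A) :
    bcInnerL f H (v + v') w = bcInnerL f H v w + bcInnerL f H v' w := by
  have : (bcInnerL f H (v + v') : BCFib f H A →ₗ[ℂ] Hom A B) = bcInnerL f H v + bcInnerL f H v' := by
    refine DFinsupp.lhom_ext fun j g => ?_
    rw [LinearMap.add_apply, bcInnerL_single, bcInnerL_single, bcInnerL_single, map_add, dag_add,
      add_comp]
  rw [this, LinearMap.add_apply]

theorem bc_induction {B : C} {p : BCFib f H B → Prop} (v : BCFib f H B) (h0 : p 0)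
    (hs : ∀ i g, p (DFinsupp.single i g)) (ha : ∀ v w, p v → p w → p (v + w)) : p v :=
  DFinsupp.induction v h0 fun i b _ _ _ hv => ha _ _ (hs i b) hv

theorem bcInner_zero_left {A B : C} (w : BCFib f H A) :
    bcInnerL f H (0 : BCFib f H B) w = 0 := by
  simpa using bcInner_add_left f H (0 : BCFib f H B) 0 w

theorem bcInner_dag {A B : C} (v : BCFib f H B) (w : BCFib f H A) :
    (bcInnerL f H v w)† = bcInnerL f H w v := by
  induction v using bc_induction with
  | h0 => rw [bcInner_zero_left, map_zero, dag_zero]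
  | ha v v' hv hv' => rw [bcInner_add_left, dag_add, hv, hv', map_add]
  | hs i l =>
    induction w using bc_induction with
    | h0 => rw [bcInner_zero_left, map_zero, dag_zero]
    | ha v v' hv hv' => rw [bcInner_add_left, ← hv, ← hv', map_add, dag_add]
    | hs j g =>
      rw [bcInner_single, bcInner_single, dag_comp, dag_comp, dag_dag, ← f.map_dag, H.inner_dag,
        comp_assoc]

def bcAct {A B : C} (k : Hom B A) : BCFib f H A →ₗ[ℂ] BCFib f H B :=
  DFinsupp.mapRange.linearMap fun _ => compL.flip k

theorem bcAct_single {A B : C} (k : Hom B A) (i : Σ d : D, H.obj d) (g : Hom A (f.obj i.1)) :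
    bcAct f H k (DFinsupp.single i g : BCFib f H A) =
      (DFinsupp.single i (g ⊚ k : Hom B (f.obj i.1)) : BCFib f H B) := by
  exact DFinsupp.mapRange_single (hf := fun _ => map_zero (compL.flip k))

theorem bcInner_act {A B E : C} (v : BCFib f H B) (w : BCFib f H A) (k : Hom E A) :
    bcInnerL f H v (bcAct f H k w) = bcInnerL f H v w ⊚ k := by
  induction w using bc_induction with
  | h0 => rw [map_zero, map_zero, map_zero, zero_comp]
  | ha v v' hv hv' => rw [map_add, map_add, map_add, hv, hv', add_comp]
  | hs i l => rw [bcAct_single, bcInnerL_single, bcInnerL_single, comp_assoc]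

/-- Positivity of the matrices `(f⟨hᵢ, hⱼ⟩)`. -/
theorem bc_pos {A : C} {ι : Type*} (s : Finset ι) : ∀ (d : ι → D) (h : ∀ i, H.obj (d i))
    (g : ∀ i, Hom A (f.obj (d i))),
    0 ≤ ∑ i ∈ s, ∑ j ∈ s, (g i)† ⊚ f.map (H.inner (h i) (h j)) ⊚ g j := by
  induction s using Finset.induction_on with
  | empty => intro d h g; simp
  | insert a s ha ih =>
    intro d h g
    set T := ∑ i ∈ insert a s, ∑ j ∈ insert a s, (g i)† ⊚ f.map (H.inner (h i) (h j)) ⊚ g j with hT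
    set M : ℝ := ∑ i ∈ insert a s, ‖g i‖ * ‖h i‖ with hM
    have hM0 : 0 ≤ M := Finset.sum_nonneg fun i _ => by positivity
    -- approximate `T` by positive elements
    have key : ∀ ε : ℝ, 0 < ε → ∃ P : Hom A A, 0 ≤ P ∧ ‖T - P‖ ≤ 2 * (‖g a‖ * ε * M) := by
      intro ε hε
      set p := H.inner (h a) (h a) with hp
      obtain ⟨r, w, -, -, hr, hw, hwr, hwp, hn, hpos⟩ :=
        exists_approx p (H.inner_nonneg (h a)) (δ := ε ^ 2) (by positivity)
      set h' : ∀ i, H.obj (d i) := fun i => h i - H.act (h a) (r ⊚ H.inner (h a) (h i)) with hh'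
      set m : ∀ i j, Hom (d j) (d i) := fun i j =>
        H.inner (h i) (h a) ⊚ (r + r - r * p * r) ⊚ H.inner (h a) (h j) with hm
      have hr' : r† = r := hr
      have e1 : ∀ i j, H.inner (h i) (h j) = H.inner (h' i) (h' j) + m i j := by
        intro i j
        simp only [hh', hm, H.inner_sub, H.sub_inner, H.inner_act, H.act_inner, dag_comp, hr',
          H.inner_dag, mul_def, comp_sub, sub_comp, comp_add, add_comp, comp_assoc, ← hp]
        abel
      have hmpos : ∀ i, 0 ≤ m i i := fun i => by
        have := conj_nonneg hpos (H.inner (h a) (h i))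
        rwa [H.inner_dag] at this
      have h'le : ∀ i, ‖h' i‖ ≤ ‖h i‖ := fun i => by
        have e := e1 i i
        have : ‖H.inner (h' i) (h' i)‖ ≤ ‖H.inner (h i) (h i)‖ :=
          CStarAlgebra.norm_le_norm_of_nonneg_of_le (H.inner_nonneg _)
            (by rw [e]; exact le_add_of_nonneg_right (hmpos i))
        rw [← H.norm_sq', ← H.norm_sq'] at this
        exact le_of_sq_le_sq this (norm_nonneg _)
      have h'a : ‖h' a‖ ≤ ε := by
        have e : H.inner (h' a) (h' a) = p - p * w - w * p + w * p * w := by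
          have e2 : h' a = h a - H.act (h a) w := by rw [hh', hwr]; rfl
          have hw' : w† = w := hw
          rw [e2, H.inner_sub, H.sub_inner, H.sub_inner, H.inner_act, H.inner_act, H.act_inner,
            hw', ← hp, mul_def, mul_def, mul_def]
          abel
        have : ‖h' a‖ ^ 2 ≤ ε ^ 2 := by rw [H.norm_sq', e]; exact hn.le
        exact le_of_sq_le_sq this hε.le
      set N : ∀ i j, Hom A A := fun i j => (g i)† ⊚ f.map (H.inner (h' i) (h' j)) ⊚ g j with hN
      set G := ∑ j ∈ insert a s, f.map (H.inner (h a) (h j)) ⊚ g j with hG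
      have e2 : T = ∑ i ∈ insert a s, ∑ j ∈ insert a s, N i j +
          G† ⊚ f.map (r + r - r * p * r) ⊚ G := by
        rw [hT, hG, dag_sum, sum_comp]
        simp only [comp_sum]
        rw [← Finset.sum_add_distrib]
        refine Finset.sum_congr rfl fun i _ => ?_
        rw [← Finset.sum_add_distrib]
        refine Finset.sum_congr rfl fun j _ => ?_
        rw [e1 i j, f.map_add, add_comp, comp_add, hN, hm]
        congr 1
        rw [f.map_comp, f.map_comp, dag_comp, ← f.map_dag, H.inner_dag]
        simp only [comp_assoc]
      refine ⟨∑ i ∈ s, ∑ j ∈ s, N i j + G† ⊚ f.map (r + r - r * p * r) ⊚ G,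
        add_nonneg (ih d h' g) (conj_nonneg (f.map_nonneg hpos) G), ?_⟩
      have e3 : T - (∑ i ∈ s, ∑ j ∈ s, N i j + G† ⊚ f.map (r + r - r * p * r) ⊚ G) =
          ∑ j ∈ insert a s, N a j + ∑ i ∈ s, N i a := by
        rw [e2, Finset.sum_insert ha]
        have : ∑ i ∈ s, ∑ j ∈ insert a s, N i j = ∑ i ∈ s, N i a + ∑ i ∈ s, ∑ j ∈ s, N i j := by
          rw [← Finset.sum_add_distrib]
          exact Finset.sum_congr rfl fun i _ => Finset.sum_insert ha
        rw [this]; abel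
      have bN : ∀ i j, ‖N i j‖ ≤ (‖g i‖ * ‖h' i‖) * (‖g j‖ * ‖h' j‖) := fun i j => by
        have h1 := norm_comp_le (g i)† (f.map (H.inner (h' i) (h' j)) ⊚ g j)
        have h2 := norm_comp_le (f.map (H.inner (h' i) (h' j))) (g j)
        have h3 := (f.norm_map_le (H.inner (h' i) (h' j))).trans (H.norm_inner_le _ _)
        rw [norm_dag] at h1
        calc ‖N i j‖ ≤ ‖g i‖ * ‖f.map (H.inner (h' i) (h' j)) ⊚ g j‖ := h1
          _ ≤ ‖g i‖ * ((‖h' i‖ * ‖h' j‖) * ‖g j‖) := by gcongr; exact h2.trans (by gcongr)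
          _ = _ := by ring
      rw [e3, two_mul]
      refine (norm_add_le _ _).trans (add_le_add ?_ ?_)
      · refine (norm_sum_le _ _).trans ?_
        rw [hM, Finset.mul_sum]
        refine Finset.sum_le_sum fun j _ => (bN a j).trans ?_
        gcongr
        exact h'le j
      · refine (norm_sum_le _ _).trans ?_
        have : ∑ i ∈ s, ‖g i‖ * ‖h i‖ ≤ M := by
          rw [hM, Finset.sum_insert ha]; exact le_add_of_nonneg_left (by positivity)
        refine le_trans ?_ (mul_le_mul_of_nonneg_left this (by positivity))
        rw [Finset.mul_sum]
        refine Finset.sum_le_sum fun j _ => (bN j a).trans ?_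
        rw [mul_comm]
        gcongr
        exact h'le j
    have cl : T ∈ closure {P : Hom A A | 0 ≤ P} := by
      rw [Metric.mem_closure_iff]
      intro ε hε
      obtain ⟨P, hP, hb⟩ := key (ε / (2 * (‖g a‖ * M) + 1)) (by positivity)
      refine ⟨P, hP, ?_⟩
      rw [dist_eq_norm]
      refine hb.trans_lt ?_
      have : 2 * (‖g a‖ * (ε / (2 * (‖g a‖ * M) + 1)) * M) =
        ε * ((2 * (‖g a‖ * M)) / (2 * (‖g a‖ * M) + 1)) := by ring
      rw [this]
      have h3 : (2 * (‖g a‖ * M)) / (2 * (‖g a‖ * M) + 1) < 1 := by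
        rw [div_lt_one (by positivity)]; linarith
      nlinarith
    rwa [CStarAlgebra.isClosed_nonneg.closure_eq] at cl

theorem bcInner_pos {A : C} (v : BCFib f H A) : 0 ≤ bcInnerL f H v v := by
  have e : v = ∑ i ∈ v.support, DFinsupp.single i (v i) := DFinsupp.sum_single.symm
  have hadd : ∀ (s : Finset (Σ d : D, H.obj d)) (w : BCFib f H A),
      bcInnerL f H (∑ i ∈ s, DFinsupp.single i (v i) : BCFib f H A) w =
        ∑ i ∈ s, bcInnerL f H (DFinsupp.single i (v i) : BCFib f H A) w := fun s w =>
    map_sum (AddMonoidHom.mk' (fun x : BCFib f H A => bcInnerL f H x w)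
      fun x y => bcInner_add_left f H x y w) _ s
  rw [e, hadd]
  simp only [map_sum, bcInner_single]
  exact bc_pos f H v.support _ _ _

/-- The pre-Hilbert module of formal sums. -/
def bcPre : PreHilbertModule C where
  obj := BCFib f H
  act v k := bcAct f H k v
  inner v w := bcInnerL f H v w
  add_act v w k := map_add _ v w
  smul_act c v k := map_smul _ c v
  act_add v k k' := by
    induction v using bc_induction with
    | h0 => simp
    | ha v v' hv hv' => rw [map_add, map_add, map_add, hv, hv']; abel
    | hs i l => rw [bcAct_single, bcAct_single, bcAct_single, comp_add, DFinsupp.single_add]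
  act_smul c v k := by
    induction v using bc_induction with
    | h0 => simp
    | ha v v' hv hv' => rw [map_add, map_add, hv, hv', smul_add]
    | hs i l => rw [bcAct_single, bcAct_single, comp_smul, DFinsupp.single_smul]
  act_act v k l := by
    induction v using bc_induction with
    | h0 => simp
    | ha v v' hv hv' => rw [map_add, map_add, map_add, hv, hv']
    | hs i g => rw [bcAct_single, bcAct_single, bcAct_single, comp_assoc]
  inner_dag := bcInner_dag f H
  inner_add v w w' := map_add _ w w'
  inner_smul c v w := map_smul _ c w
  inner_act := bcInner_act f H
  inner_pos v := exists_of_nonneg (bcInner_pos f H v)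

theorem bcPre_induction {B : C} {p : (bcPre f H).obj B → Prop} (v : (bcPre f H).obj B) (h0 : p 0)
    (hs : ∀ (d : D) (h : H.obj d) (g : Hom B (f.obj d)), p (DFinsupp.single ⟨d, h⟩ g : BCFib f H B))
    (ha : ∀ v w, p v → p w → p (v + w)) : p v :=
  bc_induction f H v h0 (fun i g => hs i.1 i.2 g) ha

/-- The Hilbert `C`-module generated by symbols `h ⊗ g`, for `h ∈ H(d)` and `g : B ⟶ f(d)`, with
`⟨h ⊗ g, h' ⊗ g'⟩ = g† ⊚ f⟨h, h'⟩ ⊚ g'`. -/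
def bcModule : HilbertModule C := (bcPre f H).completion

/-- The element `h ⊗ g`. -/
def tens {d : D} (h : H.obj d) {B : C} (g : Hom B (f.obj d)) : (bcModule f H).obj B :=
  (bcPre f H).toC (DFinsupp.single ⟨d, h⟩ g : BCFib f H B)

theorem inner_tens {d d' : D} (h : H.obj d) (h' : H.obj d') {A B : C} (g : Hom B (f.obj d))
    (g' : Hom A (f.obj d')) :
    (bcModule f H).inner (tens f H h g) (tens f H h' g') = g† ⊚ f.map (H.inner h h') ⊚ g' :=
  ((bcPre f H).inner_toC _ _).trans (bcInner_single f H ⟨d, h⟩ ⟨d', h'⟩ g g')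

theorem tens_act {d : D} (h : H.obj d) {A B : C} (g : Hom B (f.obj d)) (k : Hom A B) :
    (bcModule f H).act (tens f H h g) k = tens f H h (g ⊚ k) :=
  ((bcPre f H).toC_act _ k).symm.trans
    (congrArg (bcPre f H).toC (bcAct_single f H k ⟨d, h⟩ g))

theorem bc_toC_mem {B : C} (v : (bcPre f H).obj B) :
    (bcPre f H).toC v ∈ Submodule.span ℂ {x : (bcModule f H).obj B |
      ∃ (d : D) (h : H.obj d) (g : Hom B (f.obj d)), x = tens f H h g} := by
  induction v using bc_induction with
  | h0 =>
    have : (bcPre f H).toC (0 : (bcPre f H).obj B) = 0 := map_zero _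
    exact this ▸ Submodule.zero_mem _
  | hs i g => exact Submodule.subset_span ⟨i.1, i.2, g, rfl⟩
  | ha v w hv hw =>
    have : (bcPre f H).toC ((v : (bcPre f H).obj B) + w) =
      (bcPre f H).toC v + (bcPre f H).toC w := map_add _ _ _
    exact this ▸ Submodule.add_mem _ hv hw

theorem bc_dense {B : C} (x : (bcModule f H).obj B) :
    x ∈ closure (Submodule.span ℂ {x : (bcModule f H).obj B |
      ∃ (d : D) (h : H.obj d) (g : Hom B (f.obj d)), x = tens f H h g} :
      Set ((bcModule f H).obj B)) := by
  refine closure_mono ?_ ((bcPre f H).denseRange_toC (A := B) x)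
  rintro _ ⟨v, rfl⟩
  exact bc_toC_mem f H v

theorem bc_induct {B : C} {p : (bcModule f H).obj B → Prop} (x : (bcModule f H).obj B)
    (hc : IsClosed {x | p x}) (h0 : p 0)
    (ht : ∀ {d : D} (h : H.obj d) (g : Hom B (f.obj d)), p (tens f H h g))
    (ha : ∀ x y, p x → p y → p (x + y)) (hm : ∀ (c : ℂ) x, p x → p (c • x)) : p x := by
  refine closure_minimal (fun y hy => ?_) hc (bc_dense f H x)
  refine Submodule.span_induction ?_ h0 (fun x y _ _ => ha x y) (fun c x _ => hm c x) hy
  rintro _ ⟨d, h, g, rfl⟩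
  exact ht h g

theorem bc_ext {B : C} {x y : (bcModule f H).obj B}
    (e : ∀ {d : D} (h : H.obj d) (g : Hom B (f.obj d)),
      (bcModule f H).inner (tens f H h g) x = (bcModule f H).inner (tens f H h g) y) : x = y := by
  rw [← sub_eq_zero]
  apply (bcModule f H).eq_zero
  have : ∀ z : (bcModule f H).obj B, (bcModule f H).inner z (x - y) = 0 := fun z => by
    induction z using bc_induct with
    | hc => exact isClosed_eq ((bcModule f H).continuous_inner.comp
              (continuous_id.prodMk continuous_const)) continuous_const
    | h0 => exact (bcModule f H).zero_inner _
    | ht h g => rw [(bcModule f H).inner_sub, e, sub_self]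
    | ha z w hz hw => rw [(bcModule f H).add_inner, hz, hw, add_zero]
    | hm c z hz => rw [(bcModule f H).smul_inner, hz, smul_zero]
  exact this _

theorem tens_add {d : D} (h h' : H.obj d) {B : C} (g : Hom B (f.obj d)) :
    tens f H (h + h') g = tens f H h g + tens f H h' g := bc_ext f H fun k l => by
  rw [(bcModule f H).inner_add, inner_tens, inner_tens, inner_tens, H.inner_add, f.map_add,
    add_comp, comp_add]

theorem tens_smul {d : D} (c : ℂ) (h : H.obj d) {B : C} (g : Hom B (f.obj d)) :
    tens f H (c • h) g = c • tens f H h g := bc_ext f H fun k l => by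
  rw [(bcModule f H).inner_smul, inner_tens, inner_tens, H.inner_smul, f.map_smul, smul_comp,
    comp_smul]

theorem tens_act_left {d e : D} (h : H.obj d) (k : Hom e d) {B : C} (g : Hom B (f.obj e)) :
    tens f H (H.act h k) g = tens f H h (f.map k ⊚ g) := bc_ext f H fun l m => by
  rw [inner_tens, inner_tens, H.inner_act, f.map_comp, comp_assoc]

theorem norm_tens_le {d : D} (h : H.obj d) {B : C} (g : Hom B (f.obj d)) :
    ‖tens f H h g‖ ≤ ‖h‖ * ‖g‖ := by
  have : ‖tens f H h g‖ ^ 2 ≤ (‖h‖ * ‖g‖) ^ 2 := by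
    rw [HilbertModule.norm_sq', inner_tens]
    have h1 := norm_comp_le g† (f.map (H.inner h h) ⊚ g)
    have h2 := norm_comp_le (f.map (H.inner h h)) g
    have h3 := f.norm_map_le (H.inner h h)
    rw [norm_dag] at h1
    rw [← H.norm_sq'] at h3
    calc _ ≤ ‖g‖ * ‖f.map (H.inner h h) ⊚ g‖ := h1
      _ ≤ ‖g‖ * (‖h‖ ^ 2 * ‖g‖) := by gcongr; exact h2.trans (by gcongr)
      _ = _ := by ring
  exact le_of_sq_le_sq this (by positivity)

variable {H} {G : HilbertModule D}

/-- `h ⊗ g ↦ T h ⊗ g`. -/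
def bcMap (T : ∀ d, H.obj d →ₗ[ℂ] G.obj d) (B : C) : (bcPre f H).obj B →ₗ[ℂ] (bcPre f G).obj B :=
  (DFinsupp.lsum ℕ fun i => DFinsupp.lsingle (M := fun j : Σ d : D, G.obj d => Hom B (f.obj j.1))
    (⟨i.1, T i.1 i.2⟩ : Σ d : D, G.obj d) : BCFib f H B →ₗ[ℂ] BCFib f G B)

theorem bcMap_single (T : ∀ d, H.obj d →ₗ[ℂ] G.obj d) (B : C) (i : Σ d : D, H.obj d)
    (g : Hom B (f.obj i.1)) :
    bcMap f T B (DFinsupp.single i g : BCFib f H B) =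
      (DFinsupp.single ⟨i.1, T i.1 i.2⟩ g : BCFib f G B) := by
  exact DFinsupp.lsum_single (N := BCFib f G B) ℕ (fun i : Σ d : D, H.obj d =>
    DFinsupp.lsingle (M := fun j : Σ d : D, G.obj d => Hom B (f.obj j.1))
    (⟨i.1, T i.1 i.2⟩ : Σ d : D, G.obj d)) i g

theorem bcMap_act (T : ∀ d, H.obj d →ₗ[ℂ] G.obj d) {A B : C} (v : (bcPre f H).obj A)
    (k : Hom B A) : bcMap f T B ((bcPre f H).act v k) = (bcPre f G).act (bcMap f T A v) k := by
  change bcMap f T B (bcAct f H k v) = bcAct f G k (bcMap f T A v)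
  induction v using bc_induction with
  | h0 =>
    exact ((congrArg (bcMap f T B) (map_zero (bcAct f H k))).trans (map_zero (bcMap f T B))).trans
      ((congrArg (bcAct f G k) (map_zero (bcMap f T A))).trans (map_zero (bcAct f G k))).symm
  | hs i g => rw [bcAct_single, bcMap_single, bcMap_single, bcAct_single]
  | ha v w hv hw =>
    exact (((congrArg (bcMap f T B) (map_add (bcAct f H k) v w)).trans
      (map_add (bcMap f T B) _ _)).trans (congrArg₂ (· + ·) hv hw)).trans
      ((congrArg (bcAct f G k) (map_add (bcMap f T A) v w)).trans
        (map_add (bcAct f G k) _ _)).symm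

theorem bcMap_adj {T : ∀ d, H.obj d →ₗ[ℂ] G.obj d} {S : ∀ d, G.obj d →ₗ[ℂ] H.obj d}
    (hTS : IsAdjoint T S) {A B : C} (v : (bcPre f H).obj A) (w : (bcPre f G).obj B) :
    (bcPre f H).inner v (bcMap f S B w) = (bcPre f G).inner (bcMap f T A v) w := by
  induction v using bc_induction with
  | h0 =>
    refine ((bcPre f H).zero_inner _).trans (Eq.symm ?_)
    exact (congrArg (fun z => (bcPre f G).inner z w) (map_zero (bcMap f T A))).trans
      ((bcPre f G).zero_inner _)
  | ha v v' hv hv' =>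
    refine ((bcPre f H).add_inner v v' _).trans ((congrArg₂ (· + ·) hv hv').trans (Eq.symm ?_))
    exact (congrArg (fun z => (bcPre f G).inner z w) (map_add (bcMap f T A) v v')).trans
      ((bcPre f G).add_inner _ _ _)
  | hs i l =>
    rw [bcMap_single]
    induction w using bc_induction with
    | h0 =>
      exact (congrArg ((bcPre f H).inner _) (map_zero (bcMap f S B))).trans
        (((bcPre f H).inner_zero _).trans ((bcPre f G).inner_zero _).symm)
    | ha w w' hw hw' =>
      exact (congrArg ((bcPre f H).inner _) (map_add (bcMap f S B) w w')).trans
        (((bcPre f H).inner_add _ _ _).trans ((congrArg₂ (· + ·) hw hw').trans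
          ((bcPre f G).inner_add _ _ _).symm))
    | hs j g =>
      rw [bcMap_single]
      refine (bcInner_single f H i ⟨j.1, S j.1 j.2⟩ l g).trans
        (Eq.trans ?_ (bcInner_single f G ⟨i.1, T i.1 i.2⟩ j l g).symm)
      rw [hTS]

theorem bcMap_bounded {T : ∀ d, H.obj d →ₗ[ℂ] G.obj d} {S : ∀ d, G.obj d →ₗ[ℂ] H.obj d}
    (hTS : IsAdjoint T S) (hT : IsBoundedMap T) (hS : IsBoundedMap S) :
    PreHilbertModule.SemBounded (bcMap f T) := by
  obtain ⟨-, K, hK⟩ := hT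
  obtain ⟨-, L, hL⟩ := hS
  set M := (|K| + 1) * (|L| + 1) with hM
  have hM0 : 0 < M := by positivity
  have hST : ∀ {d : D} (h : H.obj d), ‖S d (T d h)‖ ≤ M * ‖h‖ := fun {d} h => by
    have h1 : ‖T d h‖ ≤ (|K| + 1) * ‖h‖ := (hK d h).trans
      (mul_le_mul_of_nonneg_right (by linarith [le_abs_self K]) (norm_nonneg _))
    have h2 : ‖S d (T d h)‖ ≤ (|L| + 1) * ‖T d h‖ := (hL d _).trans
      (mul_le_mul_of_nonneg_right (by linarith [le_abs_self L]) (norm_nonneg _))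
    calc _ ≤ (|L| + 1) * ‖T d h‖ := h2
      _ ≤ (|L| + 1) * ((|K| + 1) * ‖h‖) := by gcongr
      _ = _ := by rw [hM]; ring
  refine ⟨√M, fun A v => PreHilbertModule.bound_of_pow (V := bcPre f H) (W := bcPre f G)
    (bcMap f T A) (bcMap f S A) (fun v w => bcMap_adj f hTS v w) hM0 (fun v => ?_) v⟩
  set Q : Module.End ℂ ((bcPre f H).obj A) := bcMap f S A ∘ₗ bcMap f T A with hQ
  have hQs : ∀ (n : ℕ) (d : D) (h : H.obj d) (g : Hom A (f.obj d)), ∃ h' : H.obj d,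
      ‖h'‖ ≤ ‖h‖ * M ^ n ∧
      (Q ^ n) (DFinsupp.single ⟨d, h⟩ g : BCFib f H A) = (DFinsupp.single ⟨d, h'⟩ g : BCFib f H A) := by
    intro n d h g
    induction n with
    | zero => exact ⟨h, by simp, rfl⟩
    | succ n ih =>
      obtain ⟨h', hb, he⟩ := ih
      refine ⟨S d (T d h'), ?_, ?_⟩
      · refine (hST h').trans ?_
        rw [pow_succ]
        nlinarith
      · have e1 : (Q ^ (n + 1)) (DFinsupp.single ⟨d, h⟩ g : BCFib f H A) =
            Q ((Q ^ n) (DFinsupp.single ⟨d, h⟩ g : BCFib f H A)) := by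
          rw [pow_succ']; rfl
        refine e1.trans ((congrArg Q he).trans ?_)
        exact (congrArg (bcMap f S A) (bcMap_single f T A ⟨d, h'⟩ g)).trans
          (bcMap_single f S A ⟨d, T d h'⟩ g)
  induction v using bcPre_induction with
  | h0 => exact ⟨0, fun n => by rw [map_zero, map_zero, norm_zero, zero_mul]⟩
  | ha v w hv hw =>
    obtain ⟨a, ha⟩ := hv
    obtain ⟨b, hb⟩ := hw
    refine ⟨a + b, fun n => ?_⟩
    rw [map_add, map_add, add_mul]
    exact (norm_add_le _ _).trans (add_le_add (ha n) (hb n))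
  | hs d h g =>
    refine ⟨‖h‖ * ‖g‖, fun n => ?_⟩
    obtain ⟨h', hb, he⟩ := hQs n d h g
    refine (congrArg (fun z => ‖(bcPre f H).toC z‖) he).le.trans ?_
    refine (norm_tens_le f H h' g).trans ?_
    calc _ ≤ (‖h‖ * M ^ n) * ‖g‖ := by gcongr
      _ = _ := by ring

/-- The operator of base changes induced by an operator. -/
def bcOp (T : ∀ d, H.obj d →ₗ[ℂ] G.obj d) (B : C) :
    (bcModule f H).obj B →ₗ[ℂ] (bcModule f G).obj B := PreHilbertModule.extOp (bcMap f T) B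

theorem bcOp_bounded {T : ∀ d, H.obj d →ₗ[ℂ] G.obj d} {S : ∀ d, G.obj d →ₗ[ℂ] H.obj d}
    (hTS : IsAdjoint T S) (hT : IsBoundedMap T) (hS : IsBoundedMap S) :
    IsBoundedMap (bcOp f T) :=
  PreHilbertModule.isBoundedMap_extOp (bcMap_bounded f hTS hT hS) (bcMap_act f T)

theorem bcOp_adj {T : ∀ d, H.obj d →ₗ[ℂ] G.obj d} {S : ∀ d, G.obj d →ₗ[ℂ] H.obj d}
    (hTS : IsAdjoint T S) (hT : IsBoundedMap T) (hS : IsBoundedMap S) :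
    IsAdjoint (bcOp f T) (bcOp f S) :=
  PreHilbertModule.isAdjoint_extOp (bcMap_bounded f hTS hT hS)
    (bcMap_bounded f hTS.symm hS hT) (bcMap_adj f hTS)

theorem bcOp_tens {T : ∀ d, H.obj d →ₗ[ℂ] G.obj d} {S : ∀ d, G.obj d →ₗ[ℂ] H.obj d}
    (hTS : IsAdjoint T S) (hT : IsBoundedMap T) (hS : IsBoundedMap S) {d : D} (h : H.obj d)
    {B : C} (g : Hom B (f.obj d)) : bcOp f T B (tens f H h g) = tens f G (T d h) g :=
  (PreHilbertModule.extOp_toC (bcMap_bounded f hTS hT hS) _).trans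
    (congrArg (bcPre f G).toC (bcMap_single f T B ⟨d, h⟩ g))

end BaseChange

section Functor
variable {D C : Type u} [CStarCat D] [CStarCat C] [UnitalStarCat C] (f : StarFunctor D C)

/-- The base change of a small Hilbert module. -/
def bcObj (H : SmallHilb.{v} D) : SmallHilb.{v} C where
  toHilbertModule := bcModule f H.toHilbertModule
  small := by
    obtain ⟨X, s, e, he⟩ := H.small
    refine ⟨X, fun x => f.obj (s x),
      fun x => tens f H.toHilbertModule (e x) (UnitalStarCat.one _), fun B z => ?_⟩
    set N := Submodule.span ℂ {b | ∃ (x : X) (k : Hom B (f.obj (s x))), b =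
      (bcModule f H.toHilbertModule).act
        (tens f H.toHilbertModule (e x) (UnitalStarCat.one _)) k} with hN
    rw [← Submodule.topologicalClosure_coe, SetLike.mem_coe]
    induction z using bc_induct with
    | hc => exact N.isClosed_topologicalClosure
    | h0 => exact Submodule.zero_mem _
    | ha x y hx hy => exact Submodule.add_mem _ hx hy
    | hm c x hx => exact Submodule.smul_mem _ c hx
    | @ht d h g =>
      have hcont : Continuous fun h : H.obj d => tens f H.toHilbertModule h g :=
        (LinearMap.mkContinuous (⟨⟨fun h => tens f H.toHilbertModule h g,
          fun h h' => tens_add f _ h h' g⟩, fun c h => tens_smul f _ c h g⟩ :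
            H.obj d →ₗ[ℂ] (bcModule f H.toHilbertModule).obj B) ‖g‖ fun h => by
          rw [mul_comm]; exact norm_tens_le f _ h g).continuous
      have cl : IsClosed {h : H.obj d | tens f H.toHilbertModule h g ∈ N.topologicalClosure} :=
        N.isClosed_topologicalClosure.preimage hcont
      refine closure_minimal (fun y hy => ?_) cl (he d h)
      refine Submodule.span_induction ?_ ?_ (fun x y _ _ hx hy => ?_) (fun c x _ hx => ?_) hy
      · rintro _ ⟨x, k, rfl⟩
        refine N.le_topologicalClosure (Submodule.subset_span ⟨x, f.map k ⊚ g, ?_⟩)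
        rw [tens_act, UnitalStarCat.one_comp, tens_act_left]
      · have : tens f H.toHilbertModule (0 : H.obj d) g = 0 := by
          simpa using tens_smul f H.toHilbertModule 0 (0 : H.obj d) g
        exact Set.mem_ofPred_eq ▸ this ▸ Submodule.zero_mem _
      · exact Set.mem_ofPred_eq ▸ (tens_add f H.toHilbertModule x y g) ▸ Submodule.add_mem _ hx hy
      · exact Set.mem_ofPred_eq ▸ (tens_smul f H.toHilbertModule c x g) ▸ Submodule.smul_mem _ c hx

/-- The element `h ⊗ g` of the base change. -/
def ten (H : SmallHilb.{v} D) {d : D} (h : H.obj d) {B : C} (g : Hom B (f.obj d)) :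
    (bcObj f H).obj B := tens f H.toHilbertModule h g

theorem inner_ten (H : SmallHilb.{v} D) {d d' : D} (h : H.obj d) (h' : H.obj d') {A B : C}
    (g : Hom B (f.obj d)) (g' : Hom A (f.obj d')) :
    (bcObj f H).inner (ten f H h g) (ten f H h' g') = g† ⊚ f.map (H.inner h h') ⊚ g' :=
  inner_tens f _ h h' g g'

theorem ten_act (H : SmallHilb.{v} D) {d : D} (h : H.obj d) {A B : C} (g : Hom B (f.obj d))
    (k : Hom A B) : (bcObj f H).act (ten f H h g) k = ten f H h (g ⊚ k) := tens_act f _ h g k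

theorem ten_add (H : SmallHilb.{v} D) {d : D} (h h' : H.obj d) {B : C} (g : Hom B (f.obj d)) :
    ten f H (h + h') g = ten f H h g + ten f H h' g := tens_add f _ h h' g

theorem ten_smul (H : SmallHilb.{v} D) {d : D} (c : ℂ) (h : H.obj d) {B : C}
    (g : Hom B (f.obj d)) : ten f H (c • h) g = c • ten f H h g := tens_smul f _ c h g

theorem ten_act_left (H : SmallHilb.{v} D) {d e : D} (h : H.obj d) (k : Hom e d) {B : C}
    (g : Hom B (f.obj e)) : ten f H (H.act h k) g = ten f H h (f.map k ⊚ g) :=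
  tens_act_left f _ h k g

theorem ten_induct (H : SmallHilb.{v} D) {B : C} {p : (bcObj f H).obj B → Prop}
    (x : (bcObj f H).obj B) (hc : IsClosed {x | p x}) (h0 : p 0)
    (ht : ∀ {d : D} (h : H.obj d) (g : Hom B (f.obj d)), p (ten f H h g))
    (ha : ∀ x y, p x → p y → p (x + y)) (hm : ∀ (c : ℂ) x, p x → p (c • x)) : p x :=
  bc_induct f _ x hc h0 ht ha hm

theorem bcObj_hom_ext {H : SmallHilb.{v} D} {K : SmallHilb.{v} C} {S T : Hom (bcObj f H) K}
    (e : ∀ {d : D} (h : H.obj d) {B : C} (g : Hom B (f.obj d)),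
      SmallHilb.app S (ten f H h g) = SmallHilb.app T (ten f H h g)) : S = T := by
  refine SmallHilb.hom_ext fun {A} a => ?_
  induction a using ten_induct with
  | hc => exact isClosed_eq (SmallHilb.continuous_app S A) (SmallHilb.continuous_app T A)
  | h0 => exact (map_zero (S.1 A)).trans (map_zero (T.1 A)).symm
  | ht h g => exact e h g
  | ha x y hx hy => rw [SmallHilb.app_add, SmallHilb.app_add, hx, hy]
  | hm c x hx => rw [SmallHilb.app_smul, SmallHilb.app_smul, hx]

def bcHom {H G : SmallHilb.{v} D} (T : Hom H G) : Hom (bcObj f H) (bcObj f G) :=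
  Op.mk' (bcOp f T.1) (bcOp f (T†).1)
    (bcOp_bounded f (fun h x => SmallHilb.inner_dag_app T h x) T.2.1 (T†).2.1)
    (bcOp_bounded f (IsAdjoint.symm fun h x => SmallHilb.inner_dag_app T h x) (T†).2.1 T.2.1)
    (bcOp_adj f (fun h x => SmallHilb.inner_dag_app T h x) T.2.1 (T†).2.1)

theorem bcHom_ten {H G : SmallHilb.{v} D} (T : Hom H G) {d : D} (h : H.obj d) {B : C}
    (g : Hom B (f.obj d)) : SmallHilb.app (bcHom f T) (ten f H h g) =
      ten f G (SmallHilb.app T h) g :=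
  bcOp_tens f (fun h x => SmallHilb.inner_dag_app T h x) T.2.1 (T†).2.1 h g

/-- The functor `𝓗 f : 𝓗 D → 𝓗 C` induced by a `*`-functor `f : D → C`. -/
def baseChange : StarFunctor (SmallHilb.{v} D) (SmallHilb.{v} C) where
  obj := bcObj f
  map := bcHom f
  map_add S T := bcObj_hom_ext f fun h B g => by
    rw [bcHom_ten]
    refine (ten_add f _ (SmallHilb.app S h) (SmallHilb.app T h) g).trans ?_
    rw [← bcHom_ten, ← bcHom_ten]; rfl
  map_smul c S := bcObj_hom_ext f fun h B g => by
    rw [bcHom_ten]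
    refine (ten_smul f _ c (SmallHilb.app S h) g).trans ?_
    rw [← bcHom_ten]; rfl
  map_comp S T := bcObj_hom_ext f fun h B g => by
    rw [bcHom_ten, SmallHilb.comp_app, SmallHilb.comp_app, bcHom_ten, bcHom_ten]
  map_dag {H G} T := by
    refine bcObj_hom_ext f fun {d} h B g => ?_
    rw [bcHom_ten]
    refine (bcObj f H).ext_inner _ _ fun {A} b => ?_
    rw [SmallHilb.inner_dag_app]
    induction b using ten_induct with
    | hc => exact isClosed_eq ((bcObj f H).continuous_inner.comp (continuous_id.prodMk
              continuous_const)) ((bcObj f G).continuous_inner.comp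
              ((SmallHilb.continuous_app _ _).prodMk continuous_const))
    | h0 => exact ((bcObj f H).zero_inner _).trans (((congrArg (fun z => (bcObj f G).inner z _)
              (map_zero ((bcHom f T).1 _)))).trans ((bcObj f G).zero_inner _)).symm
    | ht h g => rw [bcHom_ten, inner_ten, inner_ten, SmallHilb.inner_dag_app]
    | ha x y hx hy => rw [SmallHilb.app_add, (bcObj f G).add_inner, (bcObj f H).add_inner, hx, hy]
    | hm c x hx => rw [SmallHilb.app_smul, (bcObj f G).smul_inner, (bcObj f H).smul_inner, hx]

/-- The element `h ⊗ 1` of `(𝓗 f) H` defined by `h ∈ H(d)`. -/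
def incl₁ (H : SmallHilb.{v} D) {d : D} (h : H.obj d) : ((baseChange f).obj H).obj (f.obj d) :=
  ten f H h (UnitalStarCat.one _)

theorem inner_incl₁ (H : SmallHilb.{v} D) {d d' : D} (h : H.obj d) (h' : H.obj d') :
    ((baseChange f).obj H).inner (incl₁ f H h) (incl₁ f H h') = f.map (H.inner h h') := by
  refine (inner_ten f H h h' _ _).trans ?_
  rw [dag_one, UnitalStarCat.one_comp, UnitalStarCat.comp_one]

theorem incl₁_add (H : SmallHilb.{v} D) {d : D} (h h' : H.obj d) :
    incl₁ f H (h + h') = incl₁ f H h + incl₁ f H h' := ten_add f H h h' _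
theorem incl₁_smul (H : SmallHilb.{v} D) {d : D} (c : ℂ) (h : H.obj d) :
    incl₁ f H (c • h) = c • incl₁ f H h := ten_smul f H c h _
theorem incl₁_act (H : SmallHilb.{v} D) {d e : D} (h : H.obj d) (k : Hom e d) :
    incl₁ f H (H.act h k) = ((baseChange f).obj H).act (incl₁ f H h) (f.map k) :=
  (ten_act_left f H h k _).trans (((congrArg (ten f H h) ((UnitalStarCat.comp_one _).trans
    (UnitalStarCat.one_comp _).symm))).trans (ten_act f H h _ (f.map k)).symm)
theorem ten_eq_act (H : SmallHilb.{v} D) {d : D} (h : H.obj d) {B : C} (g : Hom B (f.obj d)) :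
    ten f H h g = ((baseChange f).obj H).act (incl₁ f H h) g :=
  ((congrArg (ten f H h) (UnitalStarCat.one_comp _).symm)).trans (ten_act f H h _ g).symm
theorem baseChange_incl₁ {H G : SmallHilb.{v} D} (T : Hom H G) {d : D} (h : H.obj d) :
    SmallHilb.app ((baseChange f).map T) (incl₁ f H h) = incl₁ f G (SmallHilb.app T h) :=
  bcHom_ten f T h _

end Functor
end

end HilbCat

namespace HilbCat

noncomputable section
open StarCat

/-- The sets of morphisms are `v`-small. -/
class LocSmall (C : Type u) [StarCat.{u} C] : Prop where
  small : ∀ X Y : C, Small.{v} (Hom X Y)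

section Hered
variable {C : Type u} [CStarCat C]

theorem core_restrict {X Y : C} (N : Submodule ℂ (Hom X Y)) : NormedSpace.Core ℂ N where
  norm_nonneg := norm_nonneg
  norm_smul := norm_smul
  norm_triangle := norm_add_le
  norm_eq_zero_iff _ := norm_eq_zero

theorem complete_restrict {X Y : C} (N : Submodule ℂ (Hom X Y)) (h : IsClosed (N : Set (Hom X Y))) :
    @CompleteSpace N (NormedAddCommGroup.ofCore (core_restrict N)).toUniformSpace := by
  have : CompleteSpace N := h.completeSpace_coe
  exact complete_of_core (E := N) inferInstance _

theorem comp_mem_of_closure {X Y Z : C} {S : Set (Hom X Z)} (hS : IsClosed S) {h : Hom X Y}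
    {k : Hom Y Z} (P : ∀ ε : ℝ, 0 < ε → ∃ h' : Hom X Y, ‖h - h'‖ < ε ∧ k ⊚ h' ∈ S) : k ⊚ h ∈ S := by
  have h1 : h ∈ closure {h' : Hom X Y | k ⊚ h' ∈ S} := by
    rw [Metric.mem_closure_iff]
    intro ε hε
    obtain ⟨h', h1, h2⟩ := P ε hε
    exact ⟨h', h2, by rwa [dist_eq_norm]⟩
  have h2 : IsClosed {h' : Hom X Y | k ⊚ h' ∈ S} :=
    hS.preimage (continuous_comp.comp (continuous_const.prodMk continuous_id))
  rwa [h2.closure_eq] at h1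

theorem comp_mem_of_closure' {X Y Z : C} {S : Set (Hom X Z)} (hS : IsClosed S) {h : Hom X Y}
    {k : Hom Y Z} (P : ∀ ε : ℝ, 0 < ε → ∃ k' : Hom Y Z, ‖k - k'‖ < ε ∧ k' ⊚ h ∈ S) :
    k ⊚ h ∈ S := by
  have h1 : k ∈ closure {k' : Hom Y Z | k' ⊚ h ∈ S} := by
    rw [Metric.mem_closure_iff]
    intro ε hε
    obtain ⟨h', h1, h2⟩ := P ε hε
    exact ⟨h', h2, by rwa [dist_eq_norm]⟩
  have h2 : IsClosed {k' : Hom Y Z | k' ⊚ h ∈ S} :=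
    hS.preimage (continuous_comp.comp (continuous_id.prodMk continuous_const))
  rwa [h2.closure_eq] at h1

/-- `h` is approximated by `h ⊚ w` with `w` in the algebra generated by `h† ⊚ h`. -/
theorem approx_right {X Y : C} (h : Hom X Y) {ε : ℝ} (hε : 0 < ε) :
    ∃ w ∈ NonUnitalStarAlgebra.elemental ℂ (h† ⊚ h), w† = w ∧ ‖h - h ⊚ w‖ < ε := by
  obtain ⟨r, w, -, hw, -, hws, -, -, hn, -⟩ :=
    exists_approx (h† ⊚ h) (dag_comp_self_nonneg h) (δ := ε ^ 2) (by positivity)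
  have hws' : w† = w := hws
  refine ⟨w, hw, hws, ?_⟩
  have e : (h - h ⊚ w)† ⊚ (h - h ⊚ w) =
      h† ⊚ h - (h† ⊚ h) * w - w * (h† ⊚ h) + w * (h† ⊚ h) * w := by
    simp only [dag_sub, dag_comp, sub_comp, comp_sub, hws', mul_def, comp_assoc]
    abel
  have : ‖h - h ⊚ w‖ ^ 2 < ε ^ 2 := by rwa [HilbCat.norm_sq, e]
  exact lt_of_pow_lt_pow_left₀ 2 hε.le this

/-- `h` is approximated by `h ⊚ h† ⊚ r ⊚ h`. -/
theorem approx_left {X Y : C} (h : Hom X Y) {ε : ℝ} (hε : 0 < ε) :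
    ∃ r : Hom Y Y, ‖h - h ⊚ h† ⊚ r ⊚ h‖ < ε := by
  obtain ⟨r, w, -, hw, -, hws, -, hwp, hn, -⟩ :=
    exists_approx ((h†)† ⊚ h†) (dag_comp_self_nonneg h†) (δ := ε ^ 2) (by positivity)
  have hws' : w† = w := hws
  rw [dag_dag] at hwp hn
  refine ⟨r, ?_⟩
  have e0 : h ⊚ h† ⊚ r ⊚ h = w ⊚ h := by rw [hwp, mul_def]; simp only [comp_assoc]
  rw [e0]
  have e : ((h - w ⊚ h)†)† ⊚ (h - w ⊚ h)† =
      h ⊚ h† - (h ⊚ h†) * w - w * (h ⊚ h†) + w * (h ⊚ h†) * w := by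
    simp only [dag_sub, dag_comp, sub_comp, comp_sub, hws', mul_def, comp_assoc, dag_dag]
    abel
  have : ‖h - w ⊚ h‖ ^ 2 < ε ^ 2 := by rwa [← norm_dag, HilbCat.norm_sq, e]
  exact lt_of_pow_lt_pow_left₀ 2 hε.le this

/-- `h` is approximated by `w ⊚ h` with `w` in the algebra generated by `h ⊚ h†`. -/
theorem approx_left' {X Y : C} (h : Hom X Y) {ε : ℝ} (hε : 0 < ε) :
    ∃ w ∈ NonUnitalStarAlgebra.elemental ℂ (h ⊚ h†), w† = w ∧ ‖h - w ⊚ h‖ < ε := by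
  obtain ⟨w, hw, hs, hn⟩ := approx_right h† hε
  rw [dag_dag] at hw
  refine ⟨w, hw, hs, ?_⟩
  have : h - w ⊚ h = (h† - h† ⊚ w)† := by rw [dag_sub, dag_comp, dag_dag, hs]
  rwa [this, norm_dag]

/-- A partial hereditary subcategory of `C`: a sub-`C*`-category `𝔄`, with some of the objects of
`C`, such that `𝔄 ⊚ C ⊚ 𝔄 ⊆ 𝔄`. -/
structure HeredSubcat (C : Type u) [CStarCat C] where
  objs : Set C
  hom : ∀ X Y : objs, Submodule ℂ (Hom (X : C) (Y : C))
  closed : ∀ X Y : objs, IsClosed (hom X Y : Set (Hom (X : C) (Y : C)))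
  dag_mem : ∀ {X Y : objs} {f : Hom (X : C) (Y : C)}, f ∈ hom X Y → f† ∈ hom Y X
  comp_mem : ∀ {X Y Z : objs} {g : Hom (Y : C) (Z : C)} {f : Hom (X : C) (Y : C)},
    g ∈ hom Y Z → f ∈ hom X Y → g ⊚ f ∈ hom X Z
  hered : ∀ {W X Y Z : objs} {h : Hom (Y : C) (Z : C)} (g : Hom (X : C) (Y : C))
    {f : Hom (W : C) (X : C)}, h ∈ hom Y Z → f ∈ hom W X → h ⊚ g ⊚ f ∈ hom W Z

namespace HeredSubcat

/-- A hereditary subcategory is a partial hereditary subcategory with all objects of `C`. -/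
def IsTotal (𝔄 : HeredSubcat C) : Prop := 𝔄.objs = Set.univ

/-- The full subcategory `C(X)` on one object. -/
def fullOn (X : C) : HeredSubcat C where
  objs := {X}
  hom _ _ := ⊤
  closed _ _ := isClosed_univ
  dag_mem _ := Submodule.mem_top
  comp_mem _ _ := Submodule.mem_top
  hered _ _ _ _ := Submodule.mem_top

variable (𝔄 : HeredSubcat C)

/-- The objects of `𝔄`, as a `C*`-category with the morphisms of `𝔄`. -/
def Cat : Type u := 𝔄.objs

def alg (X : 𝔄.objs) : NonUnitalStarSubalgebra ℂ (Hom (X : C) (X : C)) where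
  carrier := 𝔄.hom X X
  add_mem' := (𝔄.hom X X).add_mem
  zero_mem' := (𝔄.hom X X).zero_mem
  mul_mem' := 𝔄.comp_mem
  smul_mem' c _ := (𝔄.hom X X).smul_mem c
  star_mem' := 𝔄.dag_mem

theorem elemental_le {X : 𝔄.objs} {p : Hom (X : C) (X : C)} (hp : p ∈ 𝔄.hom X X) :
    NonUnitalStarAlgebra.elemental ℂ p ≤ 𝔄.alg X :=
  NonUnitalStarAlgebra.elemental.le_of_mem (𝔄.closed X X) hp

instance : CStarCat 𝔄.Cat where
  Hom X Y := 𝔄.hom X Y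
  addCommGroup X Y := inferInstanceAs (AddCommGroup (𝔄.hom X Y))
  module X Y := inferInstanceAs (Module ℂ (𝔄.hom X Y))
  comp g f := ⟨g.1 ⊚ f.1, 𝔄.comp_mem g.2 f.2⟩
  dag f := ⟨f.1†, 𝔄.dag_mem f.2⟩
  comp_assoc h g f := Subtype.ext (comp_assoc h.1 g.1 f.1)
  add_comp g g' f := Subtype.ext (add_comp g.1 g'.1 f.1)
  comp_add g f f' := Subtype.ext (comp_add g.1 f.1 f'.1)
  smul_comp c g f := Subtype.ext (smul_comp c g.1 f.1)
  comp_smul c g f := Subtype.ext (comp_smul c g.1 f.1)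
  dag_dag f := Subtype.ext (dag_dag f.1)
  dag_comp g f := Subtype.ext (dag_comp g.1 f.1)
  dag_add f g := Subtype.ext (dag_add f.1 g.1)
  dag_smul c f := Subtype.ext (dag_smul c f.1)
  norm X Y := ⟨fun f => ‖f.1‖⟩
  core X Y := core_restrict (𝔄.hom X Y)
  complete X Y := complete_restrict (𝔄.hom X Y) (𝔄.closed X Y)
  norm_comp_le g f := norm_comp_le g.1 f.1
  norm_dag f := HilbCat.norm_dag f.1
  norm_sq f := HilbCat.norm_sq f.1
  pos {X Y} f := by
    obtain ⟨k, hk, hs, hkk⟩ := exists_sqrt_mem (f.1† ⊚ f.1) (dag_comp_self_nonneg f.1)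
    refine ⟨⟨k, 𝔄.elemental_le (𝔄.comp_mem (𝔄.dag_mem f.2) f.2) hk⟩, Subtype.ext ?_⟩
    rw [star_def] at hs
    exact hkk.symm.trans (congrArg (fun z => z ⊚ k) hs.symm)

/-- The inclusion functor `𝔄 → C`. -/
def incl : StarFunctor 𝔄.Cat C where
  obj X := X.1
  map f := f.1
  map_add _ _ := rfl
  map_smul _ _ := rfl
  map_comp _ _ := rfl
  map_dag _ := rfl

theorem dag_comp_mem {a b : 𝔄.objs} {X : C} {f : Hom (a : C) X} {g : Hom (b : C) X}
    (hf : f† ⊚ f ∈ 𝔄.hom a a) (hg : g† ⊚ g ∈ 𝔄.hom b b) (k : Hom X X) :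
    f† ⊚ k ⊚ g ∈ 𝔄.hom b a := by
  rw [← comp_assoc]
  refine comp_mem_of_closure (𝔄.closed b a) fun ε hε => ?_
  obtain ⟨w, hw, -, hn⟩ := approx_right g hε
  refine ⟨g ⊚ w, hn, ?_⟩
  rw [comp_assoc]
  refine comp_mem_of_closure' (𝔄.closed b a) fun δ hδ => ?_
  obtain ⟨z, hz, hzs, hn'⟩ := approx_right f hδ
  refine ⟨z ⊚ f†, ?_, ?_⟩
  · rw [← hzs, ← dag_comp, ← dag_sub, norm_dag]; exact hn'
  · have := 𝔄.hered (f† ⊚ k ⊚ g) (𝔄.elemental_le hf hz) (𝔄.elemental_le hg hw)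
    simpa only [comp_assoc, SetLike.mem_coe] using this

/-- `{f : a ⟶ X | f† ⊚ f ∈ 𝔄}`. -/
def resSub (X : C) (a : 𝔄.objs) : Submodule ℂ (Hom (a : C) X) where
  carrier := {f | f† ⊚ f ∈ 𝔄.hom a a}
  zero_mem' := by simp
  add_mem' {f g} hf hg := by
    have h : ∀ {f g : Hom (a : C) X}, f† ⊚ f ∈ 𝔄.hom a a → g† ⊚ g ∈ 𝔄.hom a a →
        f† ⊚ g ∈ 𝔄.hom a a := fun {f g} hf hg => by
      refine comp_mem_of_closure (𝔄.closed a a) fun ε hε => ?_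
      obtain ⟨r, hr⟩ := approx_left g hε
      exact ⟨g ⊚ g† ⊚ r ⊚ g, hr, by
        simpa only [comp_assoc, SetLike.mem_coe] using 𝔄.dag_comp_mem hf hg (g ⊚ g† ⊚ r)⟩
    simp only [Set.mem_ofPred_eq, dag_add, add_comp, comp_add] at hf hg ⊢
    exact Submodule.add_mem _ (Submodule.add_mem _ hf (h hg hf))
      (Submodule.add_mem _ (h hf hg) hg)
  smul_mem' c f hf := by
    simp only [Set.mem_ofPred_eq, dag_smul, smul_comp, comp_smul] at hf ⊢
    exact Submodule.smul_mem _ _ (Submodule.smul_mem _ _ hf)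

theorem mem_resSub {X : C} {a : 𝔄.objs} {f : Hom (a : C) X} :
    f ∈ 𝔄.resSub X a ↔ f† ⊚ f ∈ 𝔄.hom a a := Iff.rfl

theorem isClosed_resSub (X : C) (a : 𝔄.objs) : IsClosed (𝔄.resSub X a : Set (Hom (a : C) X)) :=
  (𝔄.closed a a).preimage (continuous_comp.comp (continuous_dag.prodMk continuous_id))

theorem inner_mem {X : C} {a b : 𝔄.objs} {f : Hom (a : C) X} {g : Hom (b : C) X}
    (hf : f ∈ 𝔄.resSub X a) (hg : g ∈ 𝔄.resSub X b) : f† ⊚ g ∈ 𝔄.hom b a := by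
  refine comp_mem_of_closure (𝔄.closed b a) fun ε hε => ?_
  obtain ⟨r, hr⟩ := approx_left g hε
  exact ⟨g ⊚ g† ⊚ r ⊚ g, hr, by simpa only [comp_assoc, SetLike.mem_coe] using 𝔄.dag_comp_mem hf hg (g ⊚ g† ⊚ r)⟩

theorem act_mem {X : C} {a b : 𝔄.objs} {f : Hom (a : C) X} {k : Hom (b : C) (a : C)}
    (_ : f ∈ 𝔄.resSub X a) (hk : k ∈ 𝔄.hom b a) : f ⊚ k ∈ 𝔄.resSub X b := by
  rw [mem_resSub, dag_comp, comp_assoc, ← comp_assoc f†]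
  exact 𝔄.hered _ (𝔄.dag_mem hk) hk

theorem comp_left_mem {X Y : C} {a : 𝔄.objs} (g : Hom X Y) {f : Hom (a : C) X}
    (hf : f ∈ 𝔄.resSub X a) : g ⊚ f ∈ 𝔄.resSub Y a := by
  rw [mem_resSub, dag_comp, comp_assoc, ← comp_assoc g†]
  exact 𝔄.dag_comp_mem hf hf _

/-- The restriction `R_𝔄 X` of an object of `C`: the Hilbert `𝔄`-module
`a ↦ {f : a ⟶ X | f† ⊚ f ∈ 𝔄}`. -/
def resModule (X : C) : HilbertModule 𝔄.Cat where
  obj a := 𝔄.resSub X a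
  addCommGroup a := inferInstanceAs (AddCommGroup (𝔄.resSub X a))
  module a := inferInstanceAs (Module ℂ (𝔄.resSub X a))
  act f k := ⟨f.1 ⊚ k.1, 𝔄.act_mem f.2 k.2⟩
  inner g f := ⟨g.1† ⊚ f.1, 𝔄.inner_mem g.2 f.2⟩
  add_act a a' f := Subtype.ext (add_comp a.1 a'.1 f.1)
  smul_act c a f := Subtype.ext (smul_comp c a.1 f.1)
  act_add a f f' := Subtype.ext (comp_add a.1 f.1 f'.1)
  act_smul c a f := Subtype.ext (comp_smul c a.1 f.1)
  act_act a f g := Subtype.ext (comp_assoc a.1 f.1 g.1)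
  inner_dag b a := Subtype.ext ((dag_comp _ _).trans (congrArg (a.1† ⊚ ·) (dag_dag b.1)))
  inner_add b a a' := Subtype.ext (comp_add b.1† a.1 a'.1)
  inner_smul c b a := Subtype.ext (comp_smul c b.1† a.1)
  inner_act b a f := Subtype.ext (comp_assoc b.1† a.1 f.1).symm
  inner_pos {a} f := by
    obtain ⟨k, hk, hs, hkk⟩ := exists_sqrt_mem (f.1† ⊚ f.1) (dag_comp_self_nonneg f.1)
    refine ⟨⟨k, 𝔄.elemental_le f.2 hk⟩, Subtype.ext ?_⟩
    rw [star_def] at hs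
    exact hkk.symm.trans (congrArg (fun z => z ⊚ k) hs.symm)
  norm a := ⟨fun f => ‖f.1‖⟩
  norm_sq f := HilbCat.norm_sq f.1
  core a := core_restrict (𝔄.resSub X a)
  complete a := complete_restrict (𝔄.resSub X a) (𝔄.isClosed_resSub X a)

/-- `R_𝔄 X` as an object of `𝓗 𝔄`. -/
def resObj [LocSmall.{v} C] (X : C) : SmallHilb.{v} 𝔄.Cat where
  toHilbertModule := 𝔄.resModule X
  small := by
    have hs : Small.{v} (Hom X X) := LocSmall.small X X
    let V := Σ a : 𝔄.objs, 𝔄.resSub X a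
    let q : V → Hom X X := fun h => h.2.1 ⊚ h.2.1†
    have hS : Small.{v} (Set.range q) := small_subset (Set.subset_univ _)
    let e : Shrink.{v} (Set.range q) → V := fun x => ((equivShrink _).symm x).2.choose
    have he : ∀ h : V, ∃ x, q (e x) = q h := fun h =>
      ⟨equivShrink _ ⟨q h, h, rfl⟩, by
        have := ((equivShrink (Set.range q)).symm (equivShrink _ ⟨q h, h, rfl⟩)).2.choose_spec
        rw [Equiv.symm_apply_apply] at this
        simpa only [e, Equiv.symm_apply_apply] using this⟩
    refine ⟨Shrink.{v} (Set.range q), fun x => (e x).1, fun x => (e x).2, fun a h => ?_⟩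
    obtain ⟨x, hx⟩ := he ⟨a, h⟩
    rw [Metric.mem_closure_iff]
    intro ε hε
    obtain ⟨r, hr⟩ := approx_left h.1 hε
    refine ⟨(𝔄.resModule X).act (e x).2 ((𝔄.resModule X).inner (e x).2
      ⟨r ⊚ h.1, 𝔄.comp_left_mem r h.2⟩), Submodule.subset_span ⟨x, _, rfl⟩, ?_⟩
    rw [dist_eq_norm]
    have hx' : (e x).2.1 ⊚ (e x).2.1† = h.1 ⊚ h.1† := hx
    have : h.1 ⊚ h.1† ⊚ r ⊚ h.1 = (e x).2.1 ⊚ (e x).2.1† ⊚ r ⊚ h.1 := by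
      rw [← comp_assoc, ← hx', comp_assoc]
    rw [this] at hr
    exact hr

def resMap {X Y : C} (g : Hom X Y) (a : 𝔄.Cat) : 𝔄.resSub X a →ₗ[ℂ] 𝔄.resSub Y a where
  toFun f := ⟨g ⊚ f.1, 𝔄.comp_left_mem g f.2⟩
  map_add' f f' := Subtype.ext (comp_add g f.1 f'.1)
  map_smul' c f := Subtype.ext (comp_smul c g f.1)

theorem resMap_bounded {X Y : C} (g : Hom X Y) :
    IsBoundedMap (H := 𝔄.resModule X) (G := 𝔄.resModule Y) (𝔄.resMap g) :=
  ⟨fun f k => Subtype.ext (comp_assoc g f.1 k.1).symm, ‖g‖, fun _ f => norm_comp_le g f.1⟩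

/-- The restriction functor `R_𝔄 : C → 𝓗 𝔄`. -/
def res [LocSmall.{v} C] : StarFunctor C (SmallHilb.{v} 𝔄.Cat) where
  obj := 𝔄.resObj
  map {X Y} g := Op.mk' (H := 𝔄.resObj X) (G := 𝔄.resObj Y) (𝔄.resMap g) (𝔄.resMap g†)
    (𝔄.resMap_bounded g) (𝔄.resMap_bounded g†) fun h x => Subtype.ext (by
      have e : h.1† ⊚ g† ⊚ x.1 = (g ⊚ h.1)† ⊚ x.1 := by rw [dag_comp, comp_assoc]
      exact e)
  map_add g g' := SmallHilb.hom_ext fun h => Subtype.ext (add_comp g g' h.1)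
  map_smul c g := SmallHilb.hom_ext fun h => Subtype.ext (smul_comp c g h.1)
  map_comp g g' := SmallHilb.hom_ext fun h => Subtype.ext (comp_assoc g g' h.1)
  map_dag {X Y} g := (Op.eq_adj _ _ fun x h => Subtype.ext (by
      have e : h.1† ⊚ g† ⊚ x.1 = (g ⊚ h.1)† ⊚ x.1 := by rw [dag_comp, comp_assoc]
      exact e)).symm

end HeredSubcat

/-- A hereditary subalgebra of the `C*`-algebra `C(X)`: a closed `*`-subalgebra `𝒜` such that
`𝒜 C(X) 𝒜 ⊆ 𝒜`. -/
structure HeredSubalg (X : C) extends NonUnitalStarSubalgebra ℂ (Hom X X) where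
  isClosed : IsClosed carrier
  hered : ∀ {a b : Hom X X} (g : Hom X X), a ∈ carrier → b ∈ carrier → a * g * b ∈ carrier

namespace HeredSubalg
variable {X : C} (𝒜 : HeredSubalg X)

theorem elemental_le {p : Hom X X} (hp : p ∈ 𝒜.carrier) :
    NonUnitalStarAlgebra.elemental ℂ p ≤ 𝒜.toNonUnitalStarSubalgebra :=
  NonUnitalStarAlgebra.elemental.le_of_mem 𝒜.isClosed hp

theorem comp_dag_mem {A B : C} {h : Hom A X} {k : Hom B X} (hh : h ⊚ h† ∈ 𝒜.carrier)
    (hk : k ⊚ k† ∈ 𝒜.carrier) (g : Hom B A) : (h ⊚ g) ⊚ k† ∈ 𝒜.carrier := by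
  refine comp_mem_of_closure 𝒜.isClosed fun ε hε => ?_
  obtain ⟨w, hw, hws, hn⟩ := approx_left' k hε
  refine ⟨k† ⊚ w, ?_, ?_⟩
  · rw [← hws, ← dag_comp, ← dag_sub, norm_dag]; exact hn
  · rw [comp_assoc]
    refine comp_mem_of_closure' 𝒜.isClosed fun δ hδ => ?_
    obtain ⟨z, hz, -, hn'⟩ := approx_left' h hδ
    refine ⟨z ⊚ h, hn', ?_⟩
    have := 𝒜.hered (h ⊚ g ⊚ k†) (𝒜.elemental_le hh hz) (𝒜.elemental_le hk hw)
    simpa only [mul_def, comp_assoc] using this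

/-- `(𝒜 X)(B) = {h : B ⟶ X | h ⊚ h† ∈ 𝒜}`. -/
def subsp (B : C) : Submodule ℂ (Hom B X) where
  carrier := {h | h ⊚ h† ∈ 𝒜.carrier}
  zero_mem' := by
    simpa only [Set.mem_ofPred_eq, zero_comp] using 𝒜.zero_mem'
  add_mem' {h k} hh hk := by
    have m : ∀ {h k : Hom B X}, h ⊚ h† ∈ 𝒜.carrier → k ⊚ k† ∈ 𝒜.carrier →
        h ⊚ k† ∈ 𝒜.carrier := fun {h k} hh hk => by
      refine comp_mem_of_closure' 𝒜.isClosed fun δ hδ => ?_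
      obtain ⟨w, hw, -, hn'⟩ := approx_right h hδ
      exact ⟨h ⊚ w, hn', 𝒜.comp_dag_mem hh hk w⟩
    simp only [Set.mem_ofPred_eq, dag_add, add_comp, comp_add] at hh hk ⊢
    exact 𝒜.add_mem' (𝒜.add_mem' hh (m hk hh)) (𝒜.add_mem' (m hh hk) hk)
  smul_mem' c h hh := by
    simp only [Set.mem_ofPred_eq, dag_smul, smul_comp, comp_smul] at hh ⊢
    exact 𝒜.smul_mem' _ (𝒜.smul_mem' _ hh)

theorem mem_subsp {B : C} {h : Hom B X} : h ∈ 𝒜.subsp B ↔ h ⊚ h† ∈ 𝒜.carrier := Iff.rfl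

theorem isClosed_subsp (B : C) : IsClosed (𝒜.subsp B : Set (Hom B X)) :=
  𝒜.isClosed.preimage (continuous_comp.comp (continuous_id.prodMk continuous_dag))

theorem act_mem {A B : C} {h : Hom A X} (hh : h ∈ 𝒜.subsp A) (g : Hom B A) :
    h ⊚ g ∈ 𝒜.subsp B := by
  have := 𝒜.comp_dag_mem hh hh (g ⊚ g†)
  rw [mem_subsp, dag_comp]
  simpa only [comp_assoc] using this

/-- The submodule `𝒜 X` of the representable module of `X`. -/
def module : HilbertModule C where
  obj B := 𝒜.subsp B
  addCommGroup B := inferInstanceAs (AddCommGroup (𝒜.subsp B))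
  module B := inferInstanceAs (Module ℂ (𝒜.subsp B))
  act h g := ⟨h.1 ⊚ g, 𝒜.act_mem h.2 g⟩
  inner h k := h.1† ⊚ k.1
  add_act a a' f := Subtype.ext (add_comp a.1 a'.1 f)
  smul_act c a f := Subtype.ext (smul_comp c a.1 f)
  act_add a f f' := Subtype.ext (comp_add a.1 f f')
  act_smul c a f := Subtype.ext (comp_smul c a.1 f)
  act_act a f g := Subtype.ext (comp_assoc a.1 f g)
  inner_dag b a := (dag_comp _ _).trans (congrArg (a.1† ⊚ ·) (dag_dag b.1))
  inner_add b a a' := comp_add b.1† a.1 a'.1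
  inner_smul c b a := comp_smul c b.1† a.1
  inner_act b a f := (comp_assoc b.1† a.1 f).symm
  inner_pos h := CStarCat.pos h.1
  norm _ := ⟨fun h => ‖h.1‖⟩
  norm_sq h := HilbCat.norm_sq h.1
  core B := core_restrict (𝒜.subsp B)
  complete B := complete_restrict (𝒜.subsp B) (𝒜.isClosed_subsp B)

theorem mem_self {a : Hom X X} (ha : a ∈ 𝒜.carrier) : a ∈ 𝒜.subsp X :=
  𝒜.mul_mem' ha (𝒜.star_mem' ha)

/-- `𝒜 X` as an object of `𝓗 C`. -/
def small [LocSmall.{v} C] : SmallHilb.{v} C where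
  toHilbertModule := 𝒜.module
  small := by
    have hs : Small.{v} (Hom X X) := LocSmall.small X X
    have hS : Small.{v} 𝒜.carrier := small_subset (Set.subset_univ _)
    refine ⟨Shrink.{v} 𝒜.carrier, fun _ => X, fun x =>
      ⟨((equivShrink _).symm x).1, 𝒜.mem_self ((equivShrink _).symm x).2⟩, fun B h => ?_⟩
    rw [Metric.mem_closure_iff]
    intro ε hε
    obtain ⟨w, hw, -, hn⟩ := approx_left' h.1 hε
    have hw' := 𝒜.elemental_le h.2 hw
    refine ⟨𝒜.module.act (A := X) ⟨w, 𝒜.mem_self hw'⟩ h.1,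
      Submodule.subset_span ⟨equivShrink _ ⟨w, hw'⟩, h.1, ?_⟩, ?_⟩
    · simp only [Equiv.symm_apply_apply]
    · rw [dist_eq_norm]
      exact hn

end HeredSubalg

namespace HeredSubcat
variable (𝔄 : HeredSubcat C) (Y : C)

def idealSpan : Submodule ℂ (Hom Y Y) :=
  Submodule.span ℂ {k | ∃ (a b : 𝔄.objs) (f : Hom Y (a : C)) (c : Hom (a : C) (b : C))
    (g : Hom (b : C) Y), c ∈ 𝔄.hom a b ∧ k = g ⊚ c ⊚ f}

theorem idealSpan_comp {k : Hom Y Y} (hk : k ∈ 𝔄.idealSpan Y) (l : Hom Y Y) :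
    k ⊚ l ∈ 𝔄.idealSpan Y := by
  refine Submodule.span_induction ?_ ?_ (fun x y _ _ hx hy => ?_) (fun c x _ hx => ?_) hk
  · rintro _ ⟨a, b, f, c, g, hc, rfl⟩
    exact Submodule.subset_span ⟨a, b, f ⊚ l, c, g, hc, by simp only [comp_assoc]⟩
  · rw [zero_comp]; exact Submodule.zero_mem _
  · rw [add_comp]; exact Submodule.add_mem _ hx hy
  · rw [smul_comp]; exact Submodule.smul_mem _ _ hx

theorem idealSpan_dag {k : Hom Y Y} (hk : k ∈ 𝔄.idealSpan Y) : k† ∈ 𝔄.idealSpan Y := by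
  refine Submodule.span_induction ?_ ?_ (fun x y _ _ hx hy => ?_) (fun c x _ hx => ?_) hk
  · rintro _ ⟨a, b, f, c, g, hc, rfl⟩
    exact Submodule.subset_span ⟨b, a, g†, c†, f†, 𝔄.dag_mem hc,
      by simp only [dag_comp, comp_assoc]⟩
  · rw [dag_zero]; exact Submodule.zero_mem _
  · rw [dag_add]; exact Submodule.add_mem _ hx hy
  · rw [dag_smul]; exact Submodule.smul_mem _ _ hx

theorem closure_comp {k : Hom Y Y} (hk : k ∈ (𝔄.idealSpan Y).topologicalClosure) (l : Hom Y Y) :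
    k ⊚ l ∈ (𝔄.idealSpan Y).topologicalClosure := by
  have hc : Continuous fun k : Hom Y Y => k ⊚ l :=
    continuous_comp.comp (continuous_id.prodMk continuous_const)
  exact map_mem_closure (f := fun k : Hom Y Y => k ⊚ l) hc hk fun k hk => 𝔄.idealSpan_comp Y hk l

/-- The endomorphisms of `Y` in the closed two-sided ideal of `C` generated by `𝔄`: the closed span
of the `g ⊚ c ⊚ f` with `c` in `𝔄`. -/
def ideal : HeredSubalg Y where
  carrier := (𝔄.idealSpan Y).topologicalClosure
  add_mem' := (𝔄.idealSpan Y).topologicalClosure.add_mem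
  zero_mem' := (𝔄.idealSpan Y).topologicalClosure.zero_mem
  smul_mem' c _ := (𝔄.idealSpan Y).topologicalClosure.smul_mem c
  mul_mem' hk _ := 𝔄.closure_comp Y hk _
  star_mem' hk := map_mem_closure continuous_dag hk fun _ hk => 𝔄.idealSpan_dag Y hk
  isClosed := (𝔄.idealSpan Y).isClosed_topologicalClosure
  hered g ha _ := 𝔄.closure_comp Y (𝔄.closure_comp Y ha g) _

end HeredSubcat

end Hered

end

end HilbCat

namespace HilbCat

noncomputable section
open StarCat

section FullSubcategories

/-- The full subcategory on the objects satisfying `p`. -/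
def FullSub {C : Type u₁} (p : C → Prop) : Type u₁ := {X : C // p X}

namespace FullSub
section
variable {C : Type u₁} [StarCat.{w₁} C] (p : C → Prop)

instance : StarCat.{w₁} (FullSub p) where
  Hom X Y := Hom X.1 Y.1
  addCommGroup X Y := inferInstanceAs (AddCommGroup (Hom X.1 Y.1))
  module X Y := inferInstanceAs (Module ℂ (Hom X.1 Y.1))
  comp g f := comp g f
  dag f := dag f
  comp_assoc h g f := comp_assoc h g f
  add_comp g g' f := add_comp g g' f
  comp_add g f f' := comp_add g f f'
  smul_comp c g f := smul_comp c g f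
  comp_smul c g f := comp_smul c g f
  dag_dag f := dag_dag f
  dag_comp g f := dag_comp g f
  dag_add f g := dag_add f g
  dag_smul c f := dag_smul c f

instance [UnitalStarCat C] : UnitalStarCat (FullSub p) where
  one X := UnitalStarCat.one X.1
  one_comp f := UnitalStarCat.one_comp (C := C) f
  comp_one f := UnitalStarCat.comp_one (C := C) f

/-- The inclusion of a full subcategory. -/
def incl : StarFunctor (FullSub p) C where
  obj X := X.1
  map f := f
  map_add _ _ := rfl
  map_smul _ _ := rfl
  map_comp _ _ := rfl
  map_dag _ := rfl

/-- A `*`-functor with values in a full subcategory. -/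
def lift {D : Type u₂} [StarCat.{w₂} D] (F : StarFunctor D C) (h : ∀ X, p (F.obj X)) :
    StarFunctor D (FullSub p) where
  obj X := ⟨F.obj X, h X⟩
  map f := F.map f
  map_add f g := F.map_add f g
  map_smul c f := F.map_smul c f
  map_comp g f := F.map_comp g f
  map_dag f := F.map_dag f

end

instance {C : Type u} [CStarCat C] (p : C → Prop) : CStarCat (FullSub p) where
  toStarCat := inferInstance
  norm X Y := CStarCat.norm X.1 Y.1
  core X Y := CStarCat.core X.1 Y.1
  complete X Y := CStarCat.complete X.1 Y.1
  norm_comp_le {X Y Z} g f := CStarCat.norm_comp_le (C := C) (X := X.1) (Y := Y.1) (Z := Z.1) g f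
  norm_dag {X Y} f := CStarCat.norm_dag (C := C) (X := X.1) (Y := Y.1) f
  norm_sq {X Y} f := CStarCat.norm_sq (C := C) (X := X.1) (Y := Y.1) f
  pos {X Y} f := CStarCat.pos (C := C) (X := X.1) (Y := Y.1) f

instance {C : Type u} [CStarCat C] [LocSmall.{v} C] (p : C → Prop) :
    LocSmall.{v} (FullSub p) where
  small X Y := LocSmall.small (C := C) X.1 Y.1

end FullSub

/-- The `*`-functor induced by `F` between full subcategories. -/
def StarFunctor.restrict {C : Type u₁} {D : Type u₂} [StarCat.{w₁} C] [StarCat.{w₂} D]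
    (F : StarFunctor C D) (p : C → Prop) (q : D → Prop) (h : ∀ X, p X → q (F.obj X)) :
    StarFunctor (FullSub p) (FullSub q) :=
  FullSub.lift q (F.comp (FullSub.incl p)) fun X => h X.1 X.2

end FullSubcategories

/-- A pre-closure operation on `𝓗 A`: a `*`-functor `P : 𝓗 A → 𝓗 A` with isometric inclusions
`μ : H → P H` which are natural in `H`. -/
structure PreClosure (A : Type u) [CStarCat A] where
  P : StarFunctor (SmallHilb.{v} A) (SmallHilb.{v} A)
  μ : ∀ (H : SmallHilb.{v} A) (a : A), H.obj a →ₗ[ℂ] (P.obj H).obj a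
  μ_act : ∀ (H : SmallHilb.{v} A) {a b : A} (x : H.obj a) (k : Hom b a),
    μ H b (H.act x k) = (P.obj H).act (μ H a x) k
  μ_inner : ∀ (H : SmallHilb.{v} A) {a b : A} (x : H.obj a) (y : H.obj b),
    (P.obj H).inner (μ H a x) (μ H b y) = H.inner x y
  μ_natural : ∀ {H G : SmallHilb.{v} A} (T : Hom H G) {a : A} (x : H.obj a),
    SmallHilb.app (P.map T) (μ H a x) = μ G a (SmallHilb.app T x)

namespace PreClosure
variable {A : Type u} [CStarCat A] (Q : PreClosure.{v} A)

/-- `H` is closed if `μ : H → P H` is an isomorphism. -/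
def IsClosedObj (H : SmallHilb.{v} A) : Prop :=
  ∃ T : Hom H (Q.P.obj H), IsUnitary T ∧
    ∀ (a : A) (x : H.obj a), SmallHilb.app T x = Q.μ H a x

/-- A closure operation is a pre-closure operation `P` such that all `P H` are closed. -/
def IsClosure : Prop := ∀ H, Q.IsClosedObj (Q.P.obj H)

end PreClosure

/-- A pre-complete structure on a unital `C*`-category: a `*`-functor `L : 𝓗 C → C` with an
isometric isomorphism of functors from the identity to `L ∘ 𝕐`. -/
structure PreComplete (C : Type u) [CStarCat C] [UnitalStarCat C] where
  L : StarFunctor (SmallHilb.{v} C) C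
  unit : ∀ A : C, Hom A (L.obj (yonedaObj A))
  isNatUnitary_unit : IsNatUnitary (StarFunctor.id C) (L.comp (yoneda C)) unit

namespace PreComplete
variable {C : Type u} [CStarCat C] [UnitalStarCat C] (P : PreComplete.{v} C)

/-- The canonical embedding of `H` into the representable module of `L H`. -/
def emb {H : SmallHilb.{v} C} {A : C} (a : H.obj A) : Hom A (P.L.obj H) :=
  P.L.map (elemOp a) ⊚ P.unit A

theorem unit_dag_unit (A : C) : (P.unit A)† ⊚ P.unit A = UnitalStarCat.one A :=
  (P.isNatUnitary_unit.1 A).1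

theorem unit_unit_dag (A : C) :
    P.unit A ⊚ (P.unit A)† = UnitalStarCat.one (P.L.obj (yonedaObj A)) :=
  (P.isNatUnitary_unit.1 A).2

theorem unit_natural {A B : C} (f : Hom A B) :
    P.L.map (elemOp (H := yonedaObj B) f : Hom (yonedaObj A) (yonedaObj B)) ⊚ P.unit A =
      P.unit B ⊚ f := P.isNatUnitary_unit.2 f

theorem map_emb {H G : SmallHilb.{v} C} (T : Hom H G) {A : C} (a : H.obj A) :
    P.L.map T ⊚ P.emb a = P.emb (SmallHilb.app T a) := by
  rw [emb, emb, ← comp_assoc, ← P.L.map_comp]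
  congr 2
  exact SmallHilb.hom_ext fun g => SmallHilb.app_act T a g

theorem emb_act {H : SmallHilb.{v} C} {A B : C} (a : H.obj A) (g : Hom B A) :
    P.emb (H.act a g) = P.emb a ⊚ g := by
  rw [emb, emb, comp_assoc, ← unit_natural, ← comp_assoc, ← P.L.map_comp]
  congr 2
  exact SmallHilb.hom_ext fun k => H.act_act a g k

theorem emb_add {H : SmallHilb.{v} C} {A : C} (a b : H.obj A) :
    P.emb (a + b) = P.emb a + P.emb b := by
  rw [emb, emb, emb, ← add_comp, ← P.L.map_add]
  congr 2
  exact SmallHilb.hom_ext fun k => H.add_act a b k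

theorem emb_smul {H : SmallHilb.{v} C} {A : C} (c : ℂ) (a : H.obj A) :
    P.emb (c • a) = c • P.emb a := by
  rw [emb, emb, ← smul_comp, ← P.L.map_smul]
  congr 2
  exact SmallHilb.hom_ext fun k => H.smul_act c a k

theorem emb_dag_emb {H : SmallHilb.{v} C} {A B : C} (b : H.obj B) (a : H.obj A) :
    (P.emb b)† ⊚ P.emb a = H.inner b a := by
  have e : (elemOp b)† ⊚ elemOp a =
      (elemOp (H := yonedaObj B) (H.inner b a) : Hom (yonedaObj A) (yonedaObj B)) := by
    refine SmallHilb.hom_ext fun k => ?_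
    exact (elemOp_dag_app b _).trans (H.inner_act b a k)
  rw [emb, emb, dag_comp, comp_assoc, ← comp_assoc ((P.L.map (elemOp b))†), ← P.L.map_dag,
    ← P.L.map_comp, e, unit_natural, ← comp_assoc, unit_dag_unit, UnitalStarCat.one_comp]

/-- Separation: a morphism out of `L H` which vanishes on `H` is zero. -/
def C1 : Prop :=
  ∀ (H : SmallHilb.{v} C) (A : C) (l : Hom (P.L.obj H) A),
    (∀ (B : C) (a : H.obj B), l ⊚ P.emb a = 0) → l = 0

/-- `f_* = L ∘ 𝓗 f`. -/
def push {D : Type u} [CStarCat D] (f : StarFunctor D C) : StarFunctor (SmallHilb.{v} D) C :=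
  P.L.comp (baseChange f)

/-- The structural morphism `f d ⟶ f_* H` associated with `h ∈ H(d)`. -/
def cone {D : Type u} [CStarCat D] (f : StarFunctor D C) {H : SmallHilb.{v} D} {d : D}
    (h : H.obj d) : Hom (f.obj d) ((P.push f).obj H) := P.emb (incl₁ f H h)

theorem cone_dag_cone {D : Type u} [CStarCat D] (f : StarFunctor D C) {H : SmallHilb.{v} D}
    {d d' : D} (h : H.obj d) (h' : H.obj d') :
    (P.cone f h)† ⊚ P.cone f h' = f.map (H.inner h h') :=
  (P.emb_dag_emb _ _).trans (inner_incl₁ f H h h')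

theorem cone_act {D : Type u} [CStarCat D] (f : StarFunctor D C) {H : SmallHilb.{v} D}
    {d e : D} (h : H.obj d) (k : Hom e d) : P.cone f (H.act h k) = P.cone f h ⊚ f.map k :=
  (congrArg P.emb (incl₁_act f H h k)).trans (P.emb_act _ _)

theorem cone_add {D : Type u} [CStarCat D] (f : StarFunctor D C) {H : SmallHilb.{v} D}
    {d : D} (h h' : H.obj d) : P.cone f (h + h') = P.cone f h + P.cone f h' :=
  (congrArg P.emb (incl₁_add f H h h')).trans (P.emb_add _ _)

theorem cone_smul {D : Type u} [CStarCat D] (f : StarFunctor D C) {H : SmallHilb.{v} D}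
    {d : D} (c : ℂ) (h : H.obj d) : P.cone f (c • h) = c • P.cone f h :=
  (congrArg P.emb (incl₁_smul f H c h)).trans (P.emb_smul _ _)

theorem push_map_cone {D : Type u} [CStarCat D] (f : StarFunctor D C) {H G : SmallHilb.{v} D}
    (T : Hom H G) {d : D} (h : H.obj d) :
    (P.push f).map T ⊚ P.cone f h = P.cone f (SmallHilb.app T h) :=
  (P.map_emb _ _).trans (congrArg P.emb (baseChange_incl₁ f T h))

/-- For a partial hereditary subcategory `𝔄` with inclusion `i`, the pre-closure operation
`R_𝔄 ∘ i_*` on `𝓗 𝔄`, with `x ∈ H(a)` sent to the structural morphism `a ⟶ i_* H`. -/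
def preClosure [LocSmall.{v} C] (𝔄 : HeredSubcat C) : PreClosure.{v} 𝔄.Cat where
  P := 𝔄.res.comp (P.push 𝔄.incl)
  μ H a :=
    { toFun := fun x => ⟨P.cone 𝔄.incl x,
        Eq.mpr (congrArg (· ∈ 𝔄.hom a a) (P.cone_dag_cone 𝔄.incl x x)) (H.inner x x).2⟩
      map_add' := fun x y => Subtype.ext (P.cone_add 𝔄.incl x y)
      map_smul' := fun c x => Subtype.ext (P.cone_smul 𝔄.incl c x) }
  μ_act _ _ _ x k := Subtype.ext (P.cone_act 𝔄.incl x k)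
  μ_inner _ _ _ x y := Subtype.ext (P.cone_dag_cone 𝔄.incl x y)
  μ_natural T _ x := Subtype.ext (P.push_map_cone 𝔄.incl T x)

/-- `𝔄` is generating: there is an isometric isomorphism `μ` of functors from the identity to
`i_* ∘ R_𝔄` such that `μ ⊚ f : a ⟶ i_* R_𝔄 Y` is the structural morphism of `f` for all
`f : a ⟶ Y` with `f† ⊚ f ∈ 𝔄`. -/
def Generating [LocSmall.{v} C] (𝔄 : HeredSubcat C) : Prop :=
  ∃ μ : ∀ Y : C, Hom Y ((P.push 𝔄.incl).obj (𝔄.res.obj Y)),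
    IsNatUnitary (StarFunctor.id C) ((P.push 𝔄.incl).comp 𝔄.res) μ ∧
      ∀ (Y : C) (a : 𝔄.Cat) (f : 𝔄.resSub Y a),
        μ Y ⊚ f.1 = P.cone 𝔄.incl (H := 𝔄.res.obj Y) f

/-- `𝒜 ⊆ C(X)` is weakly dense: `L(𝒜 X)` is isomorphic to `X`, compatibly with the inclusions of
`𝒜 X` in `L(𝒜 X)` and in `X`. -/
def WeaklyDense [LocSmall.{v} C] {X : C} (𝒜 : HeredSubalg X) : Prop :=
  ∃ θ : Hom (P.L.obj 𝒜.small) X, IsUnitary θ ∧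
    ∀ (B : C) (h : 𝒜.subsp B), θ ⊚ P.emb (H := 𝒜.small) h = h.1

/-- A hereditary subalgebra which contains a weakly dense one is weakly dense. -/
def C3 [LocSmall.{v} C] : Prop :=
  ∀ (X : C) (𝒜 ℬ : HeredSubalg X), 𝒜.carrier ⊆ ℬ.carrier → P.WeaklyDense 𝒜 → P.WeaklyDense ℬ

/-- `Y` is weakly contained in `𝔄`: the ideal generated by `𝔄` is weakly dense in `C(Y)`. -/
def WeaklyContained [LocSmall.{v} C] (Y : C) (𝔄 : HeredSubcat C) : Prop :=
  P.WeaklyDense (𝔄.ideal Y)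

/-- `Y ≺ X`: `Y` is quasi-contained in `X`. -/
def QuasiContained [LocSmall.{v} C] (Y X : C) : Prop :=
  P.WeaklyContained Y (HeredSubcat.fullOn X)

/-- A pre-complete full subcategory, given by its class of objects: it is closed under isometric
isomorphism and under the formation of the objects `i_* H`. -/
structure IsPreCompleteFullSub (S : C → Prop) : Prop where
  of_iso : ∀ {X Y : C}, Iso X Y → S Y → S X
  push_mem : ∀ (A : Type u) [CStarCat A] [LocSmall.{v} A] (i : StarFunctor A (FullSub S))
    (H : SmallHilb.{v} A), S ((P.push ((FullSub.incl S).comp i)).obj H)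

/-- The object `𝓗(incl) H` of `𝓗 C` attached to `H` in `𝓗 S` is sent by `L` into `S`. -/
theorem IsPreCompleteFullSub.push_incl_mem [LocSmall.{v} C] {S : C → Prop}
    (hS : P.IsPreCompleteFullSub S) (H : SmallHilb.{v} (FullSub S)) :
    S ((P.push (FullSub.incl S)).obj H) :=
  hS.push_mem (FullSub S) (StarFunctor.id _) H

theorem map_one_of_C1 {P : PreComplete.{v} C} (h1 : P.C1) (H : SmallHilb.{v} C) :
    P.L.map (UnitalStarCat.one H) = UnitalStarCat.one (P.L.obj H) := by
  rw [← sub_eq_zero]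
  refine h1 H _ _ fun B a => ?_
  rw [sub_comp, map_emb, UnitalStarCat.one_comp, SmallHilb.one_app, sub_self]

/-- The pre-complete structure `H ↦ incl_* H` induced on a pre-complete full subcategory. -/
def induced [LocSmall.{v} C] (h1 : P.C1) {S : C → Prop} (hS : P.IsPreCompleteFullSub S) :
    PreComplete.{v} (FullSub S) where
  L := FullSub.lift S (P.push (FullSub.incl S)) (IsPreCompleteFullSub.push_incl_mem P hS)
  unit A := P.cone (FullSub.incl S) (H := yonedaObj A) (UnitalStarCat.one A)
  isNatUnitary_unit := by
    let i := FullSub.incl S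
    refine ⟨fun A => ⟨?_, ?_⟩, fun {A B} f => ?_⟩
    · refine (P.cone_dag_cone i _ _).trans ?_
      exact (congrArg (fun z => z ⊚ UnitalStarCat.one A.1) (dag_one A.1)).trans
        (UnitalStarCat.one_comp _)
    · let G := (baseChange i).obj (yonedaObj A)
      let x : G.obj A.1 := incl₁ i (yonedaObj A) (UnitalStarCat.one A)
      have hxx : G.inner x x = UnitalStarCat.one A.1 :=
        (inner_incl₁ i (yonedaObj A) _ _).trans
          ((congrArg (fun z => z ⊚ UnitalStarCat.one A.1) (dag_one A.1)).trans
            (UnitalStarCat.one_comp _))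
      have hT : elemOp x ⊚ (elemOp x)† = UnitalStarCat.one G := by
        refine bcObj_hom_ext i fun {d} h B g => ?_
        have e : ten i (yonedaObj A) h g = G.act x (h ⊚ g : Hom B A.1) := by
          have h1 : (yonedaObj A : SmallHilb.{v} (FullSub S)).act (UnitalStarCat.one A) h = h :=
            UnitalStarCat.one_comp h
          refine (congrArg (fun z => ten i (yonedaObj A) z g) h1.symm).trans ?_
          refine (ten_eq_act i (yonedaObj A) _ g).trans ?_
          refine (congrArg (fun z => G.act z g) (incl₁_act i (yonedaObj A) _ h)).trans ?_
          exact G.act_act x _ g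
        rw [e]
        have e2 : SmallHilb.app (elemOp x)† (G.act x (h ⊚ g : Hom B A.1)) = (h ⊚ g : Hom B A.1) :=
          (elemOp_dag_app x _).trans ((G.inner_act x x _).trans
            ((congrArg (fun z => z ⊚ (h ⊚ g : Hom B A.1)) hxx).trans (UnitalStarCat.one_comp _)))
        exact congrArg (fun z => SmallHilb.app (elemOp x) z) e2
      have h2 : (P.emb x) ⊚ (P.emb x)† = UnitalStarCat.one (P.L.obj G) := by
        rw [emb, dag_comp, comp_assoc, ← comp_assoc (P.unit A.1), unit_unit_dag,
          UnitalStarCat.one_comp, ← P.L.map_dag, ← P.L.map_comp, hT, map_one_of_C1 h1]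
      exact h2
    · refine (P.push_map_cone i _ _).trans ?_
      refine Eq.trans ?_ (P.cone_act i _ _)
      refine congrArg (P.cone i) ?_
      exact (UnitalStarCat.comp_one (C := C) f).trans (UnitalStarCat.one_comp (C := C) f).symm

end PreComplete

end

end HilbCat

open HilbCat

/-!
For a Hilbert module `K` embedded isometrically in the representable module of `X`, the closed span
of the rank-one operators `e k ⊚ (e l)†` is a hereditary subalgebra `𝒦` of `C(X)` with `𝒦 X = K`
(`ModEmb.subsp_compacts`). Thus weak density of a hereditary subalgebra `𝒜` only concerns the module
`𝒜 X`: it says that some unitary `L K ⟶ X` extends a given embedding of a module `K ≃ 𝒜 X`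
(`weaklyDense_iff`). In particular the compact operators of `H` are always weakly dense in the
endomorphisms of `L H` (`weaklyDense_compacts`).

Let `J` be the ideal of `C(Y)` generated by `𝔄`. The base change of `R_𝔄 Y` to `C` is `J Y`, by
`f ⊗ g ↦ f ⊚ g` (`HeredSubcat.exists_modEmb_resObj`). Hence `Y` is weakly contained in `𝔄` if and
only if there is a unitary `i_* R_𝔄 Y ≃ Y` compatible with the structural morphisms. Conversely, if
`Y = i_* H`, then the compact operators of the base change of `H` lie in `J`, so (C3) makes `J`
weakly dense. Morphisms out of `i_* H` are determined by their composites with the structural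
morphisms (`push_hom_ext`, from (C1)), which gives naturality. The statements about closed modules
and about generating subcategories follow.

The main step is that `j_* H` is weakly contained in `𝔄` when all the `j(d)` are
(`weaklyContained_push_of_forall`): the objects `Y ≺ X` form a pre-complete full subcategory.
Transitivity of `≺` follows, because `Z ≺ Y` means that `Z` is a push-forward from `C(Y)`.

For the structure induced on a pre-complete full subcategory `S`, the property (C1) is inherited and
`L` is `incl_*`, so that its push-forward of `R Y` from `C(X)` is `L` of a base change in two
stages; this iterated base change is again compared with `J Y`.
-/

namespace HilbCat

noncomputable section
open StarCat

/-! ### Embeddings of Hilbert modules into representable modules -/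

section ModEmb
variable {C : Type u} [CStarCat C]

/-- The submodule `𝒜 X` is closed under polarization: `h ⊚ k† ∈ 𝒜` for `h`, `k` in `𝒜 X`. -/
theorem HeredSubalg.inner_dag_mem {X : C} (𝒜 : HeredSubalg X) {B : C} {h k : Hom B X}
    (hh : h ∈ 𝒜.subsp B) (hk : k ∈ 𝒜.subsp B) : h ⊚ k† ∈ 𝒜.carrier := by
  refine comp_mem_of_closure' 𝒜.isClosed fun δ hδ => ?_
  obtain ⟨w, -, -, hn⟩ := approx_right h hδ
  exact ⟨h ⊚ w, hn, 𝒜.comp_dag_mem hh hk w⟩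

/-- An isometric embedding of a Hilbert module `K` into the representable module of `X`. It need not
be adjointable. -/
structure ModEmb (K : HilbertModule C) (X : C) where
  map : ∀ {B : C}, K.obj B →ₗ[ℂ] Hom B X
  map_act : ∀ {A B : C} (k : K.obj A) (f : Hom B A), map (K.act k f) = map k ⊚ f
  dag_map : ∀ {A B : C} (k : K.obj A) (l : K.obj B), (map k)† ⊚ map l = K.inner k l

namespace ModEmb
variable {K : HilbertModule C} {X : C} (e : ModEmb K X)

theorem norm_map {B : C} (k : K.obj B) : ‖e.map k‖ = ‖k‖ := by
  have h : ‖e.map k‖ ^ 2 = ‖k‖ ^ 2 := by rw [HilbCat.norm_sq, e.dag_map, K.norm_sq']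
  exact (pow_left_inj₀ (norm_nonneg _) (norm_nonneg _) two_ne_zero).1 h

theorem isometry_map (B : C) : Isometry (e.map (B := B)) :=
  AddMonoidHomClass.isometry_of_norm e.map e.norm_map

theorem continuous_map (B : C) : Continuous (e.map (B := B)) := (e.isometry_map B).continuous

theorem isClosed_range (B : C) : IsClosed (LinearMap.range (e.map (B := B)) : Set (Hom B X)) := by
  rw [LinearMap.coe_range]
  exact (e.isometry_map B).isClosedEmbedding.isClosed_range

theorem comp_mem_range {A B : C} {h : Hom A X} (hh : h ∈ LinearMap.range (e.map (B := A)))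
    (f : Hom B A) : h ⊚ f ∈ LinearMap.range (e.map (B := B)) := by
  obtain ⟨k, rfl⟩ := hh
  exact ⟨K.act k f, e.map_act k f⟩

/-- The span of the rank-one operators `e k ⊚ (e l)†`. -/
def compactSpan : Submodule ℂ (Hom X X) :=
  Submodule.span ℂ {w | ∃ (B : C) (k l : K.obj B), w = e.map k ⊚ (e.map l)†}

theorem comp_mem_compactSpan {w w' : Hom X X} (hw : w ∈ e.compactSpan) (hw' : w' ∈ e.compactSpan)
    (g : Hom X X) : w ⊚ g ⊚ w' ∈ e.compactSpan := by
  induction hw using Submodule.span_induction with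
  | zero => rw [zero_comp]; exact Submodule.zero_mem _
  | add x y _ _ hx hy => rw [add_comp]; exact Submodule.add_mem _ hx hy
  | smul c x _ hx => rw [smul_comp]; exact Submodule.smul_mem _ c hx
  | mem w hw =>
    obtain ⟨A, k, l, rfl⟩ := hw
    induction hw' using Submodule.span_induction with
    | zero => rw [comp_zero, comp_zero]; exact Submodule.zero_mem _
    | add x y _ _ hx hy => rw [comp_add, comp_add]; exact Submodule.add_mem _ hx hy
    | smul c x _ hx => rw [comp_smul, comp_smul]; exact Submodule.smul_mem _ c hx
    | mem w' hw' =>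
      obtain ⟨B, m, n, rfl⟩ := hw'
      refine Submodule.subset_span ⟨B, K.act k ((e.map l)† ⊚ g ⊚ e.map m), n, ?_⟩
      rw [e.map_act]
      simp only [comp_assoc]

theorem dag_mem_compactSpan {w : Hom X X} (hw : w ∈ e.compactSpan) : w† ∈ e.compactSpan := by
  induction hw using Submodule.span_induction with
  | zero => rw [dag_zero]; exact Submodule.zero_mem _
  | add x y _ _ hx hy => rw [dag_add]; exact Submodule.add_mem _ hx hy
  | smul c x _ hx => rw [dag_smul]; exact Submodule.smul_mem _ _ hx
  | mem w hw =>
    obtain ⟨A, k, l, rfl⟩ := hw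
    exact Submodule.subset_span ⟨A, l, k, by rw [dag_comp, dag_dag]⟩

theorem mul_mem_compactSpan {w w' : Hom X X} (hw : w ∈ e.compactSpan) (hw' : w' ∈ e.compactSpan) :
    w ⊚ w' ∈ e.compactSpan := by
  induction hw using Submodule.span_induction with
  | zero => rw [zero_comp]; exact Submodule.zero_mem _
  | add x y _ _ hx hy => rw [add_comp]; exact Submodule.add_mem _ hx hy
  | smul c x _ hx => rw [smul_comp]; exact Submodule.smul_mem _ c hx
  | mem w hw =>
    obtain ⟨A, k, l, rfl⟩ := hw
    induction hw' using Submodule.span_induction with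
    | zero => rw [comp_zero]; exact Submodule.zero_mem _
    | add x y _ _ hx hy => rw [comp_add]; exact Submodule.add_mem _ hx hy
    | smul c x _ hx => rw [comp_smul]; exact Submodule.smul_mem _ c hx
    | mem w' hw' =>
      obtain ⟨B, m, n, rfl⟩ := hw'
      refine Submodule.subset_span ⟨B, K.act k ((e.map l)† ⊚ e.map m), n, ?_⟩
      rw [e.map_act]
      simp only [comp_assoc]

/-- The image in `C(X)` of the compact operators of `K`: the closed span of the rank-one operators
`e k ⊚ (e l)†`. -/
def compacts : HeredSubalg X where
  carrier := e.compactSpan.topologicalClosure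
  add_mem' := e.compactSpan.topologicalClosure.add_mem
  zero_mem' := e.compactSpan.topologicalClosure.zero_mem
  smul_mem' c _ := e.compactSpan.topologicalClosure.smul_mem c
  mul_mem' hk hl := map_mem_closure₂ continuous_comp hk hl fun _ hk _ hl =>
    e.mul_mem_compactSpan hk hl
  star_mem' hk := map_mem_closure continuous_dag hk fun _ hk => e.dag_mem_compactSpan hk
  isClosed := e.compactSpan.isClosed_topologicalClosure
  hered {a b} g ha hb := by
    have hc : Continuous fun q : Hom X X × Hom X X => q.1 ⊚ g ⊚ q.2 :=
      continuous_comp.comp (continuous_fst.prodMk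
        (continuous_comp.comp (continuous_const.prodMk continuous_snd)))
    have := map_mem_closure₂ (f := fun a b : Hom X X => a ⊚ g ⊚ b) hc ha hb fun _ hk _ hl =>
      e.comp_mem_compactSpan hk hl g
    rw [← comp_assoc] at this
    exact this

theorem compacts_le {𝒜 : HeredSubalg X}
    (h : ∀ {B : C} (k : K.obj B), e.map k ∈ 𝒜.subsp B) : e.compacts.carrier ⊆ 𝒜.carrier := by
  refine closure_minimal (fun w hw => ?_) 𝒜.isClosed
  induction hw using Submodule.span_induction with
  | zero => exact 𝒜.zero_mem'
  | add x y _ _ hx hy => exact 𝒜.add_mem' hx hy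
  | smul c x _ hx => exact 𝒜.smul_mem' c hx
  | mem w hw =>
    obtain ⟨B, k, l, rfl⟩ := hw
    exact 𝒜.inner_dag_mem (h k) (h l)

/-- `𝒦 X = K` for the algebra `𝒦` of compact operators of `K`. -/
theorem subsp_compacts (B : C) : e.compacts.subsp B = LinearMap.range (e.map (B := B)) := by
  apply le_antisymm
  · intro h hh
    have hc := e.isClosed_range B
    -- `h` is a limit of elements `w ⊚ h` with `w` compact
    have h1 : h ∈ closure (LinearMap.range (e.map (B := B)) : Set (Hom B X)) := by
      rw [Metric.mem_closure_iff]
      intro ε hε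
      obtain ⟨w, hw, -, hn⟩ := approx_left' h hε
      refine ⟨w ⊚ h, ?_, by rwa [dist_eq_norm]⟩
      have hw' : w ∈ closure (e.compactSpan : Set (Hom X X)) := e.compacts.elemental_le hh hw
      have hcl : IsClosed {w : Hom X X | w ⊚ h ∈ LinearMap.range (e.map (B := B))} :=
        hc.preimage (continuous_comp.comp (continuous_id.prodMk continuous_const))
      refine closure_minimal (fun w hw => ?_) hcl hw'
      rw [Set.mem_ofPred_eq]
      induction hw using Submodule.span_induction with
      | zero => rw [zero_comp]; exact Submodule.zero_mem _
      | add x y _ _ hx hy => rw [add_comp]; exact Submodule.add_mem _ hx hy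
      | smul c x _ hx => rw [smul_comp]; exact Submodule.smul_mem _ c hx
      | mem w hw =>
        obtain ⟨A, k, l, rfl⟩ := hw
        rw [comp_assoc]
        exact e.comp_mem_range ⟨k, rfl⟩ _
    rwa [hc.closure_eq] at h1
  · rintro _ ⟨k, rfl⟩
    exact subset_closure (Submodule.subset_span ⟨B, k, k, rfl⟩)

end ModEmb
end ModEmb

/-! ### Embeddings of base changes -/

section Lift
variable {D C : Type u} [CStarCat D] [CStarCat C] (f : StarFunctor D C) (H : HilbertModule D)

open scoped Classical in
/-- A family of morphisms `t h : f(d) ⟶ X` with `(t h)† ⊚ t h' = f⟨h, h'⟩` extends to an embedding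
of the base change of `H`. -/
theorem exists_modEmb_bcModule {X : C} (t : ∀ {d : D}, H.obj d → Hom (f.obj d) X)
    (ht : ∀ {d d' : D} (h : H.obj d) (h' : H.obj d'), (t h)† ⊚ t h' = f.map (H.inner h h')) :
    ∃ e : ModEmb (bcModule f H) X, ∀ {d : D} (h : H.obj d) {B : C} (g : Hom B (f.obj d)),
      e.map (tens f H h g) = t h ⊚ g := by
  let p : ∀ B : C, BCFib f H B →ₗ[ℂ] Hom B X := fun B =>
    DFinsupp.lsum ℕ fun i : Σ d : D, H.obj d => compL (X := B) (t i.2)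
  have ps : ∀ {B : C} (i : Σ d : D, H.obj d) (g : Hom B (f.obj i.1)),
      p B (DFinsupp.single i g) = t i.2 ⊚ g := fun i g =>
    DFinsupp.lsum_single (N := Hom _ X) ℕ (fun i : Σ d : D, H.obj d => compL (t i.2)) i g
  have pa : ∀ {B : C} (v w : BCFib f H B), p B (v + w) = p B v + p B w :=
    fun v w => map_add (p _) _ _
  have p0 : ∀ {B : C}, p B 0 = 0 := map_zero (p _)
  have pin : ∀ {A B : C} (v : BCFib f H B) (w : BCFib f H A),
      (p B v)† ⊚ p A w = bcInnerL f H v w := by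
    intro A B v w
    induction v using bc_induction with
    | h0 => rw [bcInner_zero_left, p0, dag_zero, zero_comp]
    | ha v v' hv hv' => rw [bcInner_add_left, pa, dag_add, add_comp, hv, hv']
    | hs i l =>
      induction w using bc_induction with
      | h0 => rw [map_zero, comp_zero, map_zero]
      | ha v v' hv hv' => rw [map_add, comp_add, hv, hv', map_add]
      | hs j g =>
        rw [bcInner_single, ps, ps, dag_comp, comp_assoc, ← comp_assoc (t i.2)†, ht]
  have pact : ∀ {A B : C} (v : BCFib f H A) (k : Hom B A),
      p B (bcAct f H k v) = p A v ⊚ k := by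
    intro A B v k
    induction v using bc_induction with
    | h0 => rw [map_zero, p0, p0, zero_comp]
    | ha v v' hv hv' => rw [map_add, pa, pa, hv, hv', add_comp]
    | hs i g => rw [bcAct_single, ps, ps, comp_assoc]
  have pn : ∀ {B : C} (v : (bcPre f H).obj B),
      ‖(p B : (bcPre f H).obj B →ₗ[ℂ] Hom B X) v‖ ≤ 1 * ‖(bcPre f H).toC v‖ := fun v => by
    rw [one_mul]
    refine le_of_sq_le_sq (le_of_eq ?_) (norm_nonneg _)
    rw [HilbCat.norm_sq, (bcPre f H).norm_toC_sq]
    exact congrArg _ (pin v v)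
  let q : ∀ B : C, (bcModule f H).obj B →L[ℂ] Hom B X := fun B =>
    (p B : (bcPre f H).obj B →ₗ[ℂ] Hom B X).extendOfNorm (bcPre f H).toC
  have hq : ∀ {B : C} (v : (bcPre f H).obj B), q B ((bcPre f H).toC v) = p B v := fun {B} v =>
    LinearMap.extendOfNorm_eq (bcPre f H).denseRange_toC ⟨1, pn⟩ v
  refine ⟨⟨fun {B} => (q B).toLinearMap, fun {A B} a k => ?_, fun {A B} a b => ?_⟩,
    fun h B g => (hq _).trans (ps ⟨_, h⟩ g)⟩
  · change q B ((bcPre f H).completion.act a k) = q A a ⊚ k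
    induction a using PreHilbertModule.c_induction with
    | hp => exact isClosed_eq ((q B).continuous.comp
              ((bcPre f H).completion.continuous_act.comp (continuous_id.prodMk continuous_const)))
              (continuous_comp.comp ((q A).continuous.prodMk continuous_const))
    | h a =>
      rw [← PreHilbertModule.toC_act, hq, hq]
      exact pact a k
  · change (q A a)† ⊚ q B b = (bcPre f H).completion.inner a b
    induction a using PreHilbertModule.c_induction with
    | hp => exact isClosed_eq (continuous_comp.comp
              ((continuous_dag.comp (q A).continuous).prodMk continuous_const))
              ((bcPre f H).completion.continuous_inner.comp (continuous_id.prodMk continuous_const))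
    | h a =>
      induction b using PreHilbertModule.c_induction with
      | hp => exact isClosed_eq (continuous_comp.comp
                (continuous_const.prodMk (q B).continuous))
                ((bcPre f H).completion.continuous_inner.comp
                  (continuous_const.prodMk continuous_id))
      | h b =>
        rw [PreHilbertModule.inner_toC, hq, hq]
        exact pin a b

end Lift

/-! ### Unitary operators and unitary morphisms -/

section Unitary

theorem IsUnitary.dag {C : Type u₁} [StarCat.{w₁} C] [UnitalStarCat C] {X Y : C} {f : Hom X Y}
    (h : IsUnitary f) : IsUnitary f† := by
  refine ⟨?_, ?_⟩ <;> rw [dag_dag]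
  exacts [h.2, h.1]

theorem IsUnitary.comp {C : Type u₁} [StarCat.{w₁} C] [UnitalStarCat C] {X Y Z : C} {g : Hom Y Z}
    {f : Hom X Y} (hg : IsUnitary g) (hf : IsUnitary f) : IsUnitary (g ⊚ f) := by
  refine ⟨?_, ?_⟩
  · rw [dag_comp, comp_assoc, ← comp_assoc g†, hg.1, UnitalStarCat.one_comp, hf.1]
  · rw [dag_comp, comp_assoc, ← comp_assoc f, hf.2, UnitalStarCat.one_comp, hg.2]

theorem isUnitary_one {C : Type u₁} [StarCat.{w₁} C] [UnitalStarCat C] (X : C) :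
    IsUnitary (UnitalStarCat.one X) := by
  refine ⟨?_, ?_⟩ <;> rw [dag_one, UnitalStarCat.one_comp]

theorem IsUnitary.comp_left_cancel {C : Type u₁} [StarCat.{w₁} C] [UnitalStarCat C] {X Y Z : C}
    {g : Hom Y Z} (hg : IsUnitary g) {f f' : Hom X Y} (h : g ⊚ f = g ⊚ f') : f = f' := by
  rw [← UnitalStarCat.one_comp f, ← hg.1, comp_assoc, h, ← comp_assoc, hg.1,
    UnitalStarCat.one_comp]

variable {D : Type u} [CStarCat D]

/-- A surjective isometric map of Hilbert modules is a unitary operator. -/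
theorem exists_unitary_of_surjective {H G : SmallHilb.{v} D} (f : ∀ A, H.obj A →ₗ[ℂ] G.obj A)
    (hact : ∀ {A B : D} (a : H.obj A) (k : Hom B A), f B (H.act a k) = G.act (f A a) k)
    (hinner : ∀ {A B : D} (a : H.obj A) (b : H.obj B), G.inner (f A a) (f B b) = H.inner a b)
    (hsurj : ∀ A, Function.Surjective (f A)) :
    ∃ T : Hom H G, IsUnitary T ∧ ∀ {A : D} (a : H.obj A), SmallHilb.app T a = f A a := by
  have hinj : ∀ A, Function.Injective (f A) := fun A => by
    rw [injective_iff_map_eq_zero]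
    intro a ha
    apply H.eq_zero
    rw [← hinner, ha, G.zero_inner]
  have hnorm : ∀ {A : D} (a : H.obj A), ‖f A a‖ = ‖a‖ := fun a => by
    refine (pow_left_inj₀ (norm_nonneg _) (norm_nonneg _) two_ne_zero).1 ?_
    rw [G.norm_sq', hinner, H.norm_sq']
  let g : ∀ A, G.obj A →ₗ[ℂ] H.obj A := fun A =>
    (LinearEquiv.ofBijective (f A) ⟨hinj A, hsurj A⟩).symm.toLinearMap
  have hfg : ∀ {A : D} (x : G.obj A), f A (g A x) = x := fun {A} x =>
    (LinearEquiv.ofBijective (f A) ⟨hinj A, hsurj A⟩).apply_symm_apply x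
  have hadj : IsAdjoint f g := fun {A B} h x => by rw [← hinner, hfg]
  let T : Hom H G := Op.mk' f g ⟨hact, 1, fun A a => by rw [hnorm, one_mul]⟩
    ⟨fun {A B} x k => hinj B (by rw [hfg, hact, hfg]), 1, fun A x => by
      rw [one_mul, ← hnorm, hfg]⟩ hadj
  refine ⟨T, SmallHilb.isUnitary_of (fun a b => hinner b a) fun {A} x => ?_, fun a => rfl⟩
  have : SmallHilb.app T† x = g A x := H.ext_inner _ _ fun b => by
    rw [SmallHilb.inner_dag_app]
    exact (hadj b x).symm
  rw [this]
  exact hfg x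

/-- An embedding `K → 𝕐 X` whose image is `𝒜 X` is a unitary operator from `K` to `𝒜 X`. -/
theorem ModEmb.exists_unitary {C : Type u} [CStarCat C] [LocSmall.{v} C] {K : SmallHilb.{v} C}
    {X : C} (e : ModEmb K.toHilbertModule X) {𝒜 : HeredSubalg X}
    (he : ∀ B, 𝒜.subsp B = LinearMap.range (e.map (B := B))) :
    ∃ T : Hom K (𝒜.small : SmallHilb.{v} C), IsUnitary T ∧
      ∀ {B : C} (k : K.obj B), (show 𝒜.subsp B from SmallHilb.app T k).1 = e.map k := by
  have hm : ∀ {B : C} (k : K.obj B), e.map k ∈ 𝒜.subsp B := fun k => by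
    rw [he]
    exact ⟨k, rfl⟩
  obtain ⟨T, hT, hTe⟩ := exists_unitary_of_surjective (H := K) (G := (𝒜.small : SmallHilb.{v} C))
    (fun B => (e.map.codRestrict (𝒜.subsp B) hm : K.obj B →ₗ[ℂ] 𝒜.subsp B))
    (fun a k => Subtype.ext (e.map_act a k)) (fun a b => e.dag_map a b)
    (fun B h => by
      have h2 : (h : 𝒜.subsp B).1 ∈ LinearMap.range (e.map (B := B)) := he B ▸ h.2
      obtain ⟨k, hk⟩ := h2
      exact ⟨k, Subtype.ext hk⟩)
  exact ⟨T, hT, fun k => congrArg Subtype.val (hTe k)⟩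

end Unitary

/-! ### Weak density -/

namespace PreComplete
variable {C : Type u} [CStarCat C] [UnitalStarCat C] {P : PreComplete.{v} C}

theorem isUnitary_map (h1 : P.C1) {H G : SmallHilb.{v} C} {T : Hom H G} (hT : IsUnitary T) :
    IsUnitary (P.L.map T) := by
  refine ⟨?_, ?_⟩
  · rw [← P.L.map_dag, ← P.L.map_comp, hT.1, map_one_of_C1 h1]
  · rw [← P.L.map_dag, ← P.L.map_comp, hT.2, map_one_of_C1 h1]

theorem hom_ext (h1 : P.C1) {H : SmallHilb.{v} C} {A : C} {l l' : Hom (P.L.obj H) A}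
    (h : ∀ {B : C} (a : H.obj B), l ⊚ P.emb a = l' ⊚ P.emb a) : l = l' := by
  rw [← sub_eq_zero]
  refine h1 H A _ fun B a => ?_
  rw [sub_comp, h, sub_self]

theorem hom_ext_dag (h1 : P.C1) {H : SmallHilb.{v} C} {A : C} {l l' : Hom A (P.L.obj H)}
    (h : ∀ {B : C} (a : H.obj B), (P.emb a)† ⊚ l = (P.emb a)† ⊚ l') : l = l' := by
  rw [← dag_dag l, ← dag_dag l']
  refine congrArg _ (hom_ext h1 fun a => ?_)
  have := congrArg dag (h a)
  rwa [dag_comp, dag_comp, dag_dag] at this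

variable (P) in
/-- The canonical embedding of `H` into the representable module of `L H`. -/
def modEmb (H : SmallHilb.{v} C) : ModEmb H.toHilbertModule (P.L.obj H) where
  map :=
    { toFun := P.emb
      map_add' := P.emb_add
      map_smul' := P.emb_smul }
  map_act := P.emb_act
  dag_map := P.emb_dag_emb

/-- `𝒜 X` may be replaced by an isomorphic Hilbert module in the definition of weak density. -/
theorem weaklyDense_iff [LocSmall.{v} C] (h1 : P.C1) {K : SmallHilb.{v} C} {X : C}
    (e : ModEmb K.toHilbertModule X) {𝒜 : HeredSubalg X}
    (he : ∀ B, 𝒜.subsp B = LinearMap.range (e.map (B := B))) :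
    P.WeaklyDense 𝒜 ↔ ∃ φ : Hom (P.L.obj K) X, IsUnitary φ ∧
      ∀ {B : C} (k : K.obj B), φ ⊚ P.emb k = e.map k := by
  obtain ⟨T, hT, hTe⟩ := e.exists_unitary he
  constructor
  · rintro ⟨θ, hθ, hθe⟩
    refine ⟨θ ⊚ P.L.map T, hθ.comp (isUnitary_map h1 hT), fun {B} k => ?_⟩
    rw [comp_assoc, map_emb]
    exact (hθe B _).trans (hTe k)
  · rintro ⟨φ, hφ, hφe⟩
    refine ⟨φ ⊚ P.L.map T†, hφ.comp (isUnitary_map h1 hT.dag), fun B h => ?_⟩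
    have h2 : h.1 ∈ LinearMap.range (e.map (B := B)) := he B ▸ h.2
    obtain ⟨k, hk⟩ := h2
    have e1 : (h : (𝒜.small : SmallHilb.{v} C).obj B) = SmallHilb.app T k :=
      Subtype.ext (hk.symm.trans (hTe k).symm)
    rw [e1, comp_assoc, map_emb, ← SmallHilb.comp_app, hT.1, SmallHilb.one_app, hφe]
    exact (hTe k).symm

/-- The compact operators of `H` are weakly dense in the endomorphisms of `L H`. -/
theorem weaklyDense_compacts [LocSmall.{v} C] (h1 : P.C1) (H : SmallHilb.{v} C) :
    P.WeaklyDense (P.modEmb H).compacts :=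
  (weaklyDense_iff h1 (P.modEmb H) (P.modEmb H).subsp_compacts).2
    ⟨UnitalStarCat.one _, isUnitary_one _, fun _ => UnitalStarCat.one_comp _⟩

end PreComplete

/-! ### The ideal generated by a partial hereditary subcategory -/

namespace HeredSubcat
variable {C : Type u} [CStarCat C] (𝔄 : HeredSubcat C)

theorem idealSpan_le_ideal {Y : C} {k : Hom Y Y} (hk : k ∈ 𝔄.idealSpan Y) :
    k ∈ (𝔄.ideal Y).carrier := subset_closure hk

/-- A closed linear condition on the ideal need only be checked on the morphisms `g ⊚ c ⊚ f`. -/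
theorem map_mem_of_mem_ideal {Y Z W : C} {k : Hom Y Y} (hk : k ∈ (𝔄.ideal Y).carrier)
    {T : Hom Y Y →ₗ[ℂ] Hom W Z} (hT : Continuous T) {N : Submodule ℂ (Hom W Z)}
    (hN : IsClosed (N : Set (Hom W Z)))
    (h : ∀ (a b : 𝔄.objs) (f : Hom Y (a : C)) (c : Hom (a : C) (b : C)) (g : Hom (b : C) Y),
      c ∈ 𝔄.hom a b → T (g ⊚ c ⊚ f) ∈ N) : T k ∈ N := by
  have hle : 𝔄.idealSpan Y ≤ N.comap T := by
    rw [idealSpan, Submodule.span_le]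
    rintro _ ⟨a, b, f, c, g, hc, rfl⟩
    exact h a b f c g hc
  exact closure_minimal hle (hN.preimage hT) hk

theorem comp_comp_mem_ideal {Y Z : C} {k : Hom Y Y} (hk : k ∈ (𝔄.ideal Y).carrier) (l : Hom Y Z)
    (r : Hom Z Y) : l ⊚ k ⊚ r ∈ (𝔄.ideal Z).carrier :=
  𝔄.map_mem_of_mem_ideal hk (T := compL l ∘ₗ compL.flip r)
    (continuous_comp.comp (continuous_const.prodMk
      (continuous_comp.comp (continuous_id.prodMk continuous_const))))
    (N := (𝔄.idealSpan Z).topologicalClosure)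
    (𝔄.ideal Z).isClosed fun a b f c g hc => 𝔄.idealSpan_le_ideal
      (Submodule.subset_span ⟨a, b, f ⊚ r, c, l ⊚ g, hc, by
        change l ⊚ (g ⊚ c ⊚ f) ⊚ r = _
        simp only [comp_assoc]⟩)

theorem comp_mem_ideal_subsp {A Y Z : C} {k : Hom A Y} (hk : k ∈ (𝔄.ideal Y).subsp A)
    (l : Hom Y Z) : l ⊚ k ∈ (𝔄.ideal Z).subsp A := by
  rw [HeredSubalg.mem_subsp, dag_comp, comp_assoc, ← comp_assoc k]
  exact 𝔄.comp_comp_mem_ideal hk l l†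

theorem resSub_le_ideal_subsp {Y : C} {a : 𝔄.objs} {f : Hom (a : C) Y} (hf : f ∈ 𝔄.resSub Y a) :
    f ∈ (𝔄.ideal Y).subsp (a : C) := by
  rw [HeredSubalg.mem_subsp]
  refine comp_mem_of_closure' (𝔄.ideal Y).isClosed fun ε hε => ?_
  obtain ⟨w, hw, -, hn⟩ := approx_right f hε
  exact ⟨f ⊚ w, hn, 𝔄.idealSpan_le_ideal
    (Submodule.subset_span ⟨a, a, f†, w, f, 𝔄.elemental_le hf hw, comp_assoc _ _ _⟩)⟩

theorem comp_mem_resSub {Y : C} {a b : 𝔄.objs} {c : Hom (a : C) (b : C)} (hc : c ∈ 𝔄.hom a b)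
    (g : Hom (b : C) Y) : g ⊚ c ∈ 𝔄.resSub Y a := by
  rw [mem_resSub, dag_comp, comp_assoc, ← comp_assoc g†]
  exact 𝔄.hered _ (𝔄.dag_mem hc) hc

/-- An embedding has image `J Y`, for the ideal `J` of `C(Y)` generated by `𝔄`, if the image is
contained in `J Y` and contains the morphisms `f : a ⟶ Y` with `f† ⊚ f ∈ 𝔄`. -/
theorem ideal_subsp_eq_range {Y : C} {K : HilbertModule C} (e : ModEmb K Y)
    (h : ∀ {B : C} (k : K.obj B), e.map k ∈ (𝔄.ideal Y).subsp B)
    (h' : ∀ {a : 𝔄.objs} {f : Hom (a : C) Y}, f ∈ 𝔄.resSub Y a →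
      f ∈ LinearMap.range (e.map (B := (a : C)))) (B : C) :
    (𝔄.ideal Y).subsp B = LinearMap.range (e.map (B := B)) := by
  apply le_antisymm
  · intro x hx
    have hc := e.isClosed_range B
    -- `x` is a limit of elements `w ⊚ x` with `w` in the ideal
    have h1 : x ∈ closure (LinearMap.range (e.map (B := B)) : Set (Hom B Y)) := by
      rw [Metric.mem_closure_iff]
      intro ε hε
      obtain ⟨w, hw, -, hn⟩ := approx_left' x hε
      refine ⟨w ⊚ x, ?_, by rwa [dist_eq_norm]⟩
      have hw' : w ∈ (𝔄.ideal Y).carrier := (𝔄.ideal Y).elemental_le hx hw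
      refine 𝔄.map_mem_of_mem_ideal hw' (T := compL.flip x)
        (continuous_comp.comp (continuous_id.prodMk continuous_const)) hc fun a b f c g hc => ?_
      change (g ⊚ c ⊚ f) ⊚ x ∈ _
      have := e.comp_mem_range (h' (𝔄.comp_mem_resSub hc g)) (f ⊚ x)
      simpa only [comp_assoc] using this
    rwa [hc.closure_eq] at h1
  · rintro _ ⟨k, rfl⟩
    exact h k

end HeredSubcat

/-! ### Weak containment -/

theorem ModEmb.map_ten_mem {D C : Type u} [CStarCat D] [CStarCat C] [UnitalStarCat C]
    {f : StarFunctor D C} {H : SmallHilb.{v} D} {X : C} (e : ModEmb (bcObj f H).toHilbertModule X)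
    {B : C} {N : Submodule ℂ (Hom B X)} (hN : IsClosed (N : Set (Hom B X)))
    (h : ∀ {d : D} (h : H.obj d) (g : Hom B (f.obj d)), e.map (ten f H h g) ∈ N)
    (k : (bcObj f H).obj B) : e.map k ∈ N := by
  induction k using ten_induct with
  | hc => exact hN.preimage (e.continuous_map B)
  | h0 => rw [map_zero]; exact Submodule.zero_mem _
  | ht k g => exact h k g
  | ha x y hx hy => rw [map_add]; exact Submodule.add_mem _ hx hy
  | hm c x hx => rw [map_smul]; exact Submodule.smul_mem _ c hx

/-- The tautological embedding of `𝒜 X`. -/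
def HeredSubalg.modEmb {C : Type u} [CStarCat C] {X : C} (𝒜 : HeredSubalg X) :
    ModEmb 𝒜.module X where
  map {B} := (𝒜.subsp B).subtype
  map_act _ _ := rfl
  dag_map _ _ := rfl

/-- The composite of an embedding with an isometry. -/
def ModEmb.postcomp {C : Type u} [CStarCat C] [UnitalStarCat C] {K : HilbertModule C} {X Y : C}
    (e : ModEmb K X) (u : Hom X Y) (hu : u† ⊚ u = UnitalStarCat.one X) : ModEmb K Y where
  map := compL u ∘ₗ e.map
  map_act k f := by
    change u ⊚ e.map (K.act k f) = (u ⊚ e.map k) ⊚ f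
    rw [e.map_act, comp_assoc]
  dag_map k l := by
    change (u ⊚ e.map k)† ⊚ u ⊚ e.map l = _
    rw [dag_comp, comp_assoc, ← comp_assoc u†, hu, UnitalStarCat.one_comp, e.dag_map]

/-- The map `f ⊗ g ↦ f ⊚ g` embeds the base change of `R_𝔄 Y` in `𝕐 Y`, with image `J Y`, for the
ideal `J` of `C(Y)` generated by `𝔄`. -/
theorem HeredSubcat.exists_modEmb_resObj {C : Type u} [CStarCat C] [UnitalStarCat C]
    [LocSmall.{v} C] (𝔄 : HeredSubcat C) (Y : C) :
    ∃ e : ModEmb (bcObj 𝔄.incl (𝔄.resObj Y : SmallHilb.{v} 𝔄.Cat)).toHilbertModule Y,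
      (∀ {a : 𝔄.objs} (f : 𝔄.resSub Y a) {B : C} (g : Hom B (a : C)),
        e.map (ten 𝔄.incl (𝔄.resObj Y) (d := a) f g) = f.1 ⊚ g) ∧
      ∀ B, (𝔄.ideal Y).subsp B = LinearMap.range (e.map (B := B)) := by
  obtain ⟨e, he⟩ := exists_modEmb_bcModule 𝔄.incl (𝔄.resModule Y)
    (t := fun {a} (f : 𝔄.resSub Y a) => f.1) (fun _ _ => rfl)
  refine ⟨e, fun f B g => he (d := _) f g, 𝔄.ideal_subsp_eq_range e (fun {B} k => ?_) ?_⟩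
  · refine ModEmb.map_ten_mem (f := 𝔄.incl) (H := (𝔄.resObj Y : SmallHilb.{v} 𝔄.Cat)) e
      ((𝔄.ideal Y).isClosed_subsp B) (fun {a} f g => ?_) k
    have e1 : e.map (tens 𝔄.incl (𝔄.resModule Y) f g) = f.1 ⊚ g := he f g
    have := (𝔄.ideal Y).act_mem (𝔄.resSub_le_ideal_subsp f.2) g
    exact e1 ▸ this
  · intro a f hf
    refine ⟨tens 𝔄.incl (𝔄.resModule Y) (d := a) ⟨f, hf⟩ (UnitalStarCat.one _), ?_⟩
    exact (he _ _).trans (UnitalStarCat.comp_one f)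

theorem HeredSubcat.isUnitary_res_map {C : Type u} [CStarCat C] [UnitalStarCat C]
    [LocSmall.{v} C] (𝔄 : HeredSubcat C) {X Y : C} {u : Hom X Y} (hu : IsUnitary u) :
    IsUnitary (𝔄.res.map u : Hom (𝔄.resObj X : SmallHilb.{v} 𝔄.Cat) (𝔄.resObj Y)) := by
  have h : ∀ X : C, 𝔄.res.map (UnitalStarCat.one X) =
      UnitalStarCat.one (𝔄.resObj X : SmallHilb.{v} 𝔄.Cat) := fun X =>
    SmallHilb.hom_ext fun f => Subtype.ext (UnitalStarCat.one_comp _)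
  have h1 := (𝔄.res (C := C)).map_comp u† u
  have h2 := (𝔄.res (C := C)).map_comp u u†
  rw [hu.1, h, (𝔄.res (C := C)).map_dag] at h1
  rw [hu.2, h, (𝔄.res (C := C)).map_dag] at h2
  exact ⟨h1.symm, h2.symm⟩

namespace PreComplete
variable {C : Type u} [CStarCat C] [UnitalStarCat C] {P : PreComplete.{v} C}

theorem emb_ten {D : Type u} [CStarCat D] (f : StarFunctor D C) {H : SmallHilb.{v} D} {d : D}
    (h : H.obj d) {B : C} (g : Hom B (f.obj d)) : P.emb (ten f H h g) = P.cone f h ⊚ g :=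
  (congrArg P.emb (ten_eq_act f H h g)).trans (P.emb_act _ g)

/-- A morphism out of `f_* H` is determined by its composites with the structural morphisms. -/
theorem push_hom_ext (h1 : P.C1) {D : Type u} [CStarCat D] {f : StarFunctor D C}
    {H : SmallHilb.{v} D} {A : C} {l l' : Hom ((P.push f).obj H) A}
    (h : ∀ {d : D} (x : H.obj d), l ⊚ P.cone f x = l' ⊚ P.cone f x) : l = l' := by
  refine hom_ext h1 (H := bcObj f H) fun {B} a => ?_
  let N : Submodule ℂ (Hom B (P.L.obj (bcObj f H))) := LinearMap.ker (compL l - compL l')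
  have hN : IsClosed (N : Set (Hom B (P.L.obj (bcObj f H)))) := by
    have hc : ∀ l : Hom (P.L.obj (bcObj f H)) A, Continuous fun y : Hom B _ => l ⊚ y := fun l =>
      continuous_comp.comp (continuous_const.prodMk continuous_id)
    have : IsClosed {y : Hom B (P.L.obj (bcObj f H)) | l ⊚ y - l' ⊚ y = 0} :=
      isClosed_eq ((hc l).sub (hc l')) continuous_const
    exact this
  have := (P.modEmb (bcObj f H)).map_ten_mem hN (fun {d} x g => by
    have e : ∀ l : Hom ((P.push f).obj H) A,
        l ⊚ P.emb (ten f H x g) = (l ⊚ P.cone f x) ⊚ g := fun l =>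
      (congrArg (l ⊚ ·) (emb_ten f x g)).trans (comp_assoc _ _ _).symm
    exact sub_eq_zero.2 ((e l).trans ((congrArg (· ⊚ g) (h x)).trans (e l').symm))) a
  exact sub_eq_zero.1 this

variable [LocSmall.{v} C] {𝔄 : HeredSubcat C}

/-- By (C3), `L H` is weakly contained in `𝔄` if the compact operators of `H` belong to the ideal
generated by `𝔄`. -/
theorem weaklyContained_of_emb_mem (h1 : P.C1) (h3 : P.C3) {H : SmallHilb.{v} C}
    (h : ∀ {B : C} (k : H.obj B), P.emb k ∈ (𝔄.ideal (P.L.obj H)).subsp B) :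
    P.WeaklyContained (P.L.obj H) 𝔄 :=
  h3 _ _ _ ((P.modEmb H).compacts_le h) (weaklyDense_compacts h1 H)

theorem weaklyContained_push (h1 : P.C1) (h3 : P.C3) (H : SmallHilb.{v} 𝔄.Cat) :
    P.WeaklyContained ((P.push 𝔄.incl).obj H) 𝔄 := by
  refine weaklyContained_of_emb_mem h1 h3 (H := bcObj 𝔄.incl H) fun {B} k => ?_
  refine (P.modEmb (bcObj 𝔄.incl H)).map_ten_mem (HeredSubalg.isClosed_subsp _ _)
    (fun {a} x g => ?_) k
  have e : (P.modEmb (bcObj 𝔄.incl H)).map (ten 𝔄.incl H x g) = P.cone 𝔄.incl x ⊚ g :=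
    emb_ten 𝔄.incl x g
  have hx : P.cone 𝔄.incl x ∈ 𝔄.resSub ((P.push 𝔄.incl).obj H) a :=
    ((P.preClosure 𝔄).μ H a x).2
  rw [e]
  exact HeredSubalg.act_mem _ (𝔄.resSub_le_ideal_subsp hx) g

theorem WeaklyContained.of_iso (h1 : P.C1) {Y Z : C} (h : Iso Y Z) (hZ : P.WeaklyContained Z 𝔄) :
    P.WeaklyContained Y 𝔄 := by
  obtain ⟨u, hu⟩ := h
  let K : SmallHilb.{v} C := (𝔄.ideal Z).small
  obtain ⟨θ, hθ, hθe⟩ := hZ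
  let e : ModEmb K.toHilbertModule Y :=
    ModEmb.postcomp (𝔄.ideal Z).modEmb u† (by rw [dag_dag]; exact hu.2)
  refine (weaklyDense_iff h1 e fun B => le_antisymm (fun y hy => ?_) ?_).2
    ⟨u† ⊚ θ, hu.dag.comp hθ, fun {B} k => ?_⟩
  · refine ⟨⟨u ⊚ y, 𝔄.comp_mem_ideal_subsp hy u⟩, ?_⟩
    change u† ⊚ u ⊚ y = y
    rw [← comp_assoc, hu.1, UnitalStarCat.one_comp]
  · rintro _ ⟨k, rfl⟩
    exact 𝔄.comp_mem_ideal_subsp k.2 u†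
  · rw [comp_assoc]
    exact congrArg (u† ⊚ ·) (hθe B k)

/-- The functors `i_*` and `R_𝔄` reconstruct every object which is weakly contained in `𝔄`. -/
theorem WeaklyContained.exists_unitary (h1 : P.C1) {Y : C} (hY : P.WeaklyContained Y 𝔄) :
    ∃ φ : Hom ((P.push 𝔄.incl).obj (𝔄.res.obj Y)) Y, IsUnitary φ ∧
      ∀ {a : 𝔄.Cat} (f : 𝔄.resSub Y a), φ ⊚ P.cone 𝔄.incl (H := 𝔄.res.obj Y) f = f.1 := by
  obtain ⟨e, he, hr⟩ := 𝔄.exists_modEmb_resObj Y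
  obtain ⟨φ, hφ, hφe⟩ := (weaklyDense_iff h1 e hr).1 hY
  exact ⟨φ, hφ, fun f => (hφe _).trans ((he f _).trans (UnitalStarCat.comp_one _))⟩

theorem weaklyContained_iff (h1 : P.C1) (h3 : P.C3) (𝔄 : HeredSubcat C) (Y : C) :
    P.WeaklyContained Y 𝔄 ↔ ∃ H : SmallHilb.{v} 𝔄.Cat, Iso Y ((P.push 𝔄.incl).obj H) := by
  constructor
  · intro h
    obtain ⟨φ, hφ, -⟩ := h.exists_unitary h1
    exact ⟨𝔄.res.obj Y, φ†, hφ.dag⟩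
  · rintro ⟨H, hH⟩
    exact .of_iso h1 hH (weaklyContained_push h1 h3 H)

/-! ### Closed modules and generating subcategories -/

theorem res_push_naturality (h1 : P.C1) {Y Z : C}
    {φ : Hom ((P.push 𝔄.incl).obj (𝔄.res.obj Y)) Y} {ψ : Hom ((P.push 𝔄.incl).obj (𝔄.res.obj Z)) Z}
    (hφ : ∀ {a : 𝔄.Cat} (f : 𝔄.resSub Y a), φ ⊚ P.cone 𝔄.incl (H := 𝔄.res.obj Y) f = f.1)
    (hψ : ∀ {a : 𝔄.Cat} (f : 𝔄.resSub Z a), ψ ⊚ P.cone 𝔄.incl (H := 𝔄.res.obj Z) f = f.1)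
    (g : Hom Y Z) : g ⊚ φ = ψ ⊚ (P.push 𝔄.incl).map (𝔄.res.map g) := by
  refine push_hom_ext h1 fun {a} f => ?_
  rw [comp_assoc, comp_assoc, push_map_cone]
  exact (congrArg (g ⊚ ·) (hφ f)).trans (hψ (SmallHilb.app (𝔄.res.map g) f)).symm

/-- The isomorphisms `Y ≃ i_* R_𝔄 Y` are natural, by (C1), as soon as they are compatible with the
structural morphisms. -/
theorem generating_of_forall (h1 : P.C1)
    (h : ∀ Y : C, ∃ φ : Hom ((P.push 𝔄.incl).obj (𝔄.res.obj Y)) Y, IsUnitary φ ∧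
      ∀ {a : 𝔄.Cat} (f : 𝔄.resSub Y a), φ ⊚ P.cone 𝔄.incl (H := 𝔄.res.obj Y) f = f.1) :
    P.Generating 𝔄 := by
  choose φ hφ hφe using h
  refine ⟨fun Y => (φ Y)†, ⟨fun Y => (hφ Y).dag, fun {Y Z} g => ?_⟩, fun Y a f => ?_⟩
  · apply (hφ Z).comp_left_cancel
    have := res_push_naturality h1 (hφe Y) (hφe Z) g
    change φ Z ⊚ (P.push 𝔄.incl).map (𝔄.res.map g) ⊚ (φ Y)† = φ Z ⊚ (φ Z)† ⊚ g
    rw [← comp_assoc, ← comp_assoc, (hφ Z).2, UnitalStarCat.one_comp]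
    refine (congrArg (· ⊚ (φ Y)†) this.symm).trans ?_
    rw [comp_assoc, (hφ Y).2]
    exact UnitalStarCat.comp_one g
  · apply (hφ Y).comp_left_cancel
    rw [← comp_assoc, (hφ Y).2, UnitalStarCat.one_comp]
    exact (hφe Y f).symm

theorem generating_iff (h1 : P.C1) (h3 : P.C3) :
    P.Generating 𝔄 ↔ ∀ Y : C, P.WeaklyContained Y 𝔄 := by
  constructor
  · rintro ⟨μ, hμ, -⟩ Y
    exact (weaklyContained_iff h1 h3 𝔄 Y).2 ⟨_, μ Y, hμ.1 Y⟩
  · exact fun h => generating_of_forall h1 fun Y => (h Y).exists_unitary h1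

theorem WeaklyContained.isClosedObj_res (h1 : P.C1) {Y : C} (hY : P.WeaklyContained Y 𝔄) :
    (P.preClosure 𝔄).IsClosedObj (𝔄.res.obj Y) := by
  obtain ⟨φ, hφ, hφe⟩ := hY.exists_unitary h1
  refine ⟨𝔄.res.map φ†, 𝔄.isUnitary_res_map hφ.dag, fun a f => Subtype.ext ?_⟩
  change φ† ⊚ f.1 = P.cone 𝔄.incl (H := 𝔄.res.obj Y) f
  apply hφ.comp_left_cancel
  rw [← comp_assoc, hφ.2, UnitalStarCat.one_comp]
  exact (hφe f).symm

theorem isClosure_preClosure (h1 : P.C1) (h3 : P.C3) (𝔄 : HeredSubcat C) :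
    (P.preClosure 𝔄).IsClosure := fun H => (weaklyContained_push h1 h3 H).isClosedObj_res h1

theorem isEquivalence_push_res (h1 : P.C1) (𝔄 : HeredSubcat C)
    (hF : ∀ H : SmallHilb.{v} 𝔄.Cat, (P.preClosure 𝔄).IsClosedObj H →
      P.WeaklyContained ((P.push 𝔄.incl).obj H) 𝔄)
    (hG : ∀ Y : C, P.WeaklyContained Y 𝔄 → (P.preClosure 𝔄).IsClosedObj (𝔄.res.obj Y)) :
    IsEquivalence
      ((P.push 𝔄.incl).restrict (P.preClosure 𝔄).IsClosedObj
        (fun Y => P.WeaklyContained Y 𝔄) hF)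
      (𝔄.res.restrict (fun Y => P.WeaklyContained Y 𝔄) (P.preClosure 𝔄).IsClosedObj hG) := by
  constructor
  · have h : ∀ H : FullSub (P.preClosure 𝔄).IsClosedObj, (P.preClosure 𝔄).IsClosedObj H.1 :=
      fun H => H.2
    choose T hT hTe using h
    refine ⟨T, hT, fun {H G} S => ?_⟩
    refine SmallHilb.hom_ext (H := H.1) (G := (P.preClosure 𝔄).P.obj G.1) fun {a} x => ?_
    have e1 := (P.preClosure 𝔄).μ_natural (H := H.1) (G := G.1) S x
    rw [← hTe H a x, ← hTe G a] at e1
    exact e1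
  · have h : ∀ Y : FullSub (fun Y => P.WeaklyContained Y 𝔄), P.WeaklyContained Y.1 𝔄 :=
      fun Y => Y.2
    choose φ hφ hφe using fun Y => (h Y).exists_unitary h1
    exact ⟨φ, hφ, fun {Y Z} g => res_push_naturality h1 (hφe Y) (hφe Z) g⟩

end PreComplete

/-! ### Base change from weakly contained objects -/

namespace HeredSubalg
variable {C : Type u} [CStarCat C]

/-- The intersection of two hereditary subalgebras. -/
def inf {X : C} (𝒜 ℬ : HeredSubalg X) : HeredSubalg X where
  toNonUnitalStarSubalgebra := 𝒜.toNonUnitalStarSubalgebra ⊓ ℬ.toNonUnitalStarSubalgebra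
  isClosed := 𝒜.isClosed.inter ℬ.isClosed
  hered g ha hb := ⟨𝒜.hered g ha.1 hb.1, ℬ.hered g ha.2 hb.2⟩

variable {A Z : C} {𝒜 : HeredSubalg A} {ℬ : HeredSubalg Z}

/-- Composition with `f : A ⟶ Z`, as an operator from `𝒜 A` to `ℬ Z`. -/
theorem exists_compOp [LocSmall.{v} C] (f : Hom A Z)
    (hf : ∀ {B : C} {u : Hom B A}, u ∈ 𝒜.subsp B → f ⊚ u ∈ ℬ.subsp B)
    (hf' : ∀ {B : C} {z : Hom B Z}, z ∈ ℬ.subsp B → f† ⊚ z ∈ 𝒜.subsp B) :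
    ∃ T : Hom (𝒜.small : SmallHilb.{v} C) ℬ.small,
      (∀ {B : C} (k : 𝒜.subsp B), SmallHilb.app T k = (⟨f ⊚ k.1, hf k.2⟩ : ℬ.subsp B)) ∧
      ∀ {B : C} (z : ℬ.subsp B), SmallHilb.app T† z = (⟨f† ⊚ z.1, hf' z.2⟩ : 𝒜.subsp B) := by
  let S : ∀ B, 𝒜.subsp B →ₗ[ℂ] ℬ.subsp B := fun B =>
    (compL f ∘ₗ (𝒜.subsp B).subtype).codRestrict _ fun k => hf k.2
  let S' : ∀ B, ℬ.subsp B →ₗ[ℂ] 𝒜.subsp B := fun B =>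
    (compL f† ∘ₗ (ℬ.subsp B).subtype).codRestrict _ fun k => hf' k.2
  have hadj : ∀ {B B' : C} (k : 𝒜.subsp B) (z : ℬ.subsp B'),
      k.1† ⊚ f† ⊚ z.1 = (f ⊚ k.1)† ⊚ z.1 := fun k z => by rw [dag_comp, comp_assoc]
  let T : Hom (𝒜.small : SmallHilb.{v} C) ℬ.small :=
    Op.mk' (H := 𝒜.small) (G := ℬ.small) S S'
      ⟨fun k g => Subtype.ext (comp_assoc f k.1 g).symm, ‖f‖, fun _ k => norm_comp_le f k.1⟩
      ⟨fun k g => Subtype.ext (comp_assoc f† k.1 g).symm, ‖f†‖, fun _ k => norm_comp_le f† k.1⟩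
      (fun k z => hadj k z)
  refine ⟨T, fun _ => rfl, fun {B} z => ?_⟩
  refine (𝒜.small : SmallHilb.{v} C).ext_inner _ _ fun b => ?_
  exact (SmallHilb.inner_dag_app T b (show (ℬ.small : SmallHilb.{v} C).obj B from z)).trans
    (hadj b z).symm

end HeredSubalg

namespace PreComplete
variable {C : Type u} [CStarCat C] [UnitalStarCat C] {P : PreComplete.{v} C} [LocSmall.{v} C]

/-- If `𝒜` is weakly dense in `C(A)` and composition with `f : A ⟶ Z` defines an operator
`𝒜 A → ℬ Z`, then `f` has a counterpart `A ⟶ L(ℬ Z)`, with the same inner products with the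
elements of `ℬ Z` and with the counterparts of other morphisms. It is the image of the operator
under `L`, composed with `A ≃ L(𝒜 A)`. -/
theorem exists_lift {Z : C} (h1 : P.C1) (ℬ : HeredSubalg Z) {ι : Type*} (A : ι → C)
    (𝒜 : ∀ i, HeredSubalg (A i)) (h𝒜 : ∀ i, P.WeaklyDense (𝒜 i)) (f : ∀ i, Hom (A i) Z)
    (hf : ∀ i {B : C} {u : Hom B (A i)}, u ∈ (𝒜 i).subsp B → f i ⊚ u ∈ ℬ.subsp B)
    (hf' : ∀ i {B : C} {z : Hom B Z}, z ∈ ℬ.subsp B → (f i)† ⊚ z ∈ (𝒜 i).subsp B) :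
    ∃ f' : ∀ i, Hom (A i) (P.L.obj ℬ.small),
      (∀ i j, (f' i)† ⊚ f' j = (f i)† ⊚ f j) ∧
      ∀ i {B : C} (z : ℬ.subsp B), (P.emb (H := ℬ.small) z)† ⊚ f' i = z.1† ⊚ f i := by
  choose θ hθ hθe using h𝒜
  choose T hT hT' using fun i => HeredSubalg.exists_compOp.{v} (f i) (hf i) (hf' i)
  refine ⟨fun i => P.L.map (T i) ⊚ (θ i)†, fun i j => ?_, fun i B z => ?_⟩
  · have e : θ i ⊚ P.L.map ((T i)† ⊚ T j) = ((f i)† ⊚ f j) ⊚ θ j := by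
      refine hom_ext h1 fun {B} u => ?_
      have e1 : SmallHilb.app ((T i)† ⊚ T j) u =
          (⟨(f i)† ⊚ f j ⊚ u.1, hf' i (hf j u.2)⟩ : (𝒜 i).subsp B) :=
        (congrArg (SmallHilb.app (T i)†) (hT j u)).trans (hT' i _)
      rw [comp_assoc, map_emb, e1]
      refine (hθe i B _).trans ?_
      rw [comp_assoc]
      exact (comp_assoc _ _ _).symm.trans (congrArg (((f i)† ⊚ f j) ⊚ ·) (hθe j B u).symm)
    rw [dag_comp, dag_dag, comp_assoc, ← comp_assoc (P.L.map (T i))†, ← P.L.map_dag,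
      ← P.L.map_comp, ← comp_assoc, e, comp_assoc, (hθ j).2, UnitalStarCat.comp_one]
  · have e : (P.L.map (T i) ⊚ (θ i)†)† ⊚ P.emb (H := ℬ.small) z = (f i)† ⊚ z.1 := by
      rw [dag_comp, dag_dag, comp_assoc, ← P.L.map_dag]
      refine (congrArg (θ i ⊚ ·) ((P.map_emb (T i)† _).trans (congrArg P.emb (hT' i z)))).trans ?_
      exact hθe i B _
    have := congrArg dag e
    rw [dag_comp, dag_comp (f i)†, dag_dag, dag_dag] at this
    exact this

/-- If all objects `j(d)` are weakly contained in `𝔄`, then so is `j_* H`. Let `Z = j_* H`, let `𝒦`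
be the algebra of compact operators of the base change `M` of `H` to `C`, and let `𝒦'` be the
intersection of `𝒦` with the ideal generated by `𝔄`. The structural morphisms `j(d) ⟶ Z` lift to
`W = L(𝒦' Z)`, so that `M` embeds in `W`, compatibly with `𝒦' Z ⊆ M`. As the compact operators of
`𝒦' Z` are weakly dense in `C(W)`, so are those of `M`; hence `W ≃ L M = Z`, and `𝒦'` is weakly
dense in `C(Z)`. -/
theorem weaklyContained_push_of_forall (h1 : P.C1) (h3 : P.C3) {𝔄 : HeredSubcat C} {D : Type u}
    [CStarCat D] (j : StarFunctor D C) (hj : ∀ d, P.WeaklyContained (j.obj d) 𝔄)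
    (H : SmallHilb.{v} D) : P.WeaklyContained ((P.push j).obj H) 𝔄 := by
  let M : SmallHilb.{v} C := bcObj j H
  let Z : C := P.L.obj M
  let 𝒦 : HeredSubalg Z := (P.modEmb M).compacts
  let 𝒦' : HeredSubalg Z := 𝒦.inf (𝔄.ideal Z)
  let W : C := P.L.obj 𝒦'.small
  have hcone : ∀ {d : D} (h : H.obj d), P.cone j h ∈ 𝒦.subsp (j.obj d) := fun {d} h => by
    rw [(P.modEmb M).subsp_compacts]
    exact ⟨incl₁ j H h, rfl⟩
  obtain ⟨t, htt, ht⟩ := exists_lift h1 𝒦' (ι := Σ d : D, H.obj d) (fun i => j.obj i.1)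
    (fun i => 𝔄.ideal (j.obj i.1)) (fun i => hj i.1) (fun i => P.cone j i.2)
    (fun i {B u} hu => ⟨𝒦.act_mem (hcone i.2) u, 𝔄.comp_mem_ideal_subsp hu _⟩)
    (fun i {B z} hz => 𝔄.comp_mem_ideal_subsp (show z ∈ (𝔄.ideal Z).subsp B from hz.2) _)
  obtain ⟨e, he⟩ := exists_modEmb_bcModule j H.toHilbertModule (X := W)
    (t := fun {d} h => t ⟨d, h⟩) (fun h h' => (htt _ _).trans (P.cone_dag_cone j h h'))
  have key : ∀ {A B : C} (z : 𝒦'.subsp B) (m : M.obj A),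
      (P.emb (H := 𝒦'.small) z)† ⊚ e.map m = z.1† ⊚ (P.modEmb M).map m := by
    intro A B z m
    induction m using ten_induct with
    | hc => exact isClosed_eq (continuous_comp.comp (continuous_const.prodMk (e.continuous_map A)))
              (continuous_comp.comp (continuous_const.prodMk ((P.modEmb M).continuous_map A)))
    | h0 => exact (congrArg ((P.emb (H := 𝒦'.small) z)† ⊚ ·) (map_zero e.map)).trans
              ((comp_zero _).trans ((congrArg (z.1† ⊚ ·) (map_zero (P.modEmb M).map)).trans
                (comp_zero _)).symm)
    | ht h g =>
      have e1 : e.map (ten j H h g) = t ⟨_, h⟩ ⊚ g := he h g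
      have e2 : (P.modEmb M).map (ten j H h g) = P.cone j h ⊚ g := emb_ten j h g
      refine (congrArg ((P.emb (H := 𝒦'.small) z)† ⊚ ·) e1).trans ?_
      refine Eq.trans ?_ (congrArg (z.1† ⊚ ·) e2).symm
      refine (comp_assoc _ _ _).symm.trans ((congrArg (· ⊚ g) (ht ⟨_, h⟩ z)).trans ?_)
      exact comp_assoc _ _ _
    | ha x y hx hy =>
      have e1 : e.map (x + y) = e.map x + e.map y := map_add e.map x y
      rw [map_add, comp_add, ← hx, ← hy, ← comp_add]
      exact congrArg _ e1
    | hm c x hx =>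
      have e1 : e.map (c • x) = c • e.map x := map_smul e.map c x
      rw [map_smul, comp_smul, ← hx, ← comp_smul]
      exact congrArg _ e1
  have hemb : ∀ {B : C} (z : 𝒦'.subsp B), ∃ m : M.obj B,
      (P.modEmb M).map m = z.1 ∧ e.map m = P.emb (H := 𝒦'.small) z := by
    intro B z
    have hz : z.1 ∈ LinearMap.range ((P.modEmb M).map (B := B)) := by
      rw [← (P.modEmb M).subsp_compacts]
      exact z.2.1
    obtain ⟨m, hm⟩ := hz
    refine ⟨m, hm, hom_ext_dag h1 fun {B'} z' => (key z' m).trans ?_⟩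
    exact (congrArg _ hm).trans (P.emb_dag_emb (H := 𝒦'.small) z' z).symm
  have hd : P.WeaklyDense e.compacts :=
    h3 _ _ _ ((P.modEmb 𝒦'.small).compacts_le fun {B} z => by
      obtain ⟨m, -, hm⟩ := hemb z
      rw [e.subsp_compacts]
      exact ⟨m, hm⟩) (weaklyDense_compacts h1 𝒦'.small)
  obtain ⟨φ, hφ, hφe⟩ := (weaklyDense_iff h1 (K := M) e e.subsp_compacts).1 hd
  refine h3 _ 𝒦' _ (fun _ hk => hk.2) ⟨φ†, hφ.dag, fun B z => ?_⟩
  obtain ⟨m, hm, hme⟩ := hemb z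
  apply hφ.comp_left_cancel
  rw [← comp_assoc, hφ.2, UnitalStarCat.one_comp, ← hm, ← hme]
  exact (hφe m).symm

end PreComplete

/-! ### The objects quasi-contained in a given object -/

theorem HeredSubcat.locSmall_cat {C : Type u} [CStarCat C] [LocSmall.{v} C] (𝔄 : HeredSubcat C) :
    LocSmall.{v} 𝔄.Cat where
  small a b := by
    have : Small.{v} (Hom a.1 b.1) := LocSmall.small a.1 b.1
    exact small_of_injective (β := Hom a.1 b.1) (f := fun f : 𝔄.hom a b => f.1)
      Subtype.val_injective

theorem HilbertModule.act_one {C : Type u} [CStarCat C] [UnitalStarCat C] (H : HilbertModule C)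
    {A : C} (a : H.obj A) : H.act a (UnitalStarCat.one A) = a :=
  H.ext_inner _ _ fun b => (H.inner_act b a _).trans (UnitalStarCat.comp_one _)

namespace PreComplete
variable {C : Type u} [CStarCat C] [UnitalStarCat C] {P : PreComplete.{v} C} [LocSmall.{v} C]

theorem quasiContained_refl (h1 : P.C1) (X : C) : P.QuasiContained X X := by
  let e : ModEmb (yonedaObj X : SmallHilb.{v} C).toHilbertModule X :=
    { map := LinearMap.id, map_act := fun _ _ => rfl, dag_map := fun _ _ => rfl }
  refine (weaklyDense_iff h1 e fun B => le_antisymm (fun h _ => ⟨h, rfl⟩) fun h _ => ?_).2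
    ⟨(P.unit X)†, (P.isNatUnitary_unit.1 X).dag, fun {B} k => ?_⟩
  · refine HeredSubcat.idealSpan_le_ideal _ (Submodule.subset_span
      ⟨⟨X, rfl⟩, ⟨X, rfl⟩, h ⊚ h†, UnitalStarCat.one X, UnitalStarCat.one X, Submodule.mem_top, ?_⟩)
    rw [UnitalStarCat.one_comp, UnitalStarCat.one_comp]
  · have h2 : P.emb k = P.unit X ⊚ k := P.unit_natural k
    refine (congrArg ((P.unit X)† ⊚ ·) h2).trans ((comp_assoc _ _ _).symm.trans ?_)
    exact (congrArg (fun z => comp z k) (P.unit_dag_unit X)).trans (UnitalStarCat.one_comp _)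

theorem isPreCompleteFullSub_quasiContained (h1 : P.C1) (h3 : P.C3) (X : C) :
    P.IsPreCompleteFullSub (fun Y => P.QuasiContained Y X) where
  of_iso h hY := WeaklyContained.of_iso h1 h hY
  push_mem _ _ _ i H := weaklyContained_push_of_forall h1 h3
    ((FullSub.incl fun Y => P.QuasiContained Y X).comp i) (fun d => (i.obj d).2) H

/-- If `Y ≺ X`, then `Y` is a push-forward along the inclusion of `C(X)`, which factors through every
full subcategory containing `X`. -/
theorem IsPreCompleteFullSub.of_quasiContained (h1 : P.C1) (h3 : P.C3) {S : C → Prop}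
    (hS : P.IsPreCompleteFullSub S) {X : C} (hX : S X) {Y : C} (hY : P.QuasiContained Y X) :
    S Y := by
  obtain ⟨H, hH⟩ := (weaklyContained_iff h1 h3 _ Y).1 hY
  have := (HeredSubcat.fullOn X).locSmall_cat
  have hobj : ∀ a : (HeredSubcat.fullOn X).Cat, S ((HeredSubcat.fullOn X).incl.obj a) := fun a => by
    change S a.1
    rwa [show a.1 = X from a.2]
  exact hS.of_iso hH (hS.push_mem _ (FullSub.lift S (HeredSubcat.fullOn X).incl hobj) H)

theorem QuasiContained.trans (h1 : P.C1) (h3 : P.C3) {X Y Z : C} (hZ : P.QuasiContained Z Y)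
    (hY : P.QuasiContained Y X) : P.QuasiContained Z X :=
  (isPreCompleteFullSub_quasiContained h1 h3 X).of_quasiContained h1 h3 hY hZ

/-! ### The induced pre-complete structure -/

variable {S : C → Prop}

/-- For the induced structure, the embedding of `H` in `L H` is given by the structural morphisms of
`incl_* H`. -/
theorem induced_emb (h1 : P.C1) (hS : P.IsPreCompleteFullSub S) {H : SmallHilb.{v} (FullSub S)}
    {A : FullSub S} (a : H.obj A) : (P.induced h1 hS).emb a = P.cone (FullSub.incl S) a :=
  (P.push_map_cone (FullSub.incl S) (elemOp a) (UnitalStarCat.one A)).trans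
    (congrArg (P.cone (FullSub.incl S)) (H.act_one a))

theorem induced_C1 (h1 : P.C1) (hS : P.IsPreCompleteFullSub S) : (P.induced h1 hS).C1 := by
  intro H A l hl
  refine push_hom_ext (P := P) (f := FullSub.incl S) (l := l) (l' := (0 : Hom _ A.1)) h1
    fun {d} x => ?_
  refine Eq.trans ?_ (zero_comp (C := C) _).symm
  exact (congrArg (fun z => comp (C := C) l z) (induced_emb h1 hS x).symm).trans (hl d x)

variable {X : C} (hX : S X)

theorem quasiContained_of_generating_induced (h1 : P.C1) (h3 : P.C3)
    (hS : P.IsPreCompleteFullSub S)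
    (hg : (P.induced h1 hS).Generating (HeredSubcat.fullOn (⟨X, hX⟩ : FullSub S)))
    {Y : C} (hY : S Y) : P.QuasiContained Y X := by
  obtain ⟨μ, hμ, -⟩ := hg
  let 𝔄 : HeredSubcat (FullSub S) := HeredSubcat.fullOn (⟨X, hX⟩ : FullSub S)
  let Y' : FullSub S := ⟨Y, hY⟩
  let M : SmallHilb.{v} (FullSub S) := bcObj 𝔄.incl (𝔄.res.obj Y')
  let 𝔛 := HeredSubcat.fullOn X
  let Z : C := P.L.obj (bcObj (FullSub.incl S) M)
  have hiso : Iso Y Z := ⟨μ Y', hμ.1 Y'⟩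
  refine WeaklyContained.of_iso h1 hiso ?_
  -- the structural morphisms are limits of sums of morphisms which factor through `X`
  have hM : ∀ {B : FullSub S} (x : M.obj B), P.cone (FullSub.incl S) x ∈ (𝔛.ideal Z).subsp B.1 := by
    intro B x
    rw [← induced_emb h1 hS]
    refine ((P.induced h1 hS).modEmb M).map_ten_mem (N := (𝔛.ideal Z).subsp B.1)
      ((𝔛.ideal Z).isClosed_subsp B.1) (fun {a} f g => ?_) x
    have e : ((P.induced h1 hS).modEmb M).map (ten 𝔄.incl (𝔄.res.obj Y') f g) =
      (P.induced h1 hS).cone 𝔄.incl f ⊚ g := emb_ten (P := P.induced h1 hS) 𝔄.incl f g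
    refine e ▸ ?_
    have ha : a.1.1 = X := congrArg Subtype.val (show a.1 = ⟨X, hX⟩ from a.2)
    exact (𝔛.ideal Z).act_mem (𝔛.resSub_le_ideal_subsp (a := ⟨a.1.1, ha⟩) Submodule.mem_top) g
  refine weaklyContained_of_emb_mem h1 h3 (H := bcObj (FullSub.incl S) M) fun {B} k => ?_
  refine (P.modEmb (bcObj (FullSub.incl S) M)).map_ten_mem (HeredSubalg.isClosed_subsp _ _)
    (fun {d} x g => ?_) k
  have e : (P.modEmb (bcObj (FullSub.incl S) M)).map (ten (FullSub.incl S) M x g) =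
    P.cone (FullSub.incl S) x ⊚ g := emb_ten (FullSub.incl S) x g
  rw [e]
  exact HeredSubalg.act_mem _ (hM x) g

theorem generating_induced (h1 : P.C1) (hS : P.IsPreCompleteFullSub S)
    (h : ∀ Y, S Y → P.QuasiContained Y X) :
    (P.induced h1 hS).Generating (HeredSubcat.fullOn (⟨X, hX⟩ : FullSub S)) := by
  let 𝔄 : HeredSubcat (FullSub S) := HeredSubcat.fullOn (⟨X, hX⟩ : FullSub S)
  let 𝔛 := HeredSubcat.fullOn X
  refine generating_of_forall (induced_C1 h1 hS) fun Y => ?_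
  let M : SmallHilb.{v} (FullSub S) := bcObj 𝔄.incl (𝔄.res.obj Y)
  -- `(f ⊗ g) ⊗ g' ↦ f ⊚ g ⊚ g'` embeds the iterated base change of `R Y` in `𝕐 Y`, with image `J Y`
  -- for the ideal `J` of `C(Y)` generated by `C(X)`
  obtain ⟨e, he, -⟩ := 𝔄.exists_modEmb_resObj.{v} Y
  obtain ⟨e', he'⟩ := exists_modEmb_bcModule (FullSub.incl S) M.toHilbertModule (X := Y.1)
    (t := fun {B} x => e.map x) (fun x y => e.dag_map x y)
  have hM : ∀ {B : FullSub S} (x : M.obj B),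
      (show Hom B.1 Y.1 from e.map x) ∈ (𝔛.ideal Y.1).subsp B.1 := by
    intro B x
    refine e.map_ten_mem (N := (𝔛.ideal Y.1).subsp B.1)
      ((𝔛.ideal Y.1).isClosed_subsp B.1) (fun {a} f g => ?_) x
    refine (he f g) ▸ ?_
    have ha : a.1.1 = X := congrArg Subtype.val (show a.1 = ⟨X, hX⟩ from a.2)
    exact (𝔛.ideal Y.1).act_mem (𝔛.resSub_le_ideal_subsp (a := ⟨a.1.1, ha⟩) Submodule.mem_top) g
  have hr := 𝔛.ideal_subsp_eq_range e' (fun {B} k => by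
    refine ModEmb.map_ten_mem (f := FullSub.incl S) (H := M) e'
      ((𝔛.ideal Y.1).isClosed_subsp B) (fun {d} x g => ?_) k
    have e1 : e'.map (tens (FullSub.incl S) M.toHilbertModule x g) =
      comp (C := C) (e.map x) g := he' x g
    exact e1 ▸ (𝔛.ideal Y.1).act_mem (hM x) g) (by
    rintro ⟨X', hX'⟩ f -
    obtain rfl : X' = X := hX'
    let a : 𝔄.objs := ⟨⟨X', hX⟩, rfl⟩
    refine ⟨tens (FullSub.incl S) M.toHilbertModule
      (ten 𝔄.incl (𝔄.res.obj Y) (d := a) (⟨f, Submodule.mem_top⟩ : 𝔄.resSub Y a)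
        (UnitalStarCat.one _)) (UnitalStarCat.one _), ?_⟩
    refine (he' _ _).trans ((UnitalStarCat.comp_one _).trans ((he (a := a) _ _).trans ?_))
    exact UnitalStarCat.comp_one (C := C) f)
  obtain ⟨φ, hφ, hφe⟩ :=
    (weaklyDense_iff h1 (K := bcObj (FullSub.incl S) M) e' hr).1 (h Y.1 Y.2)
  refine ⟨φ, hφ, fun {a} f => ?_⟩
  have e1 : (P.induced h1 hS).cone 𝔄.incl (H := 𝔄.res.obj Y) f =
    P.cone (FullSub.incl S) (incl₁ 𝔄.incl (𝔄.res.obj Y) f) := induced_emb h1 hS _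
  refine (congrArg (fun z => comp (C := C) φ z) e1).trans ((hφe _).trans ((he' _ _).trans ?_))
  exact (UnitalStarCat.comp_one (C := C) _).trans
    ((he f _).trans (UnitalStarCat.comp_one (C := FullSub S) _))

end PreComplete

end

end HilbCat

theorem mainTheorem8 (C : Type u) [CStarCat C] [UnitalStarCat C] [LocSmall.{v} C]
    (P : PreComplete.{v} C) (h1 : P.C1) (h3 : P.C3) :
    (∀ X Y : C, P.QuasiContained Y X ↔
      ∃ H : SmallHilb.{v} (HeredSubcat.fullOn X).Cat,
        Iso Y ((P.push (HeredSubcat.fullOn X).incl).obj H)) ∧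
    (∀ (𝔄 : HeredSubcat C) (Y : C), P.WeaklyContained Y 𝔄 ↔
      ∃ H : SmallHilb.{v} 𝔄.Cat, Iso Y ((P.push 𝔄.incl).obj H)) ∧
    ((∀ X : C, P.QuasiContained X X) ∧
      ∀ X Y Z : C, P.QuasiContained Z Y → P.QuasiContained Y X → P.QuasiContained Z X) ∧
    (∀ 𝔄 : HeredSubcat C, 𝔄.IsTotal →
      (P.preClosure 𝔄).IsClosure ∧
      ∃ (hF : ∀ H : SmallHilb.{v} 𝔄.Cat, (P.preClosure 𝔄).IsClosedObj H →
            P.WeaklyContained ((P.push 𝔄.incl).obj H) 𝔄)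
        (hG : ∀ Y : C, P.WeaklyContained Y 𝔄 → (P.preClosure 𝔄).IsClosedObj (𝔄.res.obj Y)),
        IsEquivalence
          ((P.push 𝔄.incl).restrict (P.preClosure 𝔄).IsClosedObj
            (fun Y => P.WeaklyContained Y 𝔄) hF)
          (𝔄.res.restrict (fun Y => P.WeaklyContained Y 𝔄) (P.preClosure 𝔄).IsClosedObj hG)) ∧
    (∀ 𝔄 : HeredSubcat C, 𝔄.IsTotal →
      (P.Generating 𝔄 ↔ ∀ Y : C, P.WeaklyContained Y 𝔄)) ∧
    (∀ X : C,
      P.IsPreCompleteFullSub (fun Y => P.QuasiContained Y X) ∧ P.QuasiContained X X ∧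
      ∀ S : C → Prop, P.IsPreCompleteFullSub S → S X → ∀ Y : C, P.QuasiContained Y X → S Y) ∧
    (∀ (X : C) (S : C → Prop) (hS : P.IsPreCompleteFullSub S) (hX : S X),
      (P.induced h1 hS).Generating (HeredSubcat.fullOn (⟨X, hX⟩ : FullSub S)) ↔
        ∀ Y : C, S Y ↔ P.QuasiContained Y X) := by
  refine ⟨fun X Y => PreComplete.weaklyContained_iff h1 h3 _ Y, PreComplete.weaklyContained_iff h1 h3,
    ⟨PreComplete.quasiContained_refl h1, fun X Y Z hZ hY => hZ.trans h1 h3 hY⟩, fun 𝔄 _ => ?_,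
    fun 𝔄 _ => PreComplete.generating_iff h1 h3, fun X => ?_, fun X S hS hX => ?_⟩
  · have hF : ∀ H : SmallHilb.{v} 𝔄.Cat, (P.preClosure 𝔄).IsClosedObj H →
        P.WeaklyContained ((P.push 𝔄.incl).obj H) 𝔄 := fun H _ =>
      PreComplete.weaklyContained_push h1 h3 H
    have hG : ∀ Y : C, P.WeaklyContained Y 𝔄 →
        (P.preClosure 𝔄).IsClosedObj (𝔄.res.obj Y) := fun Y hY => hY.isClosedObj_res h1
    exact ⟨PreComplete.isClosure_preClosure h1 h3 𝔄, hF, hG,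
      PreComplete.isEquivalence_push_res h1 𝔄 hF hG⟩
  · exact ⟨PreComplete.isPreCompleteFullSub_quasiContained h1 h3 X,
      PreComplete.quasiContained_refl h1 X,
      fun S hS hX Y hY => hS.of_quasiContained h1 h3 hX hY⟩
  · exact ⟨fun hg Y => ⟨PreComplete.quasiContained_of_generating_induced hX h1 h3 hS hg,
        hS.of_quasiContained h1 h3 hX⟩,
      fun h => PreComplete.generating_induced hX h1 hS fun Y => (h Y).1⟩
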